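/- Let $k$ be a commutative artinian ring and let $\Lambda$ be a Nakayama algebra over $k$, i.e. a $k$-algebra which is finitely generated as a $k$-module and all of whose indecomposable projective left and right modules are uniserial. Assume that no simple left $\Lambda$-module is projective. Let $\operatorname{mod}\Lambda$ be the category of left $\Lambda$-modules of finite length (equivalently, of finitely generated left $\Lambda$-modules). A complete projective resolution is an exact complex $P_\bullet=(P_i,\delta_i)_{i\in\mathbb Z}$ of projective modules in $\operatorname{mod}\Lambda$ such that the complex $\operatorname{Hom}_\Lambda(P_\bullet,\Lambda)$ is exact; a module is Gorenstein projective if it is isomorphic to $\operatorname{Im}\delta_0$ for some complete projective resolution. Let $\operatorname{gp}\Lambda$ be the full subcategory of $\operatorname{mod}\Lambda$ of Gorenstein projective modules, and let $\mathcal C=\mathcal C(\Lambda)$ (the Gorenstein core) be the full subcategory of all modules isomorphic to a finite direct sum of indecomposable non-projective Gorenstein projective modules and projective covers of such modules. Then the following hold. (1) $\mathcal C$ is an exact abelian subcategory of $\operatorname{mod}\Lambda$ (that is, $\mathcal C$ is abelian and the inclusion functor $\mathcal C\to\operatorname{mod}\Lambda$ is exact), and $\mathcal C$ is closed under extensions,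 under projective covers, and under minimal left $\Lambda$-approximations (if $M\in\mathcal C$ and $M\to P$ is a minimal left approximation of $M$ by finitely generated projective modules, then $P\in\mathcal C$). (2) There is a Nakayama algebra $\Lambda'$ over $k$ which is self-injective, together with a $k$-linear equivalence $\operatorname{mod}\Lambda'\to\mathcal C$, such that $\mathcal C\subseteq\operatorname{gp}\Lambda$ and the composition $\operatorname{mod}\Lambda'\to\mathcal C\to\operatorname{gp}\Lambda$ of this equivalence with the inclusion functor induces an equivalence $\underline{\operatorname{mod}}\,\Lambda'\to\underline{\operatorname{gp}}\,\Lambda$. Here $\underline{\operatorname{mod}}\,\Lambda'$ and $\underline{\operatorname{gp}}\,\Lambda$ are the factor categories of $\operatorname{mod}\Lambda'$ and $\operatorname{gp}\Lambda$ modulo the ideal of all maps which factor through a projective module. (3) If $\Lambda$ is connected and $\mathcal C$ contains a non-zero module, then the algebra $\Lambda'$ in (2) is connected. -/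

import Mathlib

open CategoryTheory CategoryTheory.Limits

universe v u w

section Modules

/-- A module is uniserial if its submodules are linearly ordered by inclusion. -/
def IsUniserialModule (R : Type u) [Ring R] (M : Type w) [AddCommGroup M] [Module R M] : Prop :=
  ∀ U V : Submodule R M, U ≤ V ∨ V ≤ U

/-- A module is indecomposable if it is nonzero and not the direct sum of two nonzero
submodules. -/
def IsIndecomposableModule (R : Type u) [Ring R] (M : Type w) [AddCommGroup M] [Module R M] :
    Prop :=
  Nontrivial M ∧ ∀ U V : Submodule R M, IsCompl U V → U = ⊥ ∨ V = ⊥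

/-- `f : P → M` is a projective cover: `P` is projective, `f` is surjective and the kernel of `f`
is a superfluous (small) submodule. -/
structure IsProjectiveCover {R : Type u} [Ring R] {P M : Type w} [AddCommGroup P] [Module R P]
    [AddCommGroup M] [Module R M] (f : P →ₗ[R] M) : Prop where
  projective : Module.Projective R P
  surjective : Function.Surjective f
  superfluous : ∀ U : Submodule R P, U ⊔ LinearMap.ker f = ⊤ → U = ⊤

/-- `f : M → P` is a minimal left `R`-approximation, that is, a minimal left
approximation with respect to `add R`, the finitely generated projective modules. -/
structure IsMinimalLeftApproximation {R : Type u} [Ring R] {M P : Type u} [AddCommGroup M]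
    [Module R M] [AddCommGroup P] [Module R P] (f : M →ₗ[R] P) : Prop where
  finite : Module.Finite R P
  projective : Module.Projective R P
  factors : ∀ (Q : Type u) [AddCommGroup Q] [Module R Q] [Module.Finite R Q]
    [Module.Projective R Q] (g : M →ₗ[R] Q), ∃ h : P →ₗ[R] Q, h ∘ₗ f = g
  minimal : ∀ h : P →ₗ[R] P, h ∘ₗ f = f → Function.Bijective h

end Modules

section Algebras

/-- A Nakayama algebra over `k`: an artin algebra (a `k`-algebra that is finitely generated as a
module over the commutative artinian ring `k`) all of whose indecomposable projective left and
right modules are uniserial. -/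
structure IsNakayamaAlgebra (k : Type v) (A : Type u) [CommRing k] [Ring A] [Algebra k A] :
    Prop where
  artinian : IsArtinianRing k
  finite : Module.Finite k A
  left_uniserial : ∀ (P : Type u) [AddCommGroup P] [Module A P] [Module.Finite A P]
    [Module.Projective A P], IsIndecomposableModule A P → IsUniserialModule A P
  right_uniserial : ∀ (P : Type u) [AddCommGroup P] [Module Aᵐᵒᵖ P] [Module.Finite Aᵐᵒᵖ P]
    [Module.Projective Aᵐᵒᵖ P], IsIndecomposableModule Aᵐᵒᵖ P → IsUniserialModule Aᵐᵒᵖ P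

/-- A ring is connected if it is nonzero and its only central idempotents are `0` and `1`. -/
def IsConnectedAlgebra (A : Type u) [Ring A] : Prop :=
  Nontrivial A ∧ ∀ e : A, IsIdempotentElem e → e ∈ Subring.center A → e = 0 ∨ e = 1

end Algebras

section Gorenstein

variable (A : Type u) [Ring A]

/-- A complete projective resolution: an exact complex
`⋯ → P (i + 1) → P i → ⋯`, indexed by the integers, of finitely generated projective `A`-modules
such that the complex `Hom_A(P, A)` is exact, too. -/
structure CompleteProjectiveResolution where
  P : ℤ → FGModuleCat.{u} A
  projective : ∀ i, Module.Projective A (P i)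
  d : ∀ i, P (i + 1) →ₗ[A] P i
  exact : ∀ i, Function.Exact (d (i + 1)) (d i)
  hom_exact : ∀ i, Function.Exact (fun g : P i →ₗ[A] A => g ∘ₗ d i)
    (fun g : P (i + 1) →ₗ[A] A => g ∘ₗ d (i + 1))

/-- The finitely generated projective modules, as a full subcategory of `mod A`. -/
def projMod : ObjectProperty (FGModuleCat.{u} A) :=
  fun M => Module.Projective A M

/-- The category `gp A` of Gorenstein projective modules, as a full subcategory of `mod A`: the
modules isomorphic to the image of a differential of a complete projective resolution. -/
def gorensteinProj : ObjectProperty (FGModuleCat.{u} A) :=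
  fun M => ∃ K : CompleteProjectiveResolution A, Nonempty (M ≃ₗ[A] LinearMap.range (K.d 0))

/-- The indecomposable non-projective Gorenstein projective modules. -/
def indecNonprojGorensteinProj : ObjectProperty (FGModuleCat.{u} A) :=
  fun M => IsIndecomposableModule A M ∧ ¬ Module.Projective A M ∧ gorensteinProj A M

/-- The modules that are an indecomposable non-projective Gorenstein projective
module or the projective cover of such a module. -/
def gorensteinCoreIndec : ObjectProperty (FGModuleCat.{u} A) :=
  fun X => indecNonprojGorensteinProj A X ∨
    ∃ (M : FGModuleCat.{u} A) (f : X →ₗ[A] M),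
      indecNonprojGorensteinProj A M ∧ IsProjectiveCover f

/-- The Gorenstein core, as a full subcategory of `mod A`: the modules
isomorphic to a finite (possibly empty) direct sum of indecomposable non-projective Gorenstein
projective modules and projective covers of such modules. -/
def gorensteinCore : ObjectProperty (FGModuleCat.{u} A) :=
  fun M => ∃ (n : ℕ) (X : Fin n → FGModuleCat.{u} A),
    (∀ i, gorensteinCoreIndec A (X i)) ∧ Nonempty (M ≃ₗ[A] (∀ i, X i))

variable {A}

/-- A full subcategory of `mod A` is closed under projective covers. -/
def IsClosedUnderProjectiveCovers (C : ObjectProperty (FGModuleCat.{u} A)) : Prop :=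
  ∀ (M P : FGModuleCat.{u} A) (f : P →ₗ[A] M), C M → IsProjectiveCover f → C P

/-- A full subcategory of `mod A` is closed under minimal left `A`-approximations. -/
def IsClosedUnderMinimalLeftApproximations (C : ObjectProperty (FGModuleCat.{u} A)) : Prop :=
  ∀ (M P : FGModuleCat.{u} A) (f : M →ₗ[A] P), C M → IsMinimalLeftApproximation f → C P

end Gorenstein

section Categories

/-- A full subcategory is an exact abelian subcategory if it is an abelian category and its
inclusion functor is exact. -/
def IsExactAbelianSubcategory {B : Type u} [Category.{v} B] (C : ObjectProperty B) : Prop :=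
  Nonempty (Abelian C.FullSubcategory) ∧ PreservesFiniteLimits C.ι ∧ PreservesFiniteColimits C.ι

/-- Two parallel morphisms are identified if their difference factors through an object
in `Pr`. -/
def stableRel {B : Type u} [Category.{v} B] [Preadditive B] (Pr : ObjectProperty B) : HomRel B :=
  fun X Y f g => ∃ P : B, Pr P ∧ ∃ (a : X ⟶ P) (b : P ⟶ Y), f - g = a ≫ b

variable (A : Type u) [Ring A]

/-- The relation on `mod A` that defines the stable category: the
difference factors through a projective module. -/
abbrev stableModRel : HomRel (FGModuleCat.{u} A) := stableRel (projMod A)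

/-- The relation on `gp A` that defines the stable category: the
difference factors through a projective module. -/
abbrev stableGpRel : HomRel (gorensteinProj A).FullSubcategory :=
  stableRel ((projMod A).inverseImage (gorensteinProj A).ι)

/-- The stable category of `mod A`. -/
abbrev StableMod := CategoryTheory.Quotient (stableModRel A)

/-- The stable category of `gp A`. -/
abbrev StableGp := CategoryTheory.Quotient (stableGpRel A)

variable {A}

/-- A functor from `mod A'` to a full subcategory of `mod A` is `k`-linear, where `k` acts on
homomorphisms by `(c • f) x = c • f x`: it is additive and takes `c • f` to `c • F f`. -/
def IsLinearOver (k : Type v) [CommRing k] [Algebra k A] {A' : Type u} [Ring A'] [Algebra k A']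
    {C : ObjectProperty (FGModuleCat.{u} A)} (F : FGModuleCat.{u} A' ⥤ C.FullSubcategory) : Prop :=
  F.Additive ∧ ∀ (X Y : FGModuleCat.{u} A') (f g : X ⟶ Y) (c : k),
    (∀ x : X, g.hom.hom x = algebraMap k A' c • f.hom.hom x) →
      ∀ y : (F.obj X).obj, (F.map g).hom.hom.hom y = algebraMap k A c • (F.map f).hom.hom.hom y

/-- The functor `F : mod A' ⥤ C`, followed by the inclusion of `C` into `gp A`, induces an
equivalence from the stable category of `mod A'` onto the stable category of `gp A`. -/
def InducesStableEquivalence {A' : Type u} [Ring A'] {C : ObjectProperty (FGModuleCat.{u} A)}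
    (hC : C ≤ gorensteinProj A) (F : FGModuleCat.{u} A' ⥤ C.FullSubcategory) : Prop :=
  let G : FGModuleCat.{u} A' ⥤ StableGp A :=
    F ⋙ ObjectProperty.ιOfLE hC ⋙ CategoryTheory.Quotient.functor (stableGpRel A)
  ∃ H : ∀ (X Y : FGModuleCat.{u} A') (f g : X ⟶ Y),
      stableModRel A' f g → G.map f = G.map g,
    (CategoryTheory.Quotient.lift (stableModRel A') G H).IsEquivalence

end Categories

/-! ### Indecomposable and uniserial modules, Fitting's lemma, decompositions. -/

section Modules

/-! Write `1` as a sum of primitive idempotents `e i`. A map `A (e i) → A (e j)` is right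
multiplication by an element of `e i A e j`, and the uniseriality hypotheses say that of two such
elements with a common source, or with a common target, one divides the other. Most of the argument
is divisibility of this kind. Indecomposable modules are cyclic (`IsSerialSystem.exists_generator`),
so an indecomposable non-projective Gorenstein projective module is the cokernel of a single arrow,
and this arrow continues on both sides by arrows, consecutive ones forming exact pairs
(`exists_pred`, `exists_succ`). The vertices that occur as targets form `gorensteinIndex`.

The decisive lemma is `exists_isExactPair_right` with its dual: whether an arrow has an exact
continuation depends only on the vertex where it starts. Hence any arrow between two vertices of
`gorensteinIndex` extends in both directions to a complete resolution, and its cokernel is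
Gorenstein projective.

Next the core is described by a linear condition. Each `A (e s)` has a left approximation `a s : A
(e s) → A (ε s)` by the `A (e t)` with `t` in `gorensteinIndex`; its target is zero or one such
module, and maps from the target to these modules are determined by their composition with `a s`.
The core consists exactly of the modules `X` for which every `a s` induces a bijection `Hom (A (ε
s)) X → Hom (A (e s)) X` (`IsCoreFamily.gorensteinCore_iff`). Both sides are exact in `X`, so
closure under kernels, cokernels and extensions is the five lemma.

The direct sum `G` of the `A (ε s)` is the reflection of `A` in the core: for `X` in the core,
evaluation at `unit` identifies `Hom G X` with `X`. This yields a ring homomorphism from `A` to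
`CoreRing`, the opposite endomorphism ring of `G`, along which restriction of scalars is an
equivalence onto the core. `CoreRing` inherits the divisibility conditions. It is self-injective by
Baer's criterion: its quotient by a left ideal is Gorenstein projective over `A`, so maps from the
ideal extend. Stably nothing is lost, since a Gorenstein projective module is a core module plus a
projective one, and a map of core modules that factors through a projective module factors through a
projective in the core. Finally, a central idempotent of `CoreRing` is `0` or `1` on each summand of
`G`, and the vertices where it does not vanish define a central idempotent of `A`. -/

theorem IsIndecomposableModule.of_equiv {R : Type u} [Ring R] {M N : Type*} [AddCommGroup M]
    [Module R M] [AddCommGroup N] [Module R N] (f : M ≃ₗ[R] N) (h : IsIndecomposableModule R M) :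
    IsIndecomposableModule R N := by
  refine ⟨f.symm.toEquiv.nontrivial_congr.mpr h.1, fun U V hUV => ?_⟩
  have := h.2 _ _ (((Submodule.orderIsoMapComap f.symm).isCompl_iff).mp hUV)
  simpa using this

theorem IsUniserialModule.of_injective {R : Type u} [Ring R] {M N : Type*} [AddCommGroup M]
    [Module R M] [AddCommGroup N] [Module R N] (f : M →ₗ[R] N) (hf : Function.Injective f)
    (h : IsUniserialModule R N) : IsUniserialModule R M := by
  intro U V
  simpa [Submodule.map_le_map_iff_of_injective hf] using h (U.map f) (V.map f)

theorem IsUniserialModule.of_surjective {R : Type u} [Ring R] {M N : Type*} [AddCommGroup M]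
    [Module R M] [AddCommGroup N] [Module R N] (f : M →ₗ[R] N) (hf : Function.Surjective f)
    (h : IsUniserialModule R M) : IsUniserialModule R N := by
  intro U V
  simpa [Submodule.comap_le_comap_iff_of_surjective hf] using h (U.comap f) (V.comap f)

theorem IsUniserialModule.isIndecomposable {R : Type u} [Ring R] {M : Type*} [AddCommGroup M]
    [Module R M] [Nontrivial M] (h : IsUniserialModule R M) : IsIndecomposableModule R M := by
  refine ⟨inferInstance, fun U V hUV => ?_⟩
  rcases h U V with h | h
  · exact Or.inl (by simpa [inf_eq_left.mpr h] using hUV.inf_eq_bot)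
  · exact Or.inr (by simpa [inf_eq_right.mpr h] using hUV.inf_eq_bot)

/-- Fitting's lemma for indecomposable modules of finite length. -/
theorem IsIndecomposableModule.isUnit_or_isNilpotent {R : Type u} [Ring R] {M : Type*}
    [AddCommGroup M] [Module R M] [IsArtinian R M] [IsNoetherian R M]
    (h : IsIndecomposableModule R M) (f : Module.End R M) : IsUnit f ∨ IsNilpotent f := by
  obtain ⟨n, hn⟩ := Filter.eventually_atTop.mp f.eventually_isCompl_ker_pow_range_pow
  have hc := hn (n + 1) (by omega)
  rcases h.2 _ _ hc with h0 | h0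
  · left
    have h1 : LinearMap.range (f ^ (n + 1)) = ⊤ := by simpa [h0] using hc.sup_eq_top
    rw [Module.End.isUnit_iff]
    constructor
    · have := LinearMap.ker_eq_bot.mp h0
      rw [pow_succ] at this
      exact Function.Injective.of_comp (f := (f ^ n : Module.End R M)) this
    · have := LinearMap.range_eq_top.mp h1
      rw [pow_succ'] at this
      exact Function.Surjective.of_comp (g := (f ^ n : Module.End R M)) this
  · right
    exact ⟨n + 1, LinearMap.range_eq_bot.mp h0⟩

/-- Normalise the sum to `1`: a non-unit term becomes nilpotent, one minus it is a unit, and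
induction applies to the remaining terms. -/
theorem exists_isUnit_of_sum_isUnit {R : Type*} [Ring R] [Nontrivial R]
    (h : ∀ x : R, IsUnit x ∨ IsNilpotent x) {ι : Type*} (s : Finset ι) (f : ι → R)
    (hf : IsUnit (∑ i ∈ s, f i)) : ∃ i ∈ s, IsUnit (f i) := by
  classical
  induction s using Finset.induction_on with
  | empty => simp at hf
  | insert a s ha ih =>
    rw [Finset.sum_insert ha] at hf
    obtain ⟨v, hv⟩ := hf
    by_cases h1 : IsUnit (f a)
    · exact ⟨a, by simp, h1⟩
    · have h2 : ¬ IsUnit ((v⁻¹ : Rˣ) * f a) := by simpa using h1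
      have h3 := (h _).resolve_left h2
      have h4 : (v⁻¹ : Rˣ) * ∑ i ∈ s, f i = 1 - (v⁻¹ : Rˣ) * f a := by
        rw [eq_sub_iff_add_eq, add_comm, ← mul_add, ← hv, Units.inv_mul]
      have h5 := h3.isUnit_one_sub
      rw [← h4] at h5
      obtain ⟨i, hi, hu⟩ := ih (by simpa using h5)
      exact ⟨i, by simp [hi], hu⟩

theorem exists_equiv_pi_indecomposable_of_length_le {R : Type u} [Ring R] (n : ℕ) :
    ∀ (M : Type u) [AddCommGroup M] [Module R M] [Module.Finite R M],
      Module.length R M ≤ n → ∃ (ι : Type) (_ : Fintype ι) (X : ι → FGModuleCat.{u} R),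
        (∀ i, IsIndecomposableModule R (X i)) ∧ Nonempty (M ≃ₗ[R] (∀ i, X i)) := by
  induction n with
  | zero =>
    intro M _ _ _ h
    have : Subsingleton M := by
      rw [← Module.length_eq_zero_iff (R := R)]; simpa using h
    exact ⟨PEmpty, inferInstance, fun i => i.elim, fun i => i.elim,
      ⟨{ toFun := fun _ i => i.elim, invFun := fun _ => 0, map_add' := fun _ _ => by ext i; exact i.elim,
         map_smul' := fun _ _ => by ext i; exact i.elim, left_inv := fun _ => Subsingleton.elim _ _,
         right_inv := fun _ => by ext i; exact i.elim }⟩⟩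
  | succ n ih =>
    intro M _ _ _ h
    by_cases hM : IsIndecomposableModule R M
    · exact ⟨PUnit, inferInstance, fun _ => FGModuleCat.of R M, fun _ => hM,
        ⟨(LinearEquiv.funUnique PUnit R M).symm⟩⟩
    by_cases hs : Subsingleton M
    · exact ih M (by simp)
    rw [not_subsingleton_iff_nontrivial] at hs
    simp only [IsIndecomposableModule, hs, true_and, not_forall, not_or] at hM
    obtain ⟨U, V, hUV, hU, hV⟩ := hM
    have e := Submodule.prodEquivOfIsCompl U V hUV
    have hl : Module.length R M = Module.length R U + Module.length R V := by
      rw [← e.length_eq, Module.length_prod]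
    have hpos : ∀ W : Submodule R M, W ≠ ⊥ → 1 ≤ Module.length R W := by
      intro W hW
      have := (Submodule.nontrivial_iff_ne_bot.mpr hW)
      rw [Order.one_le_iff_ne_zero]
      exact (Module.length_pos (R := R) (M := W)).ne'
    have hU1 := hpos U hU
    have hV1 := hpos V hV
    rw [hl] at h
    have hlt : ∀ a b : ℕ∞, 1 ≤ b → a + b ≤ ((n + 1 : ℕ) : ℕ∞) → a ≤ n := by
      intro a b hb hab
      have : a + 1 ≤ (n : ℕ∞) + 1 := (add_le_add le_rfl hb).trans (by simpa using hab)
      exact (ENat.add_le_add_iff_right (by simp)).mp this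
    have : Module.Finite R U := Module.Finite.equiv
      (Submodule.quotientEquivOfIsCompl V U hUV.symm)
    have : Module.Finite R V := Module.Finite.equiv
      (Submodule.quotientEquivOfIsCompl U V hUV)
    obtain ⟨ι₁, _, X₁, h₁, ⟨e₁⟩⟩ := ih U (hlt _ _ hV1 h)
    obtain ⟨ι₂, _, X₂, h₂, ⟨e₂⟩⟩ := ih V (hlt _ _ hU1 (by rwa [add_comm]))
    refine ⟨ι₁ ⊕ ι₂, inferInstance, Sum.elim X₁ X₂, ?_, ⟨?_⟩⟩
    · rintro (i | i)
      · exact h₁ i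
      · exact h₂ i
    · exact e.symm.trans ((e₁.prodCongr e₂).trans
        (LinearEquiv.sumPiEquivProdPi R ι₁ ι₂ (fun i => (Sum.elim X₁ X₂ i : FGModuleCat R))).symm)

/-- A finitely generated module over an artinian ring is a finite direct sum of indecomposable
modules. -/
theorem exists_equiv_pi_indecomposable {R : Type u} [Ring R] [IsArtinianRing R]
    (M : Type u) [AddCommGroup M] [Module R M] [Module.Finite R M] :
    ∃ (n : ℕ) (X : Fin n → FGModuleCat.{u} R),
      (∀ i, IsIndecomposableModule R (X i)) ∧ Nonempty (M ≃ₗ[R] (∀ i, X i)) := by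
  have hfin : Module.length R M ≠ ⊤ := Module.length_ne_top
  obtain ⟨n, hn⟩ := ENat.ne_top_iff_exists.mp hfin
  obtain ⟨ι, _, X, hX, ⟨e⟩⟩ := exists_equiv_pi_indecomposable_of_length_le n M hn.ge
  let g := (Fintype.equivFin ι).symm
  exact ⟨_, fun i => X (g i), fun i => hX _,
    ⟨e.trans (LinearEquiv.piCongrLeft R (fun i => (X i : FGModuleCat R)) g).symm⟩⟩

end Modules

/-! ### Primitive idempotents and uniserial projective modules. -/

section SerialRings

/-- For an idempotent `f`, the projective left ideal `A f`. -/
def leftIdeal {A : Type u} [Ring A] (f : A) : Submodule A A where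
  carrier := {x | x * f = x}
  add_mem' {a b} ha hb := by
    change (a + b) * f = a + b
    rw [add_mul, show a * f = a from ha, show b * f = b from hb]
  zero_mem' := zero_mul f
  smul_mem' c x hx := by
    change c * x * f = c * x
    rw [mul_assoc, show x * f = x from hx]

theorem mem_leftIdeal {A : Type u} [Ring A] {f x : A} : x ∈ leftIdeal f ↔ x * f = x := Iff.rfl

/-- Complete orthogonal primitive idempotents in a ring such that the corresponding projective left
and right modules are uniserial, with the corner rings satisfying Fitting's lemma. -/
structure IsSerialSystem {A : Type u} [Ring A] {ι : Type} [Fintype ι] (e : ι → A) : Prop where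
  coi : CompleteOrthogonalIdempotents e
  ne_zero : ∀ i, e i ≠ 0
  left : ∀ i a b, a * e i = a → b * e i = b → (∃ w, a = w * b) ∨ ∃ w, b = w * a
  right : ∀ i a b, e i * a = a → e i * b = b → (∃ w, a = b * w) ∨ ∃ w, b = a * w
  prim : ∀ i x, x * x = x → e i * x = x → x * e i = x → x = 0 ∨ x = e i
  nil : ∀ i x, e i * x = x → x * e i = x → (∃ y, y * x = e i) ∨ IsNilpotent x

/-- The idempotents are the components of `1` in a decomposition of the regular module; right
multiplication by `e i` is then the projection onto the `i`-th summand. -/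
theorem exists_completeOrthogonalIdempotents {A : Type u} [Ring A] [IsArtinianRing A] :
    ∃ (n : ℕ) (e : Fin n → A), CompleteOrthogonalIdempotents e ∧
      ∀ i, IsIndecomposableModule A (leftIdeal (e i)) := by
  obtain ⟨n, X, hX, ⟨φ⟩⟩ := exists_equiv_pi_indecomposable (R := A) A
  let e : Fin n → A := fun i => φ.symm (Pi.single i (φ 1 i))
  have h1 : ∀ x i, x * e i = φ.symm (Pi.single i (φ x i)) := by
    intro x i
    have : x * e i = x • e i := rfl
    rw [this, ← map_smul, ← Pi.single_smul, ← Pi.smul_apply, ← map_smul, smul_eq_mul, mul_one]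
  refine ⟨n, e, ⟨⟨fun i => ?_, fun i j hij => ?_⟩, ?_⟩, fun i => ?_⟩
  · change e i * e i = e i
    rw [h1]; simp [e]
  · change e i * e j = 0
    rw [h1]; simp [e, Pi.single_eq_of_ne hij.symm]
  · apply φ.injective
    rw [map_sum]
    simp only [e, LinearEquiv.apply_symm_apply]
    exact Finset.univ_sum_single (φ 1)
  · refine (hX i).of_equiv (LinearEquiv.ofBijective
      (LinearMap.codRestrict (leftIdeal (e i)) (φ.symm.toLinearMap ∘ₗ LinearMap.single A _ i) ?_) ⟨?_, ?_⟩)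
    · intro y
      simp [mem_leftIdeal, h1]
    · intro a b hab
      exact (φ.symm.injective.comp (Pi.single_injective i)) (congrArg Subtype.val hab)
    · rintro ⟨x, hx⟩
      refine ⟨φ x i, Subtype.ext ?_⟩
      rwa [mem_leftIdeal, h1] at hx

/-- An idempotent `x` of the corner splits `A f` into `A x` and `A f ∩ A (1 - x)`. -/
theorem primitive_of_isIndecomposable {A : Type u} [Ring A] {f : A} (hf : f * f = f)
    (h : IsIndecomposableModule A (leftIdeal f)) (x : A) (hx : x * x = x) (h1 : f * x = x)
    (h2 : x * f = x) : x = 0 ∨ x = f := by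
  let U : Submodule A (leftIdeal f) := (leftIdeal x).comap (leftIdeal f).subtype
  let V : Submodule A (leftIdeal f) := (leftIdeal (1 - x)).comap (leftIdeal f).subtype
  have hc : IsCompl U V := by
    constructor
    · rw [Submodule.disjoint_def]
      rintro ⟨y, hy⟩ hU hV
      have hU : y * x = y := hU
      have hV : y * (1 - x) = y := hV
      ext
      rw [mul_sub, hU] at hV
      simpa using hV.symm
    · rw [codisjoint_iff, eq_top_iff]
      rintro ⟨y, hy⟩ -
      rw [Submodule.mem_sup]
      have hy' : y * f = y := hy
      refine ⟨⟨y * x, by rw [mem_leftIdeal, mul_assoc, h2]⟩, ?_, ⟨y - y * x, ?_⟩, ?_, ?_⟩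
      · change y * x * x = y * x
        rw [mul_assoc, hx]
      · rw [mem_leftIdeal, sub_mul, mul_assoc, h2, hy']
      · change (y - y * x) * (1 - x) = y - y * x
        rw [mul_sub, sub_mul y (y * x) x, mul_assoc y x x, hx]; simp
      · ext; simp
  rcases h.2 U V hc with h | h
  · left
    have : (⟨x, h2⟩ : leftIdeal f) ∈ U := hx
    rw [h] at this
    exact congrArg Subtype.val ((Submodule.mem_bot _).mp this)
  · right
    have : (⟨f - x, by rw [mem_leftIdeal, sub_mul, hf, h2]⟩ : leftIdeal f) ∈ V := by
      change (f - x) * (1 - x) = f - x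
      rw [mul_sub, sub_mul f x x, h1, hx]; simp
    rw [h] at this
    have : f - x = 0 := congrArg Subtype.val ((Submodule.mem_bot _).mp this)
    exact (sub_eq_zero.mp this).symm

/-- The component `u` of `f` in `U` is an idempotent of the corner, and right multiplication by it
projects onto `U`. Since primitivity is left-right symmetric, this carries indecomposability from `A
f` to `f A`, so that right uniseriality applies to idempotents coming from a left decomposition. -/
theorem isIndecomposable_of_primitive {A : Type u} [Ring A] {f : A} (hf : f * f = f) (h0 : f ≠ 0)
    (h : ∀ x, x * x = x → f * x = x → x * f = x → x = 0 ∨ x = f) :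
    IsIndecomposableModule A (leftIdeal f) := by
  refine ⟨⟨⟨⟨f, hf⟩, 0, fun h => h0 (congrArg Subtype.val h)⟩⟩, fun U V hUV => ?_⟩
  obtain ⟨u, hu, v, hv, huv⟩ := Submodule.mem_sup.mp
    (show (⟨f, hf⟩ : leftIdeal f) ∈ U ⊔ V by rw [hUV.sup_eq_top]; trivial)
  have huf : u.1 * f = u.1 := u.2
  have hvf : v.1 * f = v.1 := v.2
  have hs : u.1 + v.1 = f := congrArg Subtype.val huv
  have hd := Submodule.disjoint_def.mp hUV.disjoint
  have key : ∀ y : leftIdeal f, y ∈ U → y.1 * u.1 = y.1 := by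
    intro y hy
    have hyf : y.1 * f = y.1 := y.2
    have h3 : y.1 • v ∈ V := V.smul_mem _ hv
    have h4 : y.1 • v = y - y.1 • u := by
      ext
      simp only [SetLike.val_smul, smul_eq_mul, AddSubgroupClass.coe_sub]
      rw [eq_sub_iff_add_eq, add_comm, ← mul_add, hs, hyf]
    have h5 := hd _ (h4 ▸ U.sub_mem hy (U.smul_mem _ hu)) h3
    rw [h4] at h5
    exact (sub_eq_zero.mp (congrArg Subtype.val h5)).symm
  have key2 : ∀ y : leftIdeal f, y ∈ V → y.1 * u.1 = 0 := by
    intro y hy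
    have hyf : y.1 * f = y.1 := y.2
    have h4 : y.1 • u = y - y.1 • v := by
      ext
      simp only [SetLike.val_smul, smul_eq_mul, AddSubgroupClass.coe_sub]
      rw [eq_sub_iff_add_eq, ← mul_add, hs, hyf]
    have h5 := hd _ (U.smul_mem y.1 hu) (h4 ▸ V.sub_mem hy (V.smul_mem _ hv))
    exact congrArg Subtype.val h5
  have hfu : f * u.1 = u.1 := by
    have := congrArg (· * u.1) hs
    simp only [add_mul, key u hu, key2 v hv, add_zero] at this
    exact this.symm
  rcases h u.1 (key u hu) hfu huf with h | h
  · left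
    rw [eq_bot_iff]
    intro y hy
    have := key y hy
    rw [h, mul_zero] at this
    exact (Submodule.mem_bot _).mpr (Subtype.ext this.symm)
  · right
    rw [eq_bot_iff]
    intro y hy
    have := key2 y hy
    have hyf : y.1 * f = y.1 := y.2
    rw [h, hyf] at this
    exact (Submodule.mem_bot _).mpr (Subtype.ext this)

theorem fitting_corner {A : Type u} [Ring A] [IsArtinianRing A] {f : A} (hf : f * f = f)
    (h : IsIndecomposableModule A (leftIdeal f)) (x : A) (h1 : f * x = x) (h2 : x * f = x) :
    (∃ y, y * x = f) ∨ IsNilpotent x := by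
  let r : Module.End A (leftIdeal f) :=
    LinearMap.restrict (LinearMap.toSpanSingleton A A x) (p := leftIdeal f) (q := leftIdeal f)
      (fun y _ => by simp [mem_leftIdeal, mul_assoc, h2])
  have hr : ∀ y, (r y).1 = y.1 * x := fun y => rfl
  rcases h.isUnit_or_isNilpotent r with hu | ⟨n, hn⟩
  · left
    obtain ⟨y, hy⟩ := ((Module.End.isUnit_iff r).mp hu).2 ⟨f, hf⟩
    exact ⟨y.1, by rw [← hr, hy]⟩
  · right
    have hp : ∀ n y, ((r ^ n) y).1 = y.1 * x ^ n := by
      intro n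
      induction n with
      | zero => simp
      | succ n ih => intro y; rw [pow_succ, Module.End.mul_apply, ih, hr, mul_assoc, pow_succ']
    refine ⟨n + 1, ?_⟩
    have := hp n ⟨f, hf⟩
    rw [hn] at this
    have h0 : f * x ^ n = 0 := this.symm
    rw [pow_succ']
    nth_rewrite 1 [← h1]
    rw [mul_assoc, ← pow_succ', pow_succ, ← mul_assoc, h0, zero_mul]

theorem leftIdeal_projective {A : Type u} [Ring A] {f : A} (hf : f * f = f) :
    Module.Projective A (leftIdeal f) := by
  refine Module.Projective.of_split (leftIdeal f).subtype
    (LinearMap.codRestrict (leftIdeal f) (LinearMap.toSpanSingleton A A f)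
      (fun y => by simp [mem_leftIdeal, mul_assoc, hf])) ?_
  ext y
  exact y.2

theorem leftIdeal_finite {A : Type u} [Ring A] {f : A} (hf : f * f = f) :
    Module.Finite A (leftIdeal f) := by
  refine Module.Finite.of_surjective
    (LinearMap.codRestrict (leftIdeal f) (LinearMap.toSpanSingleton A A f)
      (fun y => by simp [mem_leftIdeal, mul_assoc, hf])) ?_
  intro y
  exact ⟨y.1, Subtype.ext y.2⟩

theorem comparable_of_isUniserial {A : Type u} [Ring A] {f : A}
    (h : IsUniserialModule A (leftIdeal f)) (a b : A) (ha : a * f = a) (hb : b * f = b) :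
    (∃ w, a = w * b) ∨ ∃ w, b = w * a := by
  rcases h (Submodule.span A {⟨a, ha⟩}) (Submodule.span A {⟨b, hb⟩}) with h | h
  · obtain ⟨w, hw⟩ := Submodule.mem_span_singleton.mp (h (Submodule.mem_span_singleton_self _))
    exact Or.inl ⟨w, (congrArg Subtype.val hw).symm⟩
  · obtain ⟨w, hw⟩ := Submodule.mem_span_singleton.mp (h (Submodule.mem_span_singleton_self _))
    exact Or.inr ⟨w, (congrArg Subtype.val hw).symm⟩

theorem isUniserial_of_comparable {A : Type u} [Ring A] {f : A}
    (h : ∀ a b : A, a * f = a → b * f = b → (∃ w, a = w * b) ∨ ∃ w, b = w * a) :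
    IsUniserialModule A (leftIdeal f) := by
  intro U V
  by_contra! hc
  obtain ⟨⟨a, haU, haV⟩, ⟨b, hbV, hbU⟩⟩ := And.imp SetLike.not_le_iff_exists.mp
    SetLike.not_le_iff_exists.mp hc
  rcases h a.1 b.1 a.2 b.2 with ⟨w, hw⟩ | ⟨w, hw⟩
  · exact haV ((show a = w • b from Subtype.ext hw) ▸ V.smul_mem w hbV)
  · exact hbU ((show b = w • a from Subtype.ext hw) ▸ U.smul_mem w haU)

theorem isArtinianRing_of_finite (k : Type v) (A : Type u) [CommRing k] [Ring A] [Algebra k A]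
    [IsArtinianRing k] [Module.Finite k A] : IsArtinianRing A :=
  isArtinian_of_tower k (inferInstance : IsArtinian k A)

theorem IsNakayamaAlgebra.isArtinianRing {k : Type v} {A : Type u} [CommRing k] [Ring A]
    [Algebra k A] (h : IsNakayamaAlgebra k A) : IsArtinianRing A :=
  have := h.artinian
  have := h.finite
  isArtinianRing_of_finite k A

theorem IsNakayamaAlgebra.exists_isSerialSystem {k : Type v} {A : Type u} [CommRing k] [Ring A]
    [Algebra k A] (h : IsNakayamaAlgebra k A) :
    ∃ (n : ℕ) (e : Fin n → A), IsSerialSystem e := by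
  have := h.isArtinianRing
  obtain ⟨n, e, he, hi⟩ := exists_completeOrthogonalIdempotents (A := A)
  have hid : ∀ i, e i * e i = e i := he.idem
  have h0 : ∀ i, e i ≠ 0 := by
    intro i h0
    obtain ⟨y, hy⟩ := @exists_ne _ (hi i).1 (0 : leftIdeal (e i))
    refine hy (Subtype.ext ?_)
    have : y.1 * e i = y.1 := y.2
    rw [← this]
    simp [h0]
  have hp := fun i => primitive_of_isIndecomposable (hid i) (hi i)
  refine ⟨n, e, he, h0, fun i => ?_, fun i a b ha hb => ?_, hp,
    fun i => fitting_corner (hid i) (hi i)⟩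
  · have := leftIdeal_projective (hid i)
    have := leftIdeal_finite (hid i)
    exact comparable_of_isUniserial (h.left_uniserial _ (hi i))
  · have hid' : MulOpposite.op (e i) * MulOpposite.op (e i) = MulOpposite.op (e i) := by
      rw [← MulOpposite.op_mul, hid]
    have := leftIdeal_projective hid'
    have := leftIdeal_finite hid'
    have hi' : IsIndecomposableModule Aᵐᵒᵖ (leftIdeal (MulOpposite.op (e i))) := by
      refine isIndecomposable_of_primitive hid' (by simpa using h0 i) fun x hx h1 h2 => ?_
      have := hp i x.unop (by rw [← MulOpposite.unop_mul, hx])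
        (by simpa using congrArg MulOpposite.unop h2) (by simpa using congrArg MulOpposite.unop h1)
      exact this.imp (fun h => MulOpposite.unop_injective h) (fun h => MulOpposite.unop_injective h)
    rcases comparable_of_isUniserial (h.right_uniserial _ hi') (MulOpposite.op a)
      (MulOpposite.op b) (by rw [← MulOpposite.op_mul, ha]) (by rw [← MulOpposite.op_mul, hb])
      with ⟨w, hw⟩ | ⟨w, hw⟩
    · exact Or.inl ⟨w.unop, by simpa using congrArg MulOpposite.unop hw⟩
    · exact Or.inr ⟨w.unop, by simpa using congrArg MulOpposite.unop hw⟩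

/-- If the projective modules `A (e i)` are uniserial, then all indecomposable finitely generated
projective modules are. -/
theorem isUniserial_of_projective {A : Type u} [Ring A] [IsArtinianRing A] {ι : Type} [Fintype ι]
    {e : ι → A} (he : ∑ i, e i = 1) (hid : ∀ i, e i * e i = e i)
    (hl : ∀ i, ∀ a b : A, a * e i = a → b * e i = b → (∃ w, a = w * b) ∨ ∃ w, b = w * a)
    (P : Type w) [AddCommGroup P] [Module A P] [Module.Finite A P] [Module.Projective A P]
    (hP : IsIndecomposableModule A P) : IsUniserialModule A P := by
  obtain ⟨n, s, g, -, -, hs⟩ := Module.Finite.exists_comp_eq_id_of_projective A P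
  have := hP.1
  let r : ι → A →ₗ[A] A := fun i => LinearMap.toSpanSingleton A A (e i)
  -- Realise `P` as a retract of `A ^ n` and cut every coordinate by the idempotents. The identity
  -- of `P` becomes a sum of endomorphisms, each factoring through one `A (e i)`. One of them is a
  -- unit, so `P` embeds in a uniserial module.
  let F : Fin n × ι → Module.End A P := fun q =>
    s ∘ₗ LinearMap.single A (fun _ => A) q.1 ∘ₗ r q.2 ∘ₗ LinearMap.proj q.1 ∘ₗ g
  have hF : ∑ q, F q = 1 := by
    rw [← Module.End.one_eq_id] at hs
    rw [← hs]
    ext p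
    simp only [LinearMap.sum_apply, F, LinearMap.comp_apply, ← map_sum]
    congr 1
    ext l
    rw [Fintype.sum_prod_type]
    simp only [Finset.sum_apply, LinearMap.coe_single, LinearMap.proj_apply, r,
      LinearMap.toSpanSingleton_apply, smul_eq_mul]
    rw [Finset.sum_eq_single l]
    · simp [← Finset.mul_sum, he]
    · intro b _ hb
      simp [Pi.single_eq_of_ne hb.symm]
    · simp
  obtain ⟨q, -, hq⟩ := exists_isUnit_of_sum_isUnit (fun x => hP.isUnit_or_isNilpotent x)
    Finset.univ F (by rw [hF]; exact isUnit_one)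
  have hinj := ((Module.End.isUnit_iff _).mp hq).1
  refine IsUniserialModule.of_injective (LinearMap.codRestrict (leftIdeal (e q.2))
    (r q.2 ∘ₗ LinearMap.proj q.1 ∘ₗ g) (fun p => by simp [r, mem_leftIdeal, mul_assoc, hid])) ?_
    (isUniserial_of_comparable (hl q.2))
  intro a b hab
  have hab' : (a : P) = b := hinj (congrArg (s ∘ₗ LinearMap.single A (fun _ => A) q.1)
    (congrArg Subtype.val hab))
  exact hab'

end SerialRings

/-! ### Indecomposable modules over a serial ring are cyclic. -/

section CyclicModules

theorem length_span_le {A : Type u} [Ring A] {X Y : Type*} [AddCommGroup X] [Module A X]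
    [AddCommGroup Y] [Module A Y] (x : X) (y : Y) (h : ∀ r : A, r • x = 0 → r • y = 0) :
    ∃ f : Submodule.span A {x} →ₗ[A] Submodule.span A {y}, Function.Surjective f ∧
      ∀ r : A, (f ⟨r • x, Submodule.smul_mem _ _ (Submodule.mem_span_singleton_self x)⟩ : Y)
        = r • y := by
  let t := (LinearMap.toSpanSingleton A X x).rangeRestrict
  let ex : (A ⧸ LinearMap.ker (LinearMap.toSpanSingleton A X x)) ≃ₗ[A] Submodule.span A {x} :=
    (LinearMap.quotKerEquivRange _).trans (LinearEquiv.ofEq _ _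
      (LinearMap.range_toSpanSingleton x))
  let g : (A ⧸ LinearMap.ker (LinearMap.toSpanSingleton A X x)) →ₗ[A] Y :=
    Submodule.liftQ _ (LinearMap.toSpanSingleton A Y y) (fun r hr => h r hr)
  have hg : ∀ r : A, g (ex.symm ⟨r • x, Submodule.smul_mem _ _
      (Submodule.mem_span_singleton_self x)⟩) = r • y := by
    intro r
    have : ex (Submodule.Quotient.mk r) = ⟨r • x, Submodule.smul_mem _ _
      (Submodule.mem_span_singleton_self x)⟩ := rfl
    rw [← this, LinearEquiv.symm_apply_apply]
    rfl
  have hx : ∀ z : Submodule.span A {x}, ∃ r : A, z = ⟨r • x, Submodule.smul_mem _ _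
      (Submodule.mem_span_singleton_self x)⟩ := by
    rintro ⟨z, hz⟩
    obtain ⟨r, rfl⟩ := Submodule.mem_span_singleton.mp hz
    exact ⟨r, rfl⟩
  refine ⟨LinearMap.codRestrict _ (g ∘ₗ ex.symm.toLinearMap) ?_, ?_, hg⟩
  · intro z
    obtain ⟨r, rfl⟩ := hx z
    exact (hg r) ▸ Submodule.smul_mem _ _ (Submodule.mem_span_singleton_self y)
  · rintro ⟨z, hz⟩
    obtain ⟨r, rfl⟩ := Submodule.mem_span_singleton.mp hz
    exact ⟨_, Subtype.ext (hg r)⟩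

variable {A : Type u} [Ring A] {ι : Type} [Fintype ι] {e : ι → A}

theorem length_span_lt [IsArtinianRing A] {X Y : Type*} [AddCommGroup X] [Module A X]
    [AddCommGroup Y] [Module A Y] [Module.Finite A X] (x : X) (y : Y)
    (h : ∀ r : A, r • x = 0 → r • y = 0) (a : A) (hax : a • x ≠ 0) (hay : a • y = 0) :
    Module.length A (Submodule.span A {y}) < Module.length A (Submodule.span A {x}) := by
  obtain ⟨f, hf, hfr⟩ := length_span_le x y h
  have hl := Module.length_eq_add_of_exact (LinearMap.ker f).subtype f
    (Submodule.subtype_injective _) hf (LinearMap.exact_subtype_ker_map f)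
  have h1 : Nontrivial (LinearMap.ker f) := by
    rw [Submodule.nontrivial_iff_ne_bot]
    intro hb
    have := (LinearMap.mem_ker (f := f)).mpr (Subtype.ext ((hfr a).trans hay))
    rw [hb] at this
    exact hax (congrArg Subtype.val ((Submodule.mem_bot _).mp this))
  have h2 := Module.length_pos (R := A) (M := LinearMap.ker f)
  rw [hl]
  have h3 : Module.length A (Submodule.span A {y}) ≠ ⊤ := Module.length_ne_top
  exact ENat.lt_add_left h3 h2

/-- The annihilators of `y` and `y'` are governed by their traces on the uniserial module `A (e j)`,
hence are comparable. An element killing only `y'` decides which is larger, and `A y'` is a proper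
quotient of `A y`. -/
theorem IsSerialSystem.length_lt [IsArtinianRing A] (he : IsSerialSystem e) {X : Type*} [AddCommGroup X] [Module A X]
    [Module.Finite A X] {j : ι} {y y' : X} (hy : e j • y = y) (hy' : e j • y' = y') (a : A)
    (ha : a • y ≠ 0) (ha' : a • y' = 0) :
    Module.length A (Submodule.span A {y'}) < Module.length A (Submodule.span A {y}) := by
  have hid : e j * e j = e j := he.coi.idem j
  refine length_span_lt y y' (fun r hr => ?_) a ha ha'
  rcases he.left j (r * e j) (a * e j) (by rw [mul_assoc, hid]) (by rw [mul_assoc, hid])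
    with ⟨w, hw⟩ | ⟨w, hw⟩
  · rw [← hy', ← mul_smul, hw, mul_smul, mul_smul, hy', ha', smul_zero]
  · refine absurd ?_ ha
    rw [← hy, ← mul_smul, hw, mul_smul, mul_smul, hy, hr, smul_zero]

theorem IsSerialSystem.exists_smul_notMem (he : IsSerialSystem e) {X : Type*} [AddCommGroup X]
    [Module A X] {N : Submodule A X} {m : X} (hm : m ∉ N) : ∃ i, e i • m ∉ N := by
  by_contra! h
  refine hm ?_
  rw [← one_smul A m, ← he.coi.complete, Finset.sum_smul]
  exact N.sum_mem fun i _ => h i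

/-- Otherwise take `y` outside `A x`, fixed by some `e j`, with `A y` as short as possible. By
essentiality `A y` and `A x` share a nonzero element, and right divisibility of its two coefficients
lets a multiple of one generator be subtracted from a multiple of the other. The difference still
lies outside `A x` but generates a shorter module. -/
theorem IsSerialSystem.span_eq_top_of_essential [IsArtinianRing A] (he : IsSerialSystem e) {X : Type*}
    [AddCommGroup X] [Module A X] [Module.Finite A X] {i : ι} {x : X} (hx : e i • x = x)
    (hmax : ∀ j (y : X), e j • y = y →
      Module.length A (Submodule.span A {y}) ≤ Module.length A (Submodule.span A {x}))
    (hess : ∀ N : Submodule A X, N ≠ ⊥ → N ⊓ Submodule.span A {x} ≠ ⊥) :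
    Submodule.span A {x} = ⊤ := by
  by_contra hne
  have hid : ∀ j, e j * e j = e j := he.coi.idem
  obtain ⟨m, hm⟩ : ∃ m, m ∉ Submodule.span A {x} := by
    by_contra! h
    exact hne (eq_top_iff.mpr fun m _ => h m)
  let S : Set ℕ∞ := {n | ∃ j, ∃ y : X, e j • y = y ∧ y ∉ Submodule.span A {x} ∧
    Module.length A (Submodule.span A {y}) = n}
  obtain ⟨i₀, hi₀⟩ := he.exists_smul_notMem hm
  have hS : S.Nonempty := ⟨_, i₀, e i₀ • m, by rw [← mul_smul, hid], hi₀, rfl⟩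
  obtain ⟨n, ⟨j, y, hy, hyx, rfl⟩, hmin⟩ := wellFounded_lt.has_min S hS
  have hmin' : ∀ j' (y' : X), e j' • y' = y' → y' ∉ Submodule.span A {x} →
      ¬ Module.length A (Submodule.span A {y'}) < Module.length A (Submodule.span A {y}) :=
    fun j' y' h1 h2 => hmin _ ⟨j', y', h1, h2, rfl⟩
  have hxx := Submodule.mem_span_singleton_self (R := A) x
  have hN : Submodule.span A {y} ≠ ⊥ := by
    intro h0
    rw [Submodule.span_singleton_eq_bot] at h0
    exact hyx (h0 ▸ Submodule.zero_mem _)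
  obtain ⟨w₀, hw₀, hw₀0⟩ := Submodule.exists_mem_ne_zero_of_ne_bot (hess _ hN)
  obtain ⟨g, hg⟩ := he.exists_smul_notMem (N := ⊥) (m := w₀) (by simpa using hw₀0)
  rw [Submodule.mem_bot] at hg
  obtain ⟨a, ha⟩ := Submodule.mem_span_singleton.mp hw₀.1
  obtain ⟨b, hb⟩ := Submodule.mem_span_singleton.mp hw₀.2
  have ha' : (e g * a * e j) • y = e g • w₀ := by rw [mul_smul, hy, mul_smul, ha]
  have hb' : (e g * b * e i) • x = e g • w₀ := by rw [mul_smul, hx, mul_smul, hb]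
  have hne' : ∀ (c : A) (z : X), z ∉ Submodule.span A {x} → z - c • x ∉ Submodule.span A {x} :=
    fun c z hz h => hz (by simpa using Submodule.add_mem _ h (Submodule.smul_mem _ c hxx))
  rcases he.right g (e g * a * e j) (e g * b * e i) (by simp [← mul_assoc, hid])
    (by simp [← mul_assoc, hid]) with ⟨c, hc⟩ | ⟨c, hc⟩
  · have hz : e i • ((e i * c) • y) = (e i * c) • y := by rw [← mul_smul, ← mul_assoc, hid]
    have hbz : (e g * b * e i) • ((e i * c) • y) = e g • w₀ := by
      rw [← ha', hc, ← mul_smul, ← mul_assoc, mul_assoc (e g * b), hid]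
    set z := (e i * c) • y with hzdef
    have hzy : Submodule.span A {z} ≤ Submodule.span A {y} := by
      rw [Submodule.span_singleton_le_iff_mem]
      exact Submodule.smul_mem _ _ (Submodule.mem_span_singleton_self y)
    by_cases hzx : z ∈ Submodule.span A {x}
    -- Here subtraction would not help. Instead `A z` is strictly shorter than `A x`, so some `r`
    -- kills `z` but not `x`, whereas `e g * b * e i` sends both `z` and `x` to the same nonzero
    -- element. Comparability in `A (e i)` excludes this.
    · have hlt : Module.length A (Submodule.span A {z}) < Module.length A (Submodule.span A {x}) := by
        refine lt_of_lt_of_le ?_ (hmax j y hy)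
        rw [Module.length_submodule, Module.length_submodule]
        refine Submodule.height_strictMono (lt_of_le_of_ne hzy fun h => hyx ?_)
        have : y ∈ Submodule.span A {z} := h ▸ Submodule.mem_span_singleton_self y
        exact (Submodule.span_singleton_le_iff_mem _ _).mpr hzx this
      obtain ⟨r, hr, hrx⟩ : ∃ r : A, r • z = 0 ∧ r • x ≠ 0 := by
        by_contra! h
        obtain ⟨f, hf, -⟩ := length_span_le z x h
        exact absurd (Module.length_le_of_surjective f hf) (not_le.mpr hlt)
      rcases he.left i (r * e i) (e g * b * e i) (by rw [mul_assoc, hid])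
        (by rw [mul_assoc _ (e i), hid]) with ⟨s, hs⟩ | ⟨s, hs⟩
      · apply hrx
        rw [← hx, ← mul_smul, hs, mul_smul, hb', ← hbz, ← mul_smul, ← hs, mul_smul, hz, hr]
      · apply hg
        rw [← hbz, hs, mul_smul, mul_smul, hz, hr, smul_zero]
    · have hle := Module.length_le_of_injective (R := A) _ (Submodule.inclusion_injective hzy)
      refine hmin' i (z - (1 : A) • x) ?_ (hne' 1 z hzx) (lt_of_lt_of_le ?_ hle)
      · rw [one_smul, smul_sub, hz, hx]
      · refine he.length_lt hz (by rw [one_smul, smul_sub, hz, hx]) (e g * b * e i) ?_ ?_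
        · rw [hbz]; exact hg
        · rw [one_smul, smul_sub, hbz, hb', sub_self]
  · have hy' : e j • (y - (e j * c) • x) = y - (e j * c) • x := by
      rw [smul_sub, hy, ← mul_smul, ← mul_assoc, hid]
    refine hmin' j _ hy' (hne' _ y hyx) (he.length_lt hy hy' (e g * a * e j) ?_ ?_)
    · rw [ha']; exact hg
    · rw [smul_sub, ha', ← mul_smul, ← mul_assoc, mul_assoc (e g * a), hid, ← hc, hb', sub_self]

/-- Over a serial ring, an indecomposable finitely generated module is a quotient of some
`A (e i)`. -/
theorem IsSerialSystem.exists_generator [IsArtinianRing A] (he : IsSerialSystem e) {X : Type*}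
    [AddCommGroup X] [Module A X] [Module.Finite A X] (hX : IsIndecomposableModule A X) :
    ∃ (i : ι) (x : X), e i • x = x ∧ ∀ m : X, ∃ r : A, r • x = m := by
  have hid : ∀ j, e j * e j = e j := he.coi.idem
  have := hX.1
  obtain ⟨m, hm⟩ := exists_ne (0 : X)
  obtain ⟨i₀, hi₀⟩ := he.exists_smul_notMem (N := ⊥) (m := m) (by simpa using hm)
  let S : Set ℕ := {n | ∃ j, ∃ y : X, e j • y = y ∧ (n : ℕ∞) = Module.length A (Submodule.span A {y})}
  have hfin : ∀ N : Submodule A X, Module.length A N ≠ ⊤ := fun N => Module.length_ne_top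
  have hS : S.Nonempty := by
    obtain ⟨n, hn⟩ := ENat.ne_top_iff_exists.mp (hfin (Submodule.span A {e i₀ • m}))
    exact ⟨n, i₀, e i₀ • m, by rw [← mul_smul, hid], hn⟩
  obtain ⟨L, hL⟩ := ENat.ne_top_iff_exists.mp (Module.length_ne_top (R := A) (M := X))
  have hB : BddAbove S := by
    refine ⟨L, ?_⟩
    rintro n ⟨j, y, -, hn⟩
    have : (n : ℕ∞) ≤ L := by
      rw [hn, hL]; exact Module.length_le_of_injective _ (Submodule.subtype_injective _)
    exact_mod_cast this
  obtain ⟨i, x, hx, hn⟩ := Nat.sSup_mem hS hB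
  have hmax : ∀ j (y : X), e j • y = y →
      Module.length A (Submodule.span A {y}) ≤ Module.length A (Submodule.span A {x}) := by
    intro j y hy
    obtain ⟨n, hn'⟩ := ENat.ne_top_iff_exists.mp (hfin (Submodule.span A {y}))
    rw [← hn, ← hn']
    exact_mod_cast le_csSup hB ⟨j, y, hy, hn'⟩
  have hx0 : Submodule.span A {x} ≠ ⊥ := by
    intro h0
    have h1 := hmax i₀ (e i₀ • m) (by rw [← mul_smul, hid])
    rw [h0, Module.length_bot, nonpos_iff_eq_zero, Module.length_eq_zero_iff,
      Submodule.subsingleton_iff_eq_bot, Submodule.span_singleton_eq_bot] at h1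
    exact hi₀ (by simpa using h1)
  -- Modulo a maximal `Y` that meets `A x` trivially, the image of `A x` is essential and its length
  -- is unchanged, hence still maximal. So it is everything, and `Y` is a complement of `A x`.
  obtain ⟨Y, hY, hYmax⟩ := (wellFounded_gt (α := Submodule A X)).has_min
    {Y | Y ⊓ Submodule.span A {x} = ⊥} ⟨⊥, by simp⟩
  have hY : Y ⊓ Submodule.span A {x} = ⊥ := hY
  have hxx := Submodule.mem_span_singleton_self (R := A) x
  have htop : Submodule.span A {Y.mkQ x} = ⊤ := by
    refine he.span_eq_top_of_essential (i := i) (by rw [← map_smul, hx]) ?_ ?_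
    · intro j y hy
      obtain ⟨y₀, rfl⟩ := Y.mkQ_surjective y
      obtain ⟨f, hf, -⟩ := length_span_le (A := A) (e j • y₀) (Y.mkQ y₀) (fun r hr => by
        rw [← hy, ← map_smul, ← map_smul, hr, map_zero])
      obtain ⟨f', hf', -⟩ := length_span_le (A := A) (Y.mkQ x) x (fun r hr => by
        rw [← map_smul, Submodule.mkQ_apply, Submodule.Quotient.mk_eq_zero] at hr
        have : r • x ∈ Y ⊓ Submodule.span A {x} := ⟨hr, Submodule.smul_mem _ _ hxx⟩
        rwa [hY] at this)
      exact (Module.length_le_of_surjective f hf).trans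
        ((hmax j _ (by rw [← mul_smul, hid])).trans (Module.length_le_of_surjective f' hf'))
    · intro N hN h0
      refine hYmax (N.comap Y.mkQ) ?_ ?_
      · rw [Set.mem_ofPred_eq, eq_bot_iff]
        rintro z ⟨hz1, hz2⟩
        obtain ⟨r, rfl⟩ := Submodule.mem_span_singleton.mp hz2
        have h1 : Y.mkQ (r • x) ∈ N ⊓ Submodule.span A {Y.mkQ x} :=
          ⟨hz1, by rw [map_smul]; exact Submodule.smul_mem _ _ (Submodule.mem_span_singleton_self _)⟩
        rw [h0, Submodule.mem_bot, Submodule.mkQ_apply, Submodule.Quotient.mk_eq_zero] at h1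
        rw [← hY]
        exact ⟨h1, hz2⟩
      · refine lt_of_le_of_ne (fun y hy => ?_) fun h => hN ?_
        · have : Y.mkQ y = 0 := by simpa using hy
          rw [Submodule.mem_comap, this]
          exact N.zero_mem
        · rw [← Submodule.map_comap_eq_of_surjective Y.mkQ_surjective N, ← h]
          simp
  have hc : IsCompl Y (Submodule.span A {x}) := by
    refine ⟨disjoint_iff.mpr hY, codisjoint_iff.mpr ?_⟩
    rw [← Set.image_singleton, ← Submodule.map_span] at htop
    have := congrArg (Submodule.comap Y.mkQ) htop
    rwa [Submodule.comap_map_eq, Submodule.ker_mkQ, Submodule.comap_top, sup_comm] at this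
  have hY0 := (hX.2 _ _ hc).resolve_right hx0
  refine ⟨i, x, hx, fun m => ?_⟩
  have : m ∈ Y ⊔ Submodule.span A {x} := hc.sup_eq_top ▸ Submodule.mem_top
  rw [hY0, bot_sup_eq] at this
  exact Submodule.mem_span_singleton.mp this

theorem IsSerialSystem.isUniserial_of_generator (he : IsSerialSystem e) {X : Type*}
    [AddCommGroup X] [Module A X] {i : ι} {x : X} (hx : e i • x = x)
    (hgen : ∀ m : X, ∃ r : A, r • x = m) : IsUniserialModule A X := by
  have hid : ∀ j, e j * e j = e j := he.coi.idem
  refine IsUniserialModule.of_surjective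
    ((LinearMap.toSpanSingleton A X x) ∘ₗ (leftIdeal (e i)).subtype) (fun m => ?_)
    (isUniserial_of_comparable (he.left i))
  obtain ⟨r, rfl⟩ := hgen m
  refine ⟨⟨r * e i, by rw [mem_leftIdeal, mul_assoc, hid]⟩, ?_⟩
  simp [mul_smul, hx]

end CyclicModules

/-! ### Schanuel's lemma and a dual form. -/

section Schanuel

variable {A : Type u} [Ring A]

theorem nonempty_linearEquiv_of_ker_eq {X Y Z : Type*} [AddCommGroup X] [Module A X]
    [AddCommGroup Y] [Module A Y] [AddCommGroup Z] [Module A Z] (s : X →ₗ[A] Y) (t : X →ₗ[A] Z)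
    (hs : Function.Surjective s) (ht : Function.Surjective t)
    (h : LinearMap.ker s = LinearMap.ker t) : Nonempty (Y ≃ₗ[A] Z) :=
  ⟨(s.quotKerEquivOfSurjective hs).symm.trans
    ((Submodule.quotEquivOfEq _ _ h).trans (t.quotKerEquivOfSurjective ht))⟩

theorem nonempty_linearEquiv_of_range_eq {X Y Z : Type*} [AddCommGroup X] [Module A X]
    [AddCommGroup Y] [Module A Y] [AddCommGroup Z] [Module A Z] (s : Y →ₗ[A] X) (t : Z →ₗ[A] X)
    (hs : Function.Injective s) (ht : Function.Injective t)
    (h : LinearMap.range s = LinearMap.range t) : Nonempty (Y ≃ₗ[A] Z) :=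
  ⟨(LinearEquiv.ofInjective s hs).trans
    ((LinearEquiv.ofEq _ _ h).trans (LinearEquiv.ofInjective t ht).symm)⟩

/-- Schanuel's lemma. -/
theorem schanuel {M U P U' P' : Type*} [AddCommGroup M] [Module A M] [AddCommGroup U] [Module A U]
    [AddCommGroup P] [Module A P] [AddCommGroup U'] [Module A U'] [AddCommGroup P'] [Module A P']
    [Module.Projective A P] [Module.Projective A P']
    {κ : U →ₗ[A] P} {π : P →ₗ[A] M} {κ' : U' →ₗ[A] P'} {π' : P' →ₗ[A] M}
    (hκ : Function.Injective κ) (hκπ : Function.Exact κ π) (hπ : Function.Surjective π)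
    (hκ' : Function.Injective κ') (hκπ' : Function.Exact κ' π') (hπ' : Function.Surjective π') :
    Nonempty ((U × P') ≃ₗ[A] (U' × P)) := by
  obtain ⟨h, hh⟩ := Module.projective_lifting_property π' π hπ'
  obtain ⟨h', hh'⟩ := Module.projective_lifting_property π π' hπ
  have hh := fun x => LinearMap.congr_fun hh x
  have hh' := fun x => LinearMap.congr_fun hh' x
  simp only [LinearMap.comp_apply] at hh hh'
  -- Both products embed in `P × P'` with image the kernel of `π + π'`, by means of the two lifts.
  let s : (U × P') →ₗ[A] (P × P') :=
    ((κ ∘ₗ LinearMap.fst A U P') - h' ∘ₗ LinearMap.snd A U P').prod (LinearMap.snd A U P')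
  let t : (U' × P) →ₗ[A] (P × P') :=
    (LinearMap.snd A U' P).prod ((κ' ∘ₗ LinearMap.fst A U' P) - h ∘ₗ LinearMap.snd A U' P)
  have hs : LinearMap.range s = LinearMap.ker (π.coprod π') := by
    ext ⟨p, p'⟩
    constructor
    · rintro ⟨⟨u, q⟩, hq⟩
      obtain ⟨rfl, rfl⟩ := Prod.mk.inj hq
      simp [hκπ.apply_apply_eq_zero, hh']
    · intro hp
      have hp : π p + π' p' = 0 := hp
      obtain ⟨u, hu⟩ := (hκπ (p + h' p')).mp (by rw [map_add, hh', hp])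
      exact ⟨(u, p'), Prod.ext (by simp [s, hu]) rfl⟩
  have ht : LinearMap.range t = LinearMap.ker (π.coprod π') := by
    ext ⟨p, p'⟩
    constructor
    · rintro ⟨⟨u, q⟩, hq⟩
      obtain ⟨rfl, rfl⟩ := Prod.mk.inj hq
      simp [hκπ'.apply_apply_eq_zero, hh]
    · intro hp
      have hp : π p + π' p' = 0 := hp
      obtain ⟨u, hu⟩ := (hκπ' (p' + h p)).mp (by rw [map_add, hh, add_comm, hp])
      exact ⟨(u, p), Prod.ext rfl (by simp [t, hu])⟩
  refine nonempty_linearEquiv_of_range_eq s t ?_ ?_ (hs.trans ht.symm)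
  · rw [← LinearMap.ker_eq_bot, LinearMap.ker_eq_bot']
    rintro ⟨u, q⟩ hq
    obtain ⟨h1, h2⟩ := Prod.mk.inj hq
    have h2 : q = 0 := h2
    subst h2
    have : κ u = 0 := by simpa using h1
    rw [hκ (this.trans (map_zero κ).symm)]; rfl
  · rw [← LinearMap.ker_eq_bot, LinearMap.ker_eq_bot']
    rintro ⟨u, q⟩ hq
    obtain ⟨h1, h2⟩ := Prod.mk.inj hq
    have h1 : q = 0 := h1
    subst h1
    have : κ' u = 0 := by simpa using h2
    rw [hκ' (this.trans (map_zero κ').symm)]; rfl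

/-- Injectivity of `Q` and `Q'` is replaced by the requirement that `j` and `j'` factor through each
other, as left approximations do. Both sides are quotients of `Q × Q'` by the same kernel. -/
theorem schanuel_dual {M Q C Q' C' : Type*} [AddCommGroup M] [Module A M] [AddCommGroup Q]
    [Module A Q] [AddCommGroup C] [Module A C] [AddCommGroup Q'] [Module A Q'] [AddCommGroup C']
    [Module A C'] {j : M →ₗ[A] Q} {c : Q →ₗ[A] C} {j' : M →ₗ[A] Q'} {c' : Q' →ₗ[A] C'}
    (hj : Function.Exact j c) (hc : Function.Surjective c)
    (hj' : Function.Exact j' c') (hc' : Function.Surjective c')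
    (h : Q →ₗ[A] Q') (hh : h ∘ₗ j = j') (h' : Q' →ₗ[A] Q) (hh' : h' ∘ₗ j' = j) :
    Nonempty ((C × Q') ≃ₗ[A] (C' × Q)) := by
  have hh := fun x => LinearMap.congr_fun hh x
  have hh' := fun x => LinearMap.congr_fun hh' x
  simp only [LinearMap.comp_apply] at hh hh'
  let G : (Q × Q') →ₗ[A] (C' × Q) :=
    (c' ∘ₗ (LinearMap.snd A Q Q' - h ∘ₗ LinearMap.fst A Q Q')).prod
      (LinearMap.fst A Q Q' + h' ∘ₗ (LinearMap.snd A Q Q' - h ∘ₗ LinearMap.fst A Q Q'))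
  have hG : ∀ q q', G (q, q') = (c' (q' - h q), q + h' (q' - h q)) := fun q q' => rfl
  refine nonempty_linearEquiv_of_ker_eq (c.prodMap (LinearMap.id : Q' →ₗ[A] Q')) G ?_ ?_ ?_
  · exact Function.Surjective.prodMap hc Function.surjective_id
  · rintro ⟨a, b⟩
    obtain ⟨a, rfl⟩ := hc' a
    refine ⟨(b - h' a, a + h (b - h' a)), ?_⟩
    rw [hG]; simp
  · ext ⟨q, q'⟩
    rw [LinearMap.mem_ker, LinearMap.mem_ker, hG, LinearMap.prodMap_apply, Prod.mk_eq_zero,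
      Prod.mk_eq_zero, LinearMap.id_apply]
    constructor
    · rintro ⟨h1, rfl⟩
      obtain ⟨m, rfl⟩ := (hj q).mp h1
      simp [hh, hh', hj'.apply_apply_eq_zero]
    · rintro ⟨h1, h2⟩
      obtain ⟨m, hm⟩ := (hj' _).mp h1
      rw [← hm, hh'] at h2
      obtain rfl := eq_neg_of_add_eq_zero_left h2
      refine ⟨by simp [hj.apply_apply_eq_zero], ?_⟩
      rw [map_neg, hh, sub_neg_eq_add] at hm
      simpa using hm.symm

end Schanuel

/-! ### Syzygies and cosyzygies of summands of Gorenstein projective modules. -/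

section GorensteinSummands

variable {A : Type u} [Ring A]

/-- `f : U → P` is a left approximation of `U` by finitely generated projective modules, up to the
conditions on `P`. -/
def IsLeftApproximation {U P : Type*} [AddCommGroup U] [Module A U] [AddCommGroup P] [Module A P]
    (f : U →ₗ[A] P) : Prop :=
  ∀ φ : U →ₗ[A] A, ∃ ψ : P →ₗ[A] A, ψ ∘ₗ f = φ

theorem IsLeftApproximation.exists_comp_eq {U P : Type*} [AddCommGroup U] [Module A U]
    [AddCommGroup P] [Module A P] {f : U →ₗ[A] P} (hf : IsLeftApproximation f)
    {Q : Type*} [AddCommGroup Q] [Module A Q] [Module.Finite A Q] [Module.Projective A Q]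
    (φ : U →ₗ[A] Q) : ∃ ψ : P →ₗ[A] Q, ψ ∘ₗ f = φ := by
  obtain ⟨n, s, g, -, -, hs⟩ := Module.Finite.exists_comp_eq_id_of_projective A Q
  choose ψ hψ using fun l => hf (LinearMap.proj l ∘ₗ g ∘ₗ φ)
  refine ⟨s ∘ₗ LinearMap.pi ψ, ?_⟩
  rw [LinearMap.comp_assoc]
  have : LinearMap.pi ψ ∘ₗ f = g ∘ₗ φ := by
    ext u l
    exact LinearMap.congr_fun (hψ l) u
  rw [this, ← LinearMap.comp_assoc, hs, LinearMap.id_comp]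

theorem IsLeftApproximation.prodMap {U P V Q : Type*} [AddCommGroup U] [Module A U]
    [AddCommGroup P] [Module A P] [AddCommGroup V] [Module A V] [AddCommGroup Q] [Module A Q]
    {f : U →ₗ[A] P} {g : V →ₗ[A] Q} (hf : IsLeftApproximation f) (hg : IsLeftApproximation g) :
    IsLeftApproximation (f.prodMap g) := by
  intro φ
  obtain ⟨ψ₁, h₁⟩ := hf (φ ∘ₗ LinearMap.inl A U V)
  obtain ⟨ψ₂, h₂⟩ := hg (φ ∘ₗ LinearMap.inr A U V)
  refine ⟨ψ₁.coprod ψ₂, ?_⟩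
  ext u
  · simpa using LinearMap.congr_fun h₁ u
  · simpa using LinearMap.congr_fun h₂ u

/-- A module which is, up to finitely generated projective summands, a direct summand of an image
of a differential of a complete projective resolution. -/
def IsGorensteinSummand (A : Type u) [Ring A] (M : Type u) [AddCommGroup M] [Module A M] : Prop :=
  ∃ (K : CompleteProjectiveResolution A) (i : ℤ) (N P : FGModuleCat.{u} A),
    Module.Projective A P ∧ Nonempty ((M × N) ≃ₗ[A] (LinearMap.range (K.d i) × P))

theorem IsGorensteinSummand.of_equiv {M M' : Type u} [AddCommGroup M] [Module A M]
    [AddCommGroup M'] [Module A M'] (f : M ≃ₗ[A] M') (h : IsGorensteinSummand A M) :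
    IsGorensteinSummand A M' := by
  obtain ⟨K, i, N, P, hP, ⟨E⟩⟩ := h
  exact ⟨K, i, N, P, hP, ⟨(f.symm.prodCongr (LinearEquiv.refl A N)).trans E⟩⟩

theorem IsGorensteinSummand.of_prod {M M' : Type u} [AddCommGroup M] [Module A M]
    [AddCommGroup M'] [Module A M'] [Module.Finite A M'] (h : IsGorensteinSummand A (M × M')) :
    IsGorensteinSummand A M := by
  obtain ⟨K, i, N, P, hP, ⟨E⟩⟩ := h
  exact ⟨K, i, FGModuleCat.of A (M' × N), P, hP, ⟨(LinearEquiv.prodAssoc A M M' N).symm.trans E⟩⟩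

/-- Composed with the differential, `φ` is a cocycle of the dual complex, which is exact. -/
theorem CompleteProjectiveResolution.exists_extend (K : CompleteProjectiveResolution A) (i : ℤ)
    (φ : LinearMap.range (K.d i) →ₗ[A] A) : ∃ ψ : K.P i →ₗ[A] A, ∀ x, ψ x.1 = φ x := by
  obtain ⟨ψ, hψ⟩ := (K.hom_exact i (φ ∘ₗ (K.d i).rangeRestrict)).mp (by
    ext y
    have : (K.d i).rangeRestrict (K.d (i + 1) y) = 0 :=
      Subtype.ext ((K.exact i).apply_apply_eq_zero y)
    simp [this])
  refine ⟨ψ, ?_⟩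
  rintro ⟨_, y, rfl⟩
  exact LinearMap.congr_fun hψ y

/-- First syzygies of direct summands of Gorenstein projective modules: all maps to `A` extend. -/
theorem IsGorensteinSummand.isLeftApproximation {M U P : Type u} [AddCommGroup M] [Module A M]
    [AddCommGroup U] [Module A U] [AddCommGroup P] [Module A P] [Module.Projective A P]
    (h : IsGorensteinSummand A M) {κ : U →ₗ[A] P} {π : P →ₗ[A] M} (hκ : Function.Injective κ)
    (hκπ : Function.Exact κ π) (hπ : Function.Surjective π) : IsLeftApproximation κ := by
  obtain ⟨K, i, N, P₀, hP₀, ⟨E⟩⟩ := h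
  have := K.projective (i + 1)
  let ρ : (K.P (i + 1) × P₀) →ₗ[A] (LinearMap.range (K.d i) × P₀) :=
    (K.d i).rangeRestrict.prodMap LinearMap.id
  have hρ : Function.Surjective ρ :=
    Function.Surjective.prodMap (LinearMap.surjective_rangeRestrict _) Function.surjective_id
  -- `a` and `b` compare the cover `π` with the resolution. They lift the inclusion of `M` as a
  -- summand and the projection back.
  obtain ⟨a, ha⟩ := Module.projective_lifting_property ρ
    (E.toLinearMap ∘ₗ LinearMap.inl A M N ∘ₗ π) hρ
  obtain ⟨b, hb⟩ := Module.projective_lifting_property π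
    (LinearMap.fst A M N ∘ₗ E.symm.toLinearMap ∘ₗ ρ) hπ
  have ha := fun x => LinearMap.congr_fun ha x
  have hb := fun x => LinearMap.congr_fun hb x
  simp only [LinearMap.comp_apply, LinearEquiv.coe_coe] at ha hb
  have hba : ∀ x, π (b (a x)) = π x := by
    intro x
    rw [hb, ha]; simp
  let κ' := LinearEquiv.ofInjective κ hκ
  have hr : ∀ x, π x = 0 → x ∈ LinearMap.range κ := fun x hx => (hκπ x).mp hx
  have hκ'x : ∀ u, κ'.symm ⟨κ u, u, rfl⟩ = u := fun u => κ'.symm_apply_apply u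
  intro φ
  let bk : K.P (i + 1 + 1) →ₗ[A] LinearMap.range κ := LinearMap.codRestrict _
    (b ∘ₗ LinearMap.inl A _ _ ∘ₗ K.d (i + 1)) (fun x => hr _ (by
      have : ρ (K.d (i + 1) x, 0) = 0 :=
        Prod.ext (Subtype.ext ((K.exact i).apply_apply_eq_zero x)) rfl
      simp [hb, this]))
  obtain ⟨g, hg⟩ := (K.hom_exact (i + 1) (φ ∘ₗ κ'.symm.toLinearMap ∘ₗ bk)).mp (by
    ext y
    have : bk (K.d (i + 1 + 1) y) = 0 := by
      ext
      simp only [bk, LinearMap.codRestrict_apply, LinearMap.comp_apply,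
        (K.exact (i + 1)).apply_apply_eq_zero y, map_zero, ZeroMemClass.coe_zero]
    simp [this])
  have hg := fun x => LinearMap.congr_fun hg x
  -- `b ∘ a` is the identity only up to a map into the range of `κ`. The extension `g` obtained on
  -- the resolution is pulled back along `a` and corrected by `φ` on this difference.
  let δ : P →ₗ[A] LinearMap.range κ := LinearMap.codRestrict _ (b ∘ₗ a - LinearMap.id)
    (fun x => hr _ (by simp [hba]))
  refine ⟨g ∘ₗ LinearMap.fst A _ _ ∘ₗ a - φ ∘ₗ κ'.symm.toLinearMap ∘ₗ δ, ?_⟩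
  ext u
  have h0 : ρ (a (κ u)) = 0 := by rw [ha, hκπ.apply_apply_eq_zero]; simp
  obtain ⟨h1, h2⟩ := Prod.mk.inj h0
  obtain ⟨y, hy⟩ := (K.exact i _).mp (congrArg Subtype.val h1)
  have hay : a (κ u) = (K.d (i + 1) y, 0) := Prod.ext hy.symm h2
  have h3 : bk y = ⟨b (a (κ u)), hr _ (by rw [hba, hκπ.apply_apply_eq_zero])⟩ := by
    ext; simp [bk, hay]
  have h4 : bk y = δ (κ u) + ⟨κ u, u, rfl⟩ := by
    rw [h3]; ext; simp [δ]
  have h5 := hg y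
  simp only [LinearMap.comp_apply, LinearEquiv.coe_coe] at h5
  simp only [LinearMap.comp_apply, LinearMap.sub_apply, LinearEquiv.coe_coe]
  rw [hay, LinearMap.fst_apply, h5, h4, map_add, map_add, hκ'x]
  abel

/-- Cover the complement `N` by a free module and apply Schanuel to the two covers of `M × N`. The
extra projective summands are the reason for admitting them in `IsGorensteinSummand`. -/
theorem IsGorensteinSummand.syzygy [IsNoetherianRing A] {M U P : Type u} [AddCommGroup M]
    [Module A M] [AddCommGroup U] [Module A U] [AddCommGroup P] [Module A P] [Module.Finite A P]
    [Module.Projective A P]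
    (h : IsGorensteinSummand A M) {κ : U →ₗ[A] P} {π : P →ₗ[A] M} (hκ : Function.Injective κ)
    (hκπ : Function.Exact κ π) (hπ : Function.Surjective π) : IsGorensteinSummand A U := by
  obtain ⟨K, i, N, P₀, hP₀, ⟨E⟩⟩ := h
  have := K.projective (i + 1)
  obtain ⟨n, s, hs⟩ := Module.Finite.exists_fin' A N
  obtain ⟨S⟩ := schanuel (κ := κ.prodMap (LinearMap.ker s).subtype)
    (π := E.toLinearMap ∘ₗ π.prodMap s)
    (κ' := LinearMap.inl A _ P₀ ∘ₗ (LinearMap.range (K.d (i + 1))).subtype)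
    (π' := ((K.d i).rangeRestrict.prodMap LinearMap.id))
    (hκ.prodMap (Submodule.subtype_injective _))
    (by
      rintro ⟨p, q⟩
      simp only [LinearMap.comp_apply, LinearEquiv.coe_coe, LinearEquiv.map_eq_zero_iff,
        LinearMap.prodMap_apply, Prod.mk_eq_zero, Set.mem_range, Prod.exists, hκπ p]
      constructor
      · rintro ⟨⟨u, rfl⟩, hq⟩
        exact ⟨u, ⟨q, hq⟩, rfl⟩
      · rintro ⟨u, ⟨q', hq'⟩, hu⟩
        obtain ⟨rfl, rfl⟩ := Prod.mk.inj hu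
        exact ⟨⟨u, rfl⟩, hq'⟩)
    (E.surjective.comp (hπ.prodMap hs))
    (by
      exact (LinearMap.inl_injective).comp (Submodule.subtype_injective _))
    (by
      rintro ⟨p, q⟩
      simp only [LinearMap.prodMap_apply, Prod.mk_eq_zero, LinearMap.id_apply, Set.mem_range,
        LinearMap.comp_apply]
      constructor
      · rintro ⟨h1, rfl⟩
        obtain ⟨y, rfl⟩ := (K.exact i _).mp (congrArg Subtype.val h1)
        exact ⟨⟨_, y, rfl⟩, rfl⟩
      · rintro ⟨⟨_, y, rfl⟩, hy⟩
        obtain ⟨rfl, rfl⟩ := Prod.mk.inj hy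
        exact ⟨Subtype.ext ((K.exact i).apply_apply_eq_zero y), rfl⟩)
    (Function.Surjective.prodMap (LinearMap.surjective_rangeRestrict _) Function.surjective_id)
  exact ⟨K, i + 1, FGModuleCat.of A (LinearMap.ker s × (K.P (i + 1) × P₀)),
    FGModuleCat.of A (P × (Fin n → A)), inferInstanceAs (Module.Projective A (P × (Fin n → A))),
    ⟨(LinearEquiv.prodAssoc A _ _ _).symm.trans S⟩⟩

theorem IsGorensteinSummand.exists_isLeftApproximation {M : Type u} [AddCommGroup M] [Module A M]
    (h : IsGorensteinSummand A M) : ∃ (Q : FGModuleCat.{u} A) (j : M →ₗ[A] Q),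
      Module.Projective A Q ∧ Function.Injective j ∧ IsLeftApproximation j := by
  obtain ⟨K, i, N, P₀, hP₀, ⟨E⟩⟩ := h
  have := K.projective i
  let J : (LinearMap.range (K.d i) × P₀) →ₗ[A] (K.P i × P₀) :=
    (LinearMap.range (K.d i)).subtype.prodMap LinearMap.id
  refine ⟨FGModuleCat.of A (K.P i × P₀), J ∘ₗ E.toLinearMap ∘ₗ LinearMap.inl A M N,
    inferInstanceAs (Module.Projective A (K.P i × P₀)), ?_, ?_⟩
  · exact ((Submodule.subtype_injective _).prodMap Function.injective_id).comp
      (E.injective.comp LinearMap.inl_injective)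
  · intro φ
    let φ' := φ ∘ₗ LinearMap.fst A M N ∘ₗ E.symm.toLinearMap
    obtain ⟨ψ, hψ⟩ := K.exists_extend i (φ' ∘ₗ LinearMap.inl A _ _)
    refine ⟨ψ.coprod (φ' ∘ₗ LinearMap.inr A _ _), ?_⟩
    ext m
    have : φ m = φ' (E (m, 0)) := by simp [φ']
    simp only [LinearMap.comp_apply]
    rw [this]
    have h2 : E (m, 0) = ((E (m, 0)).1, 0) + (0, (E (m, 0)).2) := by simp
    rw [h2, map_add]
    simp [J, hψ]

theorem IsGorensteinSummand.finite {M : Type u} [AddCommGroup M] [Module A M]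
    (h : IsGorensteinSummand A M) : Module.Finite A M := by
  obtain ⟨K, i, N, P₀, hP₀, ⟨E⟩⟩ := h
  exact Module.Finite.of_surjective (LinearMap.fst A M N ∘ₗ E.symm.toLinearMap)
    (Prod.fst_surjective.comp E.symm.surjective)

/-- After adding an approximation of the complement, `j` and the embedding of the image into the
resolution are both left approximations, so each factors through the other and the dual Schanuel
lemma compares their cokernels. -/
theorem IsGorensteinSummand.cosyzygy {M Q C : Type u} [AddCommGroup M]
    [Module A M] [AddCommGroup Q] [Module A Q] [AddCommGroup C] [Module A C] [Module.Finite A Q]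
    [Module.Projective A Q]
    (h : IsGorensteinSummand A M) {j : M →ₗ[A] Q} {c : Q →ₗ[A] C} (hj : IsLeftApproximation j)
    (hjc : Function.Exact j c) (hc : Function.Surjective c) : IsGorensteinSummand A C := by
  have hfin := h.finite
  obtain ⟨K, i, N, P₀, hP₀, ⟨E⟩⟩ := h
  -- The cokernel of the image of `d (l + 1)` in `P (l + 1)` is the image of `d l`.
  obtain ⟨l, rfl⟩ : ∃ l, i = l + 1 := ⟨i - 1, by ring⟩
  have := K.projective (l + 1)
  have hN : IsGorensteinSummand A N :=
    ⟨K, l + 1, FGModuleCat.of A M, P₀, hP₀, ⟨(LinearEquiv.prodComm A N M).trans E⟩⟩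
  obtain ⟨Q', j', hQ', -, hj'⟩ := hN.exists_isLeftApproximation
  let J : (M × N) →ₗ[A] (K.P (l + 1) × P₀) :=
    ((LinearMap.range (K.d (l + 1))).subtype.prodMap LinearMap.id) ∘ₗ E.toLinearMap
  have hJ : IsLeftApproximation J := by
    intro φ
    obtain ⟨ψ, hψ⟩ := K.exists_extend (l + 1) (φ ∘ₗ E.symm.toLinearMap ∘ₗ LinearMap.inl A _ _)
    refine ⟨ψ.coprod (φ ∘ₗ E.symm.toLinearMap ∘ₗ LinearMap.inr A _ _), ?_⟩
    apply LinearMap.ext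
    intro m
    obtain ⟨⟨r, p⟩, rfl⟩ := E.symm.surjective m
    have : (r, p) = (r, 0) + (0, p) := by simp
    simp [J, hψ, ← map_add]
  obtain ⟨a, ha⟩ := (hj.prodMap hj').exists_comp_eq J
  obtain ⟨b, hb⟩ := hJ.exists_comp_eq (j.prodMap j')
  obtain ⟨S⟩ := schanuel_dual (j := j.prodMap j') (j' := J) (c := c.prodMap (LinearMap.range j').mkQ)
    (c' := (K.d l).rangeRestrict ∘ₗ LinearMap.fst A _ P₀)
    (by
      rintro ⟨p, q⟩
      simp only [LinearMap.prodMap_apply, Prod.mk_eq_zero, hjc p, Submodule.mkQ_apply,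
        Submodule.Quotient.mk_eq_zero, Set.mem_range, Prod.exists]
      constructor
      · rintro ⟨⟨m, rfl⟩, ⟨n, rfl⟩⟩
        exact ⟨m, n, rfl⟩
      · rintro ⟨m, n, hu⟩
        obtain ⟨rfl, rfl⟩ := Prod.mk.inj hu
        exact ⟨⟨m, rfl⟩, ⟨n, rfl⟩⟩)
    (hc.prodMap (Submodule.mkQ_surjective _))
    (by
      rintro ⟨p, q⟩
      constructor
      · intro hp
        obtain ⟨y, rfl⟩ := (K.exact l _).mp (congrArg Subtype.val hp)
        obtain ⟨m, hm⟩ := E.surjective (⟨_, y, rfl⟩, q)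
        refine ⟨m, ?_⟩
        simp [J, hm]
      · rintro ⟨m, hm⟩
        obtain ⟨y, hy⟩ := (E m).1.2
        have : p = K.d (l + 1) y := hy ▸ (congrArg Prod.fst hm).symm
        subst this
        exact Subtype.ext ((K.exact l).apply_apply_eq_zero y))
    ((LinearMap.surjective_rangeRestrict _).comp LinearMap.fst_surjective) a ha b hb
  have : Module.Projective A Q' := hQ'
  exact ⟨K, l, FGModuleCat.of A ((Q' ⧸ LinearMap.range j') × (K.P (l + 1) × P₀)),
    FGModuleCat.of A (Q × Q'), inferInstanceAs (Module.Projective A (Q × Q')),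
    ⟨(LinearEquiv.prodAssoc A _ _ _).symm.trans S⟩⟩

end GorensteinSummands

/-! ### Maps between indecomposable projectives as ring elements; exact pairs. -/

section Arrows

variable {A : Type u} [Ring A] {ι : Type} [Fintype ι] {e : ι → A}

/-- A nonzero non-isomorphism `A (e i) → A (e j)`, given by right multiplication with `f`. -/
structure IsArrow (e : ι → A) (i j : ι) (f : A) : Prop where
  left : e i * f = f
  right : f * e j = f
  ne_zero : f ≠ 0
  not_unit : ∀ w, w * f ≠ e j

/-- Right multiplications with `x` and `y` give an exact sequence of projective left modules at
`A (e j)`, whose dual is exact, too. -/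
structure IsExactPair (e : ι → A) (j : ι) (x y : A) : Prop where
  mul_eq_zero : x * y = 0
  left : ∀ z, z * e j = z → z * y = 0 → ∃ w, z = w * x
  right : ∀ z, e j * z = z → x * z = 0 → ∃ w, z = y * w

namespace IsSerialSystem

theorem mul_self (he : IsSerialSystem e) (i : ι) : e i * e i = e i := he.coi.idem i

/-- `f * (e j * w * e i)` is an idempotent in the corner at `i`. By primitivity it is `0` or `e i`,
and `0` would force `e j = 0`. -/
theorem exists_right_inv (he : IsSerialSystem e) {i j : ι} {f w : A} (hi : e i * f = f)
    (hw : w * f = e j) : ∃ w', f * w' = e i := by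
  have hid := he.mul_self
  have h1 : (e j * w * e i) * f = e j := by
    rw [mul_assoc, hi, mul_assoc, hw, hid]
  rcases he.prim i (f * (e j * w * e i)) (by
      rw [mul_assoc, ← mul_assoc _ f, h1, ← mul_assoc (e j), ← mul_assoc (e j), hid])
    (by rw [← mul_assoc, hi]) (by simp only [mul_assoc, hid]) with h | h
  · exfalso
    apply he.ne_zero j
    calc e j = (e j * w * e i * f) * (e j * w * e i * f) := by rw [h1, hid]
      _ = e j * w * e i * (f * (e j * w * e i)) * f := by simp only [mul_assoc]
      _ = 0 := by rw [h, mul_zero, zero_mul]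
  · exact ⟨_, h⟩

/-- Halves the work below by left-right duality. Only the Fitting condition is not visibly
symmetric; there `exists_right_inv` exchanges the one-sided inverses. -/
theorem op (he : IsSerialSystem e) : IsSerialSystem (fun i => MulOpposite.op (e i)) := by
  have hu : ∀ {x y : Aᵐᵒᵖ}, x = y → x.unop = y.unop := fun h => congrArg _ h
  refine ⟨⟨⟨fun i => ?_, fun i j hij => ?_⟩, ?_⟩, fun i => by simpa using he.ne_zero i, ?_, ?_, ?_, ?_⟩
  · exact congrArg MulOpposite.op (he.mul_self i)
  · exact congrArg MulOpposite.op (he.coi.ortho hij.symm)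
  · rw [← Finset.op_sum, he.coi.complete, MulOpposite.op_one]
  · intro i a b ha hb
    rcases he.right i a.unop b.unop (hu ha) (hu hb) with ⟨w, hw⟩ | ⟨w, hw⟩
    · exact Or.inl ⟨MulOpposite.op w, congrArg MulOpposite.op hw⟩
    · exact Or.inr ⟨MulOpposite.op w, congrArg MulOpposite.op hw⟩
  · intro i a b ha hb
    rcases he.left i a.unop b.unop (hu ha) (hu hb) with ⟨w, hw⟩ | ⟨w, hw⟩
    · exact Or.inl ⟨MulOpposite.op w, congrArg MulOpposite.op hw⟩
    · exact Or.inr ⟨MulOpposite.op w, congrArg MulOpposite.op hw⟩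
  · intro i x h h1 h2
    exact (he.prim i x.unop (hu h) (hu h2) (hu h1)).imp (congrArg MulOpposite.op)
      (congrArg MulOpposite.op)
  · intro i x h1 h2
    rcases he.nil i x.unop (hu h2) (hu h1) with ⟨y, hy⟩ | ⟨n, hn⟩
    · obtain ⟨w, hw⟩ := he.exists_right_inv (hu h2) hy
      exact Or.inl ⟨MulOpposite.op w, congrArg MulOpposite.op hw⟩
    · exact Or.inr ⟨n, congrArg MulOpposite.op hn⟩

theorem exists_left_inv (he : IsSerialSystem e) {i j : ι} {f w : A} (hj : f * e j = f)
    (hw : f * w = e i) : ∃ w', w' * f = e j := by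
  obtain ⟨w', hw'⟩ := he.op.exists_right_inv (f := MulOpposite.op f) (w := MulOpposite.op w)
    (congrArg MulOpposite.op hj) (congrArg MulOpposite.op hw)
  exact ⟨w'.unop, congrArg MulOpposite.unop hw'⟩

theorem isArrow_op (he : IsSerialSystem e) {i j : ι} {f : A} (hf : IsArrow e i j f) :
    IsArrow (fun i => MulOpposite.op (e i)) j i (MulOpposite.op f) := by
  refine ⟨congrArg MulOpposite.op hf.right, congrArg MulOpposite.op hf.left,
    by simpa using hf.ne_zero, fun w hw => ?_⟩
  obtain ⟨w', hw'⟩ := he.exists_left_inv hf.right (congrArg MulOpposite.unop hw)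
  exact hf.not_unit w' hw'

theorem isArrow_unop (he : IsSerialSystem e) {i j : ι} {f : Aᵐᵒᵖ}
    (hf : IsArrow (fun i => MulOpposite.op (e i)) j i f) : IsArrow e i j f.unop := by
  refine ⟨congrArg MulOpposite.unop hf.right, congrArg MulOpposite.unop hf.left,
    by simpa using hf.ne_zero, fun w hw => ?_⟩
  obtain ⟨w', hw'⟩ := he.exists_right_inv (congrArg MulOpposite.unop hf.right)
    hw
  exact hf.not_unit (MulOpposite.op w') (congrArg MulOpposite.op hw')

theorem isArrow_of_isExactPair (he : IsSerialSystem e) {i j l : ι} {f g : A}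
    (hf : IsArrow e i j f) (hl : e j * g = g) (hr : g * e l = g) (h0 : g ≠ 0) (h : f * g = 0) :
    IsArrow e j l g := by
  refine ⟨hl, hr, h0, fun w hw => hf.ne_zero ?_⟩
  obtain ⟨w', hw'⟩ := he.exists_right_inv hl hw
  rw [← hf.right, ← hw', ← mul_assoc, h, zero_mul]

/-- A form of Nakayama's lemma: `e j * (w * f)` lies in the corner at `j` and has no left inverse
there, so it is nilpotent, but it fixes `g`. -/
theorem eq_zero_of_eq_mul (he : IsSerialSystem e) {i j : ι} {f w g : A} (hf : IsArrow e i j f)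
    (hg : e j * g = g) (h : g = w * f * g) : g = 0 := by
  have hid := he.mul_self
  rcases he.nil j (e j * (w * f)) (by rw [← mul_assoc, hid])
    (by rw [mul_assoc, mul_assoc, hf.right]) with ⟨y, hy⟩ | ⟨n, hn⟩
  · exact absurd hy (by simpa only [mul_assoc] using hf.not_unit (y * (e j * w)))
  · have h1 : e j * (w * f) * g = g := by rw [mul_assoc, ← h, hg]
    have h2 : ∀ n : ℕ, (e j * (w * f)) ^ n * g = g := by
      intro n
      induction n with
      | zero => simp
      | succ n ih => rw [pow_succ, mul_assoc, h1, ih]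
    rw [← h2 n, hn, zero_mul]

theorem eq_zero_of_eq_mul_right (he : IsSerialSystem e) {i j : ι} {f w g : A}
    (hf : IsArrow e i j f) (hg : g * e j = g) (h : g = g * (w * f)) : g = 0 := by
  have hid := he.mul_self
  rcases he.nil j (e j * (w * f)) (by rw [← mul_assoc, hid])
    (by rw [mul_assoc, mul_assoc, hf.right]) with ⟨y, hy⟩ | ⟨n, hn⟩
  · exact absurd hy (by simpa only [mul_assoc] using hf.not_unit (y * (e j * w)))
  · have h1 : g * (e j * (w * f)) = g := by rw [← mul_assoc, hg, ← h]
    have h2 : ∀ n : ℕ, g * (e j * (w * f)) ^ n = g := by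
      intro n
      induction n with
      | zero => simp
      | succ n ih => rw [pow_succ', ← mul_assoc, h1, ih]
    rw [← h2 n, hn, mul_zero]

/-- If `d₀, d₁` is an exact pair and `f` starts where `d₀` starts, then `f` is the first map of an
exact pair whose second map ends where `d₁` ends. -/
theorem exists_isExactPair_right (he : IsSerialSystem e) {y₀ y₁ y₂ x : ι} {d₀ d₁ f : A}
    (hd₀ : IsArrow e y₀ y₁ d₀) (hd₁ : IsArrow e y₁ y₂ d₁) (hd : IsExactPair e y₁ d₀ d₁)
    (hf : IsArrow e y₀ x f) : ∃ f', IsArrow e x y₂ f' ∧ IsExactPair e x f f' := by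
  have hid := he.mul_self
  rcases he.right y₀ f d₀ hf.left hd₀.left with ⟨g', hg'⟩ | ⟨g', hg'⟩
  -- Case `f = d₀ * g`. Then `g` is not divisible by `d₁`, since `f ≠ 0`, so `d₁ = g * f'`, and this
  -- `f'` is the continuation.
  · obtain ⟨g, hg1, hg2, hfg⟩ : ∃ g, e y₁ * g = g ∧ g * e x = g ∧ f = d₀ * g := by
      refine ⟨e y₁ * g' * e x, by rw [← mul_assoc, ← mul_assoc, hid], by rw [mul_assoc, hid], ?_⟩
      rw [← mul_assoc, ← mul_assoc, hd₀.right, ← hg', hf.right]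
    obtain ⟨f₁, hf₁⟩ : ∃ f₁, d₁ = g * f₁ := by
      rcases he.right y₁ d₁ g hd₁.left hg1 with h | ⟨w, hw⟩
      · exact h
      · exact absurd (by rw [hfg, hw, ← mul_assoc, hd.mul_eq_zero, zero_mul]) hf.ne_zero
    obtain ⟨f', hf'1, hf'2, hgf'⟩ : ∃ f', e x * f' = f' ∧ f' * e y₂ = f' ∧ g * f' = d₁ := by
      refine ⟨e x * f₁ * e y₂, by rw [← mul_assoc, ← mul_assoc, hid], by rw [mul_assoc, hid], ?_⟩
      rw [← mul_assoc, ← mul_assoc, hg2, ← hf₁, hd₁.right]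
    have h0 : f * f' = 0 := by rw [hfg, mul_assoc, hgf', hd.mul_eq_zero]
    have hne : f' ≠ 0 := by
      rintro rfl
      exact hd₁.ne_zero (by rw [← hgf', mul_zero])
    refine ⟨f', he.isArrow_of_isExactPair hf hf'1 hf'2 hne h0, h0, fun z hz hzf => ?_,
      fun z hz hfz => ?_⟩
    · rcases he.left x z g hz hg2 with ⟨w, hw⟩ | ⟨w, hw⟩
      · obtain ⟨v, hv⟩ := hd.left (w * e y₁) (by rw [mul_assoc, hid]) (by
          rw [mul_assoc, hd₁.left, ← hgf', ← mul_assoc, ← hw, hzf])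
        exact ⟨v, by rw [hfg, ← mul_assoc, ← hv, mul_assoc, hg1, hw]⟩
      · exact absurd (by rw [← hgf', hw, mul_assoc, hzf, mul_zero]) hd₁.ne_zero
    · obtain ⟨v, hv⟩ := hd.right (g * z) (by rw [← mul_assoc, hg1]) (by
        rw [← mul_assoc, ← hfg, hfz])
      have h1 : g * (z - f' * v) = 0 := by rw [mul_sub, ← mul_assoc, hgf', hv, sub_self]
      rcases he.right x (z - f' * v) f' (by rw [mul_sub, hz, ← mul_assoc, hf'1]) hf'1 with
        ⟨w, hw⟩ | ⟨w, hw⟩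
      · exact ⟨w + v, by rw [mul_add, ← hw, sub_add_cancel]⟩
      · exact absurd (by rw [← hgf', hw, ← mul_assoc, h1, zero_mul]) hd₁.ne_zero
  -- Case `d₀ = f * g`. The continuation is `g * d₁`. If it vanished, `g` would lie in `A d₀ = A f
  -- g`, which the Nakayama argument forbids.
  · obtain ⟨g, hg1, hg2, hfg⟩ : ∃ g, e x * g = g ∧ g * e y₁ = g ∧ d₀ = f * g := by
      refine ⟨e x * g' * e y₁, by rw [← mul_assoc, ← mul_assoc, hid], by rw [mul_assoc, hid], ?_⟩
      rw [← mul_assoc, ← mul_assoc, hf.right, ← hg', hd₀.right]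
    have hne : g * d₁ ≠ 0 := by
      intro h0
      obtain ⟨w, hw⟩ := hd.left g hg2 h0
      have : g = 0 := he.eq_zero_of_eq_mul hf hg1 (by rw [mul_assoc, ← hfg]; exact hw)
      exact hd₀.ne_zero (by rw [hfg, this, mul_zero])
    have h0 : f * (g * d₁) = 0 := by rw [← mul_assoc, ← hfg, hd.mul_eq_zero]
    refine ⟨g * d₁, he.isArrow_of_isExactPair hf (by rw [← mul_assoc, hg1])
      (by rw [mul_assoc, hd₁.right]) hne h0, h0, fun z hz hzf => ?_, fun z hz hfz => ?_⟩
    · obtain ⟨w, hw⟩ := hd.left (z * g) (by rw [mul_assoc, hg2]) (by rw [mul_assoc, hzf])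
      have h1 : (z - w * f) * g = 0 := by rw [sub_mul, mul_assoc w, ← hfg, hw, sub_self]
      rcases he.left x (z - w * f) f (by rw [sub_mul, hz, mul_assoc, hf.right]) hf.right with
        ⟨v, hv⟩ | ⟨v, hv⟩
      · exact ⟨v + w, by rw [add_mul, ← hv, sub_add_cancel]⟩
      · exact absurd (by rw [hfg, hv, mul_assoc, h1, mul_zero]) hd₀.ne_zero
    · rcases he.right x z g hz hg1 with ⟨w, hw⟩ | ⟨w, hw⟩
      · obtain ⟨v, hv⟩ := hd.right (e y₁ * w) (by rw [← mul_assoc, hid]) (by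
          rw [← mul_assoc, hd₀.right, hfg, mul_assoc, ← hw, hfz])
        exact ⟨v, by rw [mul_assoc, ← hv, ← mul_assoc, hg2, hw]⟩
      · exact absurd (by rw [hfg, hw, ← mul_assoc, hfz, zero_mul]) hd₀.ne_zero

theorem exists_isExactPair_left (he : IsSerialSystem e) {y₀ y₁ y₂ x : ι} {d₀ d₁ f : A}
    (hd₁ : IsArrow e y₂ y₁ d₁) (hd₀ : IsArrow e y₁ y₀ d₀) (hd : IsExactPair e y₁ d₁ d₀)
    (hf : IsArrow e x y₀ f) : ∃ f', IsArrow e y₂ x f' ∧ IsExactPair e x f' f := by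
  have hu : ∀ {x y : Aᵐᵒᵖ}, x = y → x.unop = y.unop := fun h => congrArg _ h
  obtain ⟨f', hf', h⟩ := he.op.exists_isExactPair_right (he.isArrow_op hd₀) (he.isArrow_op hd₁)
    ⟨congrArg MulOpposite.op hd.mul_eq_zero,
      fun z hz h => (hd.right z.unop (hu hz) (hu h)).imp' MulOpposite.op
        fun w hw => congrArg MulOpposite.op hw,
      fun z hz h => (hd.left z.unop (hu hz) (hu h)).imp' MulOpposite.op
        fun w hw => congrArg MulOpposite.op hw⟩ (he.isArrow_op hf)
  refine ⟨f'.unop, he.isArrow_unop hf', congrArg MulOpposite.unop h.mul_eq_zero, ?_, ?_⟩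
  · exact fun z hz hzf => (h.right (MulOpposite.op z) (congrArg MulOpposite.op hz)
      (congrArg MulOpposite.op hzf)).imp' MulOpposite.unop fun w hw => congrArg MulOpposite.unop hw
  · exact fun z hz hzf => (h.left (MulOpposite.op z) (congrArg MulOpposite.op hz)
      (congrArg MulOpposite.op hzf)).imp' MulOpposite.unop fun w hw => congrArg MulOpposite.unop hw

theorem exists_left_generator (he : IsSerialSystem e) (i : ι) {κ : Type*} (s : Finset κ)
    (hs : s.Nonempty) (f : κ → A) (hf : ∀ k, f k * e i = f k) :
    ∃ k ∈ s, ∀ k' ∈ s, ∃ w, f k' = w * f k := by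
  classical
  induction hs using Finset.Nonempty.cons_induction with
  | singleton a => exact ⟨a, by simp, fun k' hk' => ⟨1, by rw [Finset.mem_singleton.mp hk', one_mul]⟩⟩
  | cons a s ha hs ih =>
    obtain ⟨k, hk, h⟩ := ih
    rcases he.left i (f a) (f k) (hf a) (hf k) with ⟨w, hw⟩ | ⟨w, hw⟩
    · refine ⟨k, by simp [hk], fun k' hk' => ?_⟩
      rcases Finset.mem_cons.mp hk' with rfl | hk'
      · exact ⟨w, hw⟩
      · exact h k' hk'
    · refine ⟨a, by simp, fun k' hk' => ?_⟩
      rcases Finset.mem_cons.mp hk' with rfl | hk'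
      · exact ⟨1, by rw [one_mul]⟩
      · obtain ⟨v, hv⟩ := h k' hk'
        exact ⟨v * w, by rw [hv, hw, mul_assoc]⟩

theorem exists_right_generator (he : IsSerialSystem e) (i : ι) {κ : Type*} (s : Finset κ)
    (hs : s.Nonempty) (f : κ → A) (hf : ∀ k, e i * f k = f k) :
    ∃ k ∈ s, ∀ k' ∈ s, ∃ w, f k' = f k * w := by
  obtain ⟨k, hk, h⟩ := he.op.exists_left_generator i s hs (fun k => MulOpposite.op (f k))
    (fun k => congrArg MulOpposite.op (hf k))
  exact ⟨k, hk, fun k' hk' => (h k' hk').imp' MulOpposite.unop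
    fun w hw => congrArg MulOpposite.unop hw⟩

/-- A finitely generated submodule of a uniserial module is cyclic. Cutting the generators by the
idempotents first yields a generator with a definite source vertex `l`, that is, a map from `A (e
l)`. -/
theorem exists_generator_of_le (he : IsSerialSystem e) [IsNoetherianRing A] {i : ι}
    {V : Submodule A A} (hV : V ≤ leftIdeal (e i)) :
    ∃ l h, e l * h = h ∧ h ∈ V ∧ ∀ r ∈ V, ∃ w, r = w * h := by
  classical
  obtain ⟨S, hS⟩ := (inferInstance : IsNoetherian A V).noetherian ⊤ |> fun h =>
    (Submodule.fg_top V).mp h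
  have hSV : ∀ s ∈ S, s ∈ V := fun s hs => hS ▸ Submodule.subset_span hs
  -- Inserting `0` keeps the index set nonempty when `V` is zero.
  obtain ⟨⟨⟨s, hs⟩, l⟩, -, h⟩ := he.exists_left_generator i
    (Finset.univ : Finset ({x // x ∈ insert 0 S} × ι)) ⟨⟨⟨0, by simp⟩, i⟩, by simp⟩
    (fun q => e q.2 * q.1.1) (by
      rintro ⟨⟨s, hs⟩, l⟩
      rcases Finset.mem_insert.mp hs with rfl | hs
      · simp
      · rw [mul_assoc, show s * e i = s from hV (hSV s hs)])
  refine ⟨l, e l * s, by rw [← mul_assoc, he.mul_self], ?_, fun r hr => ?_⟩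
  · rcases Finset.mem_insert.mp hs with rfl | hs
    · simp
    · exact V.smul_mem _ (hSV s hs)
  · have : V ≤ Submodule.span A {e l * s} := by
      rw [← hS, Submodule.span_le]
      intro t ht
      rw [SetLike.mem_coe, ← one_mul t, ← he.coi.complete, Finset.sum_mul]
      refine Submodule.sum_mem _ fun q _ => ?_
      obtain ⟨w, hw⟩ := h ⟨⟨t, Finset.mem_insert_of_mem ht⟩, q⟩ (by simp)
      exact Submodule.mem_span_singleton.mpr ⟨w, hw.symm⟩
    obtain ⟨w, hw⟩ := Submodule.mem_span_singleton.mp (this hr)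
    exact ⟨w, hw.symm⟩

end IsSerialSystem

end Arrows

/-! ### Cokernels of arrows and complete resolutions built from arrows. -/

section Presentations

variable {A : Type u} [Ring A] {ι : Type} [Fintype ι] {e : ι → A}

theorem exists_linearMap_of_generator {M N : Type*} [AddCommGroup M] [Module A M] [AddCommGroup N]
    [Module A N] {x : M} (hx : ∀ m : M, ∃ r : A, r • x = m) {y : N}
    (h : ∀ r : A, r • x = 0 → r • y = 0) : ∃ φ : M →ₗ[A] N, φ x = y := by
  let q := (LinearMap.toSpanSingleton A M x).quotKerEquivOfSurjective hx
  refine ⟨Submodule.liftQ _ (LinearMap.toSpanSingleton A N y) (fun r hr => h r hr) ∘ₗ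
    q.symm.toLinearMap, ?_⟩
  have : q.symm x = Submodule.Quotient.mk 1 := by
    rw [LinearEquiv.symm_apply_eq]
    exact (one_smul A x).symm
  rw [LinearMap.comp_apply, LinearEquiv.coe_coe, this]
  exact one_smul A y

theorem nonempty_linearEquiv_of_generator {M N : Type*} [AddCommGroup M] [Module A M]
    [AddCommGroup N] [Module A N] {x : M} (hx : ∀ m : M, ∃ r : A, r • x = m) {y : N}
    (hy : ∀ n : N, ∃ r : A, r • y = n) (h : ∀ r : A, r • x = 0 ↔ r • y = 0) :
    Nonempty (M ≃ₗ[A] N) :=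
  nonempty_linearEquiv_of_ker_eq (LinearMap.toSpanSingleton A M x)
    (LinearMap.toSpanSingleton A N y) hx hy (by ext r; exact h r)

/-- The module `M` is isomorphic to the cokernel of the right multiplication with `f`, viewed as a
map to `A (e j)`. -/
def IsPresentedBy (e : ι → A) (j : ι) (f : A) (M : Type*) [AddCommGroup M] [Module A M] : Prop :=
  ∃ x : M, e j • x = x ∧ (∀ m, ∃ r : A, r • x = m) ∧ ∀ r : A, r • x = 0 ↔ ∃ w, r * e j = w * f

/-- A nonzero non-isomorphism `A (e i) → A (e j)` the cokernel of which is, up to projective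
summands, a direct summand of a Gorenstein projective module. -/
def IsGorensteinArrow (e : ι → A) (i j : ι) (f : A) : Prop :=
  IsArrow e i j f ∧ ∃ M : FGModuleCat.{u} A, IsPresentedBy e j f M ∧ IsGorensteinSummand A M

/-- The index set of the projective covers of the indecomposable non-projective Gorenstein
projective modules. -/
def gorensteinIndex (e : ι → A) : Set ι := {j | ∃ i f, IsGorensteinArrow e i j f}

namespace IsSerialSystem

/-- The left ideal `A f` is the first syzygy of the cokernel of `f`, hence again a Gorenstein
summand, and `h` generates the kernel of its cover by `A (e i)`. Exactness of the dual is the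
extension property of the inclusion of `A f` in `A (e j)`. -/
theorem exists_pred (he : IsSerialSystem e) [IsNoetherianRing A] {i j : ι} {f : A}
    (hf : IsGorensteinArrow e i j f) : ∃ l h, IsGorensteinArrow e l i h ∧ IsExactPair e i h f := by
  obtain ⟨hf, M, ⟨x, hx, hgen, hann⟩, hM⟩ := hf
  have hid := he.mul_self
  have := leftIdeal_projective (hid j)
  have := leftIdeal_finite (hid j)
  have hle : Submodule.span A {f} ≤ leftIdeal (e j) :=
    (Submodule.span_singleton_le_iff_mem _ _).mpr hf.right
  let κ : Submodule.span A {f} →ₗ[A] leftIdeal (e j) := Submodule.inclusion hle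
  let π : leftIdeal (e j) →ₗ[A] M := LinearMap.toSpanSingleton A M x ∘ₗ (leftIdeal (e j)).subtype
  have hκ : Function.Injective κ := Submodule.inclusion_injective hle
  have hπ : Function.Surjective π := by
    intro m
    obtain ⟨r, rfl⟩ := hgen m
    exact ⟨⟨r * e j, by rw [mem_leftIdeal, mul_assoc, hid]⟩, by simp [π, mul_smul, hx]⟩
  have hκπ : Function.Exact κ π := by
    rintro ⟨r, hr⟩
    constructor
    · intro h
      obtain ⟨w, hw⟩ := (hann r).mp h
      exact ⟨⟨r, Submodule.mem_span_singleton.mpr ⟨w, by rw [smul_eq_mul, ← hw]; exact hr⟩⟩, rfl⟩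
    · rintro ⟨⟨r', hr'⟩, h⟩
      obtain rfl : r' = r := congrArg Subtype.val h
      obtain ⟨w, hw⟩ := Submodule.mem_span_singleton.mp hr'
      exact (hann r').mpr ⟨w, by rw [show r' * e j = r' from hr, ← hw, smul_eq_mul]⟩
  have happ := hM.isLeftApproximation hκ hκπ hπ
  have hU := hM.syzygy hκ hκπ hπ
  let V : Submodule A A := leftIdeal (e i) ⊓ LinearMap.ker (LinearMap.toSpanSingleton A A f)
  obtain ⟨l, h, hl, hV, hgenV⟩ := he.exists_generator_of_le (V := V) (i := i) inf_le_left
  have hVmem : ∀ r, r * e i = r → r * f = 0 → r ∈ V := fun r h1 h2 => ⟨h1, h2⟩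
  have hi : h * e i = h := hV.1
  have hhf : h * f = 0 := hV.2
  let u : Submodule.span A {f} := ⟨f, Submodule.mem_span_singleton_self f⟩
  have hu : ∀ m : Submodule.span A {f}, ∃ r : A, r • u = m := by
    rintro ⟨m, hm⟩
    obtain ⟨r, rfl⟩ := Submodule.mem_span_singleton.mp hm
    exact ⟨r, rfl⟩
  have huann : ∀ r : A, r • u = 0 ↔ ∃ w, r * e i = w * h := by
    intro r
    have : r • u = 0 ↔ r * f = 0 := Subtype.ext_iff
    rw [this]
    constructor
    · intro hr
      exact hgenV _ (hVmem _ (by rw [mul_assoc, hid]) (by rw [mul_assoc, hf.left, hr]))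
    · rintro ⟨w, hw⟩
      rw [← hf.left, ← mul_assoc, hw, mul_assoc, hhf, mul_zero]
  have hright : ∀ z, e i * z = z → h * z = 0 → ∃ w, z = f * w := by
    intro z hz hhz
    obtain ⟨φ, hφ⟩ := exists_linearMap_of_generator hu (y := z) (fun r hr => by
      obtain ⟨w, hw⟩ := (huann r).mp hr
      rw [smul_eq_mul, ← hz, ← mul_assoc, hw, mul_assoc, hhz, mul_zero])
    obtain ⟨ψ, hψ⟩ := happ φ
    refine ⟨ψ ⟨e j, hid j⟩, ?_⟩
    have h1 : κ u = f • ⟨e j, hid j⟩ := Subtype.ext hf.right.symm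
    rw [← hφ, ← hψ, LinearMap.comp_apply, h1, map_smul, smul_eq_mul]
  refine ⟨l, h, ⟨⟨hl, hi, ?_, fun w hw => ?_⟩, FGModuleCat.of A (Submodule.span A {f}), ⟨u, ?_, hu, huann⟩, hU⟩,
    hhf, fun z hz hzf => hgenV z (hVmem z hz hzf), hright⟩
  · rintro rfl
    obtain ⟨w, hw⟩ := hright (e i) (hid i) (zero_mul _)
    obtain ⟨w', hw'⟩ := he.exists_left_inv hf.right hw.symm
    exact hf.not_unit w' hw'
  · apply hf.ne_zero
    rw [← hf.left, ← hw, mul_assoc, hhf, mul_zero]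
  · exact Subtype.ext hf.left

/-- An injective left approximation of the cokernel of `f` can be cut down to a single `A (e q)`.
The image of the generator is the next arrow, and the cosyzygy is its cokernel. -/
theorem exists_succ (he : IsSerialSystem e) {i j : ι} {f : A}
    (hf : IsGorensteinArrow e i j f) : ∃ q g, IsGorensteinArrow e j q g ∧ IsExactPair e j f g := by
  obtain ⟨hf, M, ⟨x, hx, hgen, hann⟩, hM⟩ := hf
  have hid := he.mul_self
  have hfx : f • x = 0 := (hann f).mpr ⟨1, by rw [hf.right, one_mul]⟩
  have hx0 : x ≠ 0 := by
    rintro rfl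
    obtain ⟨w, hw⟩ := (hann 1).mp (smul_zero _)
    exact hf.not_unit w (by rw [← hw, one_mul])
  obtain ⟨Q, j₀, hQ, hinj, happ⟩ := hM.exists_isLeftApproximation
  obtain ⟨n, s, g, -, -, hs⟩ := Module.Finite.exists_comp_eq_id_of_projective A Q
  have hgj : e j • g (j₀ x) = g (j₀ x) := by rw [← map_smul, ← map_smul, hx]
  have hgx : g (j₀ x) ≠ 0 := by
    intro h0
    have : j₀ x = 0 := by rw [← LinearMap.id_apply (R := A) (j₀ x), ← hs, LinearMap.comp_apply, h0, map_zero]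
    exact hx0 (hinj (this.trans (map_zero _).symm))
  obtain ⟨l₀, -⟩ : ∃ l₀, g (j₀ x) l₀ ≠ 0 := by
    by_contra! h
    exact hgx (funext h)
  -- The coordinates of the image of `x` in `A ^ n`, cut by the idempotents, all lie in the
  -- uniserial `e j A`. One of them divides all others, so the whole approximation factors through
  -- that coordinate.
  obtain ⟨⟨l, q⟩, -, hmax⟩ := he.exists_right_generator j (Finset.univ : Finset (Fin n × ι))
    ⟨(l₀, j), by simp⟩ (fun p => g (j₀ x) p.1 * e p.2) (fun p => by
      rw [← mul_assoc]
      exact congrArg (fun v : Fin n → A => v p.1 * e p.2) hgj)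
  let J : M →ₗ[A] leftIdeal (e q) := LinearMap.codRestrict _
    (LinearMap.toSpanSingleton A A (e q) ∘ₗ LinearMap.proj l ∘ₗ g ∘ₗ j₀)
    (fun m => by simp [mem_leftIdeal, mul_assoc, hid])
  set z₀ : A := g (j₀ x) l * e q with hz₀
  have hJx : (J x).1 = z₀ := rfl
  have hz₀l : e j * z₀ = z₀ := by
    rw [hz₀, ← mul_assoc]
    exact congrArg (fun v : Fin n → A => v l * e q) hgj
  have hz₀r : z₀ * e q = z₀ := (J x).2
  have hall : ∀ l', ∃ w, g (j₀ x) l' = z₀ * w := by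
    intro l'
    choose w hw using fun p => hmax p (Finset.mem_univ p)
    refine ⟨∑ p, w (l', p), ?_⟩
    rw [Finset.mul_sum, ← mul_one (g (j₀ x) l'), ← he.coi.complete, Finset.mul_sum]
    exact Finset.sum_congr rfl fun p _ => hw (l', p)
  choose W hW using hall
  let T : leftIdeal (e q) →ₗ[A] Q :=
    s ∘ₗ LinearMap.pi (fun l' => LinearMap.toSpanSingleton A A (W l')) ∘ₗ (leftIdeal (e q)).subtype
  have hT : T ∘ₗ J = j₀ := by
    apply LinearMap.ext
    intro m
    obtain ⟨r, rfl⟩ := hgen m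
    simp only [map_smul]
    congr 1
    have : j₀ x = s (g (j₀ x)) := (LinearMap.congr_fun hs _).symm
    rw [this]
    simp only [T, LinearMap.comp_apply]
    congr 1
    funext l'
    exact (hW l').symm
  have hJapp : IsLeftApproximation J := by
    intro φ
    obtain ⟨ψ, hψ⟩ := happ φ
    exact ⟨ψ ∘ₗ T, by rw [LinearMap.comp_assoc, hT, hψ]⟩
  have hJinj : Function.Injective J := by
    rw [← hT, LinearMap.coe_comp] at hinj
    exact hinj.of_comp
  have hJr : ∀ r : A, (J (r • x)).1 = r * z₀ := fun r => by rw [map_smul]; rfl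
  have := leftIdeal_projective (hid q)
  have := leftIdeal_finite (hid q)
  have hC : IsGorensteinSummand A (leftIdeal (e q) ⧸ LinearMap.range J) :=
    hM.cosyzygy hJapp (LinearMap.exact_map_mkQ_range J) (Submodule.mkQ_surjective _)
  have hfz : f * z₀ = 0 := by rw [← hJr, hfx, map_zero]; rfl
  have hz0 : z₀ ≠ 0 := by
    intro h0
    exact hx0 (hJinj (Subtype.ext (by rw [hJx, h0, map_zero]; rfl)))
  refine ⟨q, z₀, ⟨he.isArrow_of_isExactPair hf hz₀l hz₀r hz0 hfz,
    FGModuleCat.of A (leftIdeal (e q) ⧸ LinearMap.range J),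
    ⟨Submodule.Quotient.mk ⟨e q, hid q⟩, ?_, ?_, ?_⟩, hC⟩, hfz, ?_, ?_⟩
  · rw [← Submodule.Quotient.mk_smul]
    congr 1
    exact Subtype.ext (hid q)
  · intro m
    obtain ⟨⟨r, hr⟩, rfl⟩ := Submodule.mkQ_surjective _ m
    refine ⟨r, ?_⟩
    rw [← Submodule.Quotient.mk_smul]
    exact congrArg _ (Subtype.ext hr)
  · intro r
    rw [← Submodule.Quotient.mk_smul, Submodule.Quotient.mk_eq_zero]
    constructor
    · rintro ⟨m, hm⟩
      obtain ⟨w, rfl⟩ := hgen m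
      exact ⟨w, by rw [← hJr, hm]; rfl⟩
    · rintro ⟨w, hw⟩
      exact ⟨w • x, Subtype.ext (by rw [hJr, ← hw]; rfl)⟩
  · intro z hz hzz
    have : z • x = 0 := hJinj (Subtype.ext (by rw [hJr, hzz, map_zero]; rfl))
    obtain ⟨w, hw⟩ := (hann z).mp this
    exact ⟨w, by rw [← hz, hw]⟩
  · intro z hz hfz
    obtain ⟨φ, hφ⟩ := exists_linearMap_of_generator hgen (y := z) (fun r hr => by
      obtain ⟨w, hw⟩ := (hann r).mp hr
      rw [smul_eq_mul, ← hz, ← mul_assoc, hw, mul_assoc, hfz, mul_zero])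
    obtain ⟨ψ, hψ⟩ := hJapp φ
    refine ⟨ψ ⟨e q, hid q⟩, ?_⟩
    have h1 : J x = z₀ • ⟨e q, hid q⟩ := Subtype.ext hz₀r.symm
    rw [← hφ, ← hψ, LinearMap.comp_apply, h1, map_smul, smul_eq_mul]

theorem mem_gorensteinIndex_source (he : IsSerialSystem e) [IsNoetherianRing A] {i j : ι} {f : A}
    (hf : IsGorensteinArrow e i j f) : i ∈ gorensteinIndex e := by
  obtain ⟨l, h, hh, -⟩ := he.exists_pred hf
  exact ⟨l, h, hh⟩

/-- Every nonzero non-isomorphism out of a projective cover of a Gorenstein projective module has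
a successor. -/
theorem exists_arrow_right (he : IsSerialSystem e) {i j : ι} {f : A} (hi : i ∈ gorensteinIndex e)
    (hf : IsArrow e i j f) :
    ∃ l ∈ gorensteinIndex e, ∃ g, IsArrow e j l g ∧ IsExactPair e j f g := by
  obtain ⟨k, d, hd⟩ := hi
  -- The given arrow `d` only ends at `i`; its successor `d₁` starts there, so the pair `d₁, d₂` can
  -- be transferred to `f`.
  obtain ⟨q, d₁, hd₁, -⟩ := he.exists_succ hd
  obtain ⟨q₂, d₂, hd₂, h⟩ := he.exists_succ hd₁
  obtain ⟨g, hg⟩ := he.exists_isExactPair_right hd₁.1 hd₂.1 h hf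
  exact ⟨q₂, ⟨q, d₂, hd₂⟩, g, hg⟩

theorem exists_arrow_left (he : IsSerialSystem e) [IsNoetherianRing A] {i j : ι} {f : A}
    (hj : j ∈ gorensteinIndex e) (hf : IsArrow e i j f) :
    ∃ l ∈ gorensteinIndex e, ∃ h, IsArrow e l i h ∧ IsExactPair e i h f := by
  obtain ⟨k, d, hd⟩ := hj
  obtain ⟨q, d₁, hd₁, hd₁'⟩ := he.exists_pred hd
  obtain ⟨g, hg⟩ := he.exists_isExactPair_left hd₁.1 hd.1 hd₁' hf
  exact ⟨q, he.mem_gorensteinIndex_source hd₁, g, hg⟩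

end IsSerialSystem

theorem exists_int_sequence {S : Type*} (R : S → S → Prop) (hl : ∀ t, ∃ t', R t' t)
    (hr : ∀ t, ∃ t', R t t') (t₀ : S) : ∃ s : ℤ → S, s 0 = t₀ ∧ ∀ m, R (s (m + 1)) (s m) := by
  choose p hp using hl
  choose q hq using hr
  refine ⟨fun m => Int.casesOn m (fun n => p^[n] t₀) (fun n => q^[n + 1] t₀), rfl, fun m => ?_⟩
  cases m with
  | ofNat n =>
    change R (p^[n + 1] t₀) (p^[n] t₀)
    rw [Function.iterate_succ_apply']
    exact hp _
  | negSucc n =>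
    cases n with
    | zero => exact hq t₀
    | succ n =>
      change R (q^[n + 1] t₀) (q^[n + 1 + 1] t₀)
      rw [Function.iterate_succ_apply' q (n + 1)]
      exact hq _

/-- A bi-infinite sequence of exact pairs gives a complete projective resolution. -/
theorem exists_completeProjectiveResolution (he : IsSerialSystem e) (n : ℤ → ι) (a : ℤ → A)
    (hl : ∀ m, e (n (m + 1)) * a m = a m) (hr : ∀ m, a m * e (n m) = a m)
    (hex : ∀ m, IsExactPair e (n (m + 1)) (a (m + 1)) (a m)) :
    ∃ (K : CompleteProjectiveResolution A) (x : LinearMap.range (K.d 0)),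
      (∀ m, ∃ r : A, r • x = m) ∧ ∀ r : A, r • x = 0 ↔ r * a 0 = 0 := by
  have hid := he.mul_self
  have hfin : ∀ m, Module.Finite A (leftIdeal (e (n m))) := fun m => leftIdeal_finite (hid _)
  let d : ∀ m, leftIdeal (e (n (m + 1))) →ₗ[A] leftIdeal (e (n m)) := fun m =>
    LinearMap.restrict (LinearMap.toSpanSingleton A A (a m))
      (fun y _ => by simp [mem_leftIdeal, mul_assoc, hr])
  have hd : ∀ m y, (d m y).1 = y.1 * a m := fun m y => rfl
  let ε : ∀ m, leftIdeal (e (n m)) := fun m => ⟨e (n m), hid _⟩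
  have hε : ∀ m (y : leftIdeal (e (n m))), y = y.1 • ε m := fun m y => Subtype.ext y.2.symm
  have hdε : ∀ m, d m (ε (m + 1)) = a m • ε m := fun m => Subtype.ext (by
    rw [hd]; exact (hl m).trans (hr m).symm)
  let K : CompleteProjectiveResolution A :=
    { P := fun m => FGModuleCat.of A (leftIdeal (e (n m)))
      projective := fun m => leftIdeal_projective (hid _)
      d := d
      exact := by
        intro m y
        constructor
        · intro hy
          obtain ⟨w, hw⟩ := (hex m).left y.1 y.2 (congrArg Subtype.val hy)
          refine ⟨⟨w * e (n (m + 1 + 1)), by rw [mem_leftIdeal, mul_assoc, hid]⟩, Subtype.ext ?_⟩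
          rw [hd, mul_assoc, hl, hw]
        · rintro ⟨z, rfl⟩
          exact Subtype.ext (by rw [hd, hd, mul_assoc, (hex m).mul_eq_zero, mul_zero]; rfl)
      hom_exact := by
        intro m g
        constructor
        · intro hg
          have hg' : g (d (m + 1) (ε (m + 1 + 1))) = 0 := LinearMap.congr_fun hg _
          rw [hdε, map_smul, smul_eq_mul] at hg'
          obtain ⟨w, hw⟩ := (hex m).right (g (ε (m + 1))) (by
            rw [← smul_eq_mul, ← map_smul]
            exact congrArg g (Subtype.ext (hid _))) hg'
          refine ⟨LinearMap.toSpanSingleton A A w ∘ₗ (leftIdeal (e (n m))).subtype, ?_⟩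
          apply LinearMap.ext
          intro y
          change (d m y).1 * w = g y
          rw [hd, mul_assoc, ← hw, ← smul_eq_mul, ← map_smul, ← hε]
        · rintro ⟨φ, rfl⟩
          apply LinearMap.ext
          intro y
          change φ (d m (d (m + 1) y)) = 0
          have : d m (d (m + 1) y) = 0 :=
            Subtype.ext (by rw [hd, hd, mul_assoc, (hex m).mul_eq_zero, mul_zero]; rfl)
          rw [this, map_zero] }
  have hx : ∀ r : A, r * e (n (0 + 1)) * a 0 = r * a 0 := fun r => by rw [mul_assoc, hl]
  refine ⟨K, ⟨d 0 (ε (0 + 1)), ε (0 + 1), rfl⟩, ?_, fun r => ?_⟩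
  · rintro ⟨_, y, rfl⟩
    refine ⟨y.1, Subtype.ext ?_⟩
    change y.1 • d 0 (ε (0 + 1)) = d 0 y
    rw [← map_smul, ← hε (0 + 1) y]
  · rw [Subtype.ext_iff]
    change r • d 0 (ε (0 + 1)) = 0 ↔ _
    rw [Subtype.ext_iff]
    change r * (e (n (0 + 1)) * a 0) = 0 ↔ _
    rw [hl]

theorem gorensteinProj_isGorensteinSummand {M : FGModuleCat.{u} A} (h : gorensteinProj A M) :
    IsGorensteinSummand A M := by
  obtain ⟨K, ⟨E⟩⟩ := h
  exact ⟨K, 0, FGModuleCat.of A PUnit.{u + 1}, FGModuleCat.of A PUnit.{u + 1},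
    inferInstanceAs (Module.Projective A PUnit.{u + 1}), ⟨E.prodCongr (LinearEquiv.refl A PUnit.{u + 1})⟩⟩

namespace IsSerialSystem

/-- The cokernel is a nonzero quotient of a uniserial module, hence indecomposable. If it were
projective, a splitting would give an idempotent in the corner at `j`; the value `0` kills the
generator `x`, and the value `e j` kills `f`. -/
theorem indecomposable_of_isPresentedBy (he : IsSerialSystem e) {i j : ι} {f : A}
    (hf : IsArrow e i j f) {M : Type*} [AddCommGroup M] [Module A M] (hM : IsPresentedBy e j f M) :
    IsIndecomposableModule A M ∧ ¬ Module.Projective A M := by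
  obtain ⟨x, hx, hgen, hann⟩ := hM
  have hid := he.mul_self
  have hx0 : x ≠ 0 := by
    rintro rfl
    obtain ⟨w, hw⟩ := (hann 1).mp (smul_zero _)
    exact hf.not_unit w (by rw [← hw, one_mul])
  have : Nontrivial M := ⟨x, 0, hx0⟩
  refine ⟨(he.isUniserial_of_generator hx hgen).isIndecomposable, fun hP => ?_⟩
  obtain ⟨s, hs⟩ := Module.projective_lifting_property (LinearMap.toSpanSingleton A M x)
    LinearMap.id hgen
  have hs' : s x • x = x := LinearMap.congr_fun hs x
  have h1 : s x * s x = s x := by rw [← smul_eq_mul, ← map_smul, hs']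
  have h2 : e j * s x = s x := by rw [← smul_eq_mul, ← map_smul, hx]
  have h3 : f * s x = 0 := by
    rw [← smul_eq_mul, ← map_smul, (hann f).mpr ⟨1, by rw [hf.right, one_mul]⟩, map_zero]
  rcases he.prim j (s x * e j) (by rw [mul_assoc, ← mul_assoc (e j), h2, ← mul_assoc, h1])
    (by rw [← mul_assoc, h2]) (by rw [mul_assoc, hid]) with h | h
  · apply hx0
    calc x = (s x * e j) • x := by rw [mul_smul, hx, hs']
      _ = 0 := by rw [h, zero_smul]
  · apply hf.ne_zero
    rw [← hf.right, ← h, ← mul_assoc, h3, zero_mul]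

/-- The cokernel of a nonzero non-isomorphism between projective covers of indecomposable
non-projective Gorenstein projective modules is Gorenstein projective. -/
theorem gorensteinProj_of_isPresentedBy (he : IsSerialSystem e) [IsNoetherianRing A] {i j : ι}
    {f : A} (hi : i ∈ gorensteinIndex e) (hj : j ∈ gorensteinIndex e) (hf : IsArrow e i j f)
    {M : FGModuleCat.{u} A} (hM : IsPresentedBy e j f M) : gorensteinProj A M := by
  -- The cokernel of `f` is the image of the next arrow `g`, so `g` is placed in degree `0` of the
  -- resolution.
  obtain ⟨l, hl, g, hg, hfg⟩ := he.exists_arrow_right hi hf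
  let S := {t : ι × ι × A // t.1 ∈ gorensteinIndex e ∧ t.2.1 ∈ gorensteinIndex e ∧
    IsArrow e t.1 t.2.1 t.2.2}
  let R : S → S → Prop := fun t' t => t'.1.2.1 = t.1.1 ∧ IsExactPair e t.1.1 t'.1.2.2 t.1.2.2
  obtain ⟨s, hs0, hs⟩ := exists_int_sequence R
    (by
      rintro ⟨⟨i, j, f⟩, hi, hj, hf⟩
      obtain ⟨l, hl, h, hh, hex⟩ := he.exists_arrow_left hj hf
      exact ⟨⟨⟨l, i, h⟩, hl, hi, hh⟩, rfl, hex⟩)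
    (by
      rintro ⟨⟨i, j, f⟩, hi, hj, hf⟩
      obtain ⟨l, hl, h, hh, hex⟩ := he.exists_arrow_right hi hf
      exact ⟨⟨⟨j, l, h⟩, hj, hl, hh⟩, rfl, hex⟩)
    ⟨⟨j, l, g⟩, hj, hl, hg⟩
  obtain ⟨K, y, hy, hyann⟩ := exists_completeProjectiveResolution he (fun m => (s m).1.2.1)
    (fun m => (s m).1.2.2) (fun m => by rw [(hs m).1]; exact (s m).2.2.2.left)
    (fun m => (s m).2.2.2.right) (fun m => by rw [(hs m).1]; exact (hs m).2)
  obtain ⟨x, hx, hgen, hann⟩ := hM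
  refine ⟨K, nonempty_linearEquiv_of_generator hgen hy fun r => ?_⟩
  rw [hyann, hann, hs0]
  change _ ↔ r * g = 0
  constructor
  · rintro ⟨w, hw⟩
    rw [← hg.left, ← mul_assoc, hw, mul_assoc, hfg.mul_eq_zero, mul_zero]
  · intro h
    exact hfg.left _ (by rw [mul_assoc, he.mul_self]) (by rw [mul_assoc, hg.left, h])

/-- The generator of `M` gives a map from `A (e j)`, and a generator of its kernel is the arrow; it
is nonzero because `M` is not projective. -/
theorem exists_isPresentedBy (he : IsSerialSystem e) [IsArtinianRing A] {M : FGModuleCat.{u} A}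
    (hM : IsIndecomposableModule A M) (hP : ¬ Module.Projective A M) (hG : IsGorensteinSummand A M) :
    ∃ i j f, IsGorensteinArrow e i j f ∧ IsPresentedBy e j f M := by
  obtain ⟨j, x, hx, hgen⟩ := he.exists_generator hM
  have hid := he.mul_self
  have := hM.1
  have hx0 : x ≠ 0 := by
    rintro rfl
    obtain ⟨m, hm⟩ := exists_ne (0 : M)
    obtain ⟨r, rfl⟩ := hgen m
    exact hm (smul_zero r)
  let V : Submodule A A := leftIdeal (e j) ⊓ LinearMap.ker (LinearMap.toSpanSingleton A M x)
  obtain ⟨i, f, hi, hV, hgenV⟩ := he.exists_generator_of_le (V := V) (i := j) inf_le_left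
  have hj : f * e j = f := hV.1
  have hfx : f • x = 0 := hV.2
  have hann : ∀ r : A, r • x = 0 ↔ ∃ w, r * e j = w * f := by
    intro r
    constructor
    · intro hr
      refine hgenV _ ⟨by rw [SetLike.mem_coe, mem_leftIdeal, mul_assoc, hid], ?_⟩
      change (r * e j) • x = 0
      rw [mul_smul, hx, hr]
    · rintro ⟨w, hw⟩
      rw [← hx, ← mul_smul, hw, mul_smul, hfx, smul_zero]
  have hp : IsPresentedBy e j f M := ⟨x, hx, hgen, hann⟩
  refine ⟨i, j, f, ⟨⟨hi, hj, ?_, fun w hw => hx0 ?_⟩, M, hp, hG⟩, hp⟩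
  · rintro rfl
    apply hP
    obtain ⟨E⟩ := nonempty_linearEquiv_of_generator (x := (⟨e j, hid j⟩ : leftIdeal (e j)))
      (fun m => ⟨m.1, Subtype.ext m.2⟩) hgen (fun r => by
        rw [hann, Subtype.ext_iff]
        simp)
    have := leftIdeal_projective (hid j)
    exact Module.Projective.of_equiv E
  · rw [← hx, ← hw, mul_smul, hfx, smul_zero]

end IsSerialSystem

end Presentations

theorem projective_pi {R : Type*} [Ring R] {κ : Type*} [Finite κ] {W : κ → Type*}
    [∀ i, AddCommGroup (W i)] [∀ i, Module R (W i)] [∀ i, Module.Projective R (W i)] :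
    Module.Projective R (∀ i, W i) := by
  classical
  have := Fintype.ofFinite κ
  exact Module.Projective.of_equiv (DFinsupp.linearEquivFunOnFintype (R := R) (M := W))

/-! ### Approximations by the projectives belonging to the core. -/

section CoreApproximations

variable {A : Type u} [Ring A] {ι : Type} [Fintype ι] {e : ι → A}

/-- Right multiplication with `a` is a left approximation `A (e s) → A ε` of `A (e s)` by the
projective covers of indecomposable non-projective Gorenstein projective modules. -/
structure IsCoreApproximation (e : ι → A) (s : ι) (ε a : A) : Prop where
  target : (ε = 0 ∧ a = 0) ∨ (a ≠ 0 ∧ ∃ t ∈ gorensteinIndex e, ε = e t)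
  left : e s * a = a
  right : a * ε = a
  generates : ∀ t ∈ gorensteinIndex e, ∀ x, e s * x = x → x * e t = x → ∃ w, x = a * w
  injective : ∀ t ∈ gorensteinIndex e, ∀ h, ε * h = h → h * e t = h → a * h = 0 → h = 0

theorem IsCoreApproximation.idem {s : ι} {ε a : A} (h : IsCoreApproximation e s ε a)
    (he : IsSerialSystem e) : ε * ε = ε := by
  rcases h.target with ⟨rfl, -⟩ | ⟨-, t, -, rfl⟩
  · simp
  · exact he.mul_self t

/-- Finitely many `k`-module generators of `A`, cut by `e s` on the left and by the admissible `e t`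
on the right, lie in the uniserial `e s A`. One that divides the others serves as `a`. -/
theorem IsSerialSystem.exists_isCoreApproximation {k : Type v} [CommRing k] [Algebra k A]
    [Module.Finite k A] [IsNoetherianRing A] (he : IsSerialSystem e) (s : ι) :
    ∃ ε a, IsCoreApproximation e s ε a := by
  classical
  have hid := he.mul_self
  have triv : (∀ t ∈ gorensteinIndex e, ∀ x, e s * x = x → x * e t = x → x = 0) →
      ∃ ε a, IsCoreApproximation e s ε a := by
    intro h
    refine ⟨0, 0, Or.inl ⟨rfl, rfl⟩, by simp, by simp, fun t ht x h1 h2 => ⟨0, ?_⟩, ?_⟩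
    · rw [h t ht x h1 h2, mul_zero]
    · intro t _ x hx _ _
      rw [← hx, zero_mul]
  obtain ⟨G, hG⟩ := (Module.finite_def (R := k) (M := A)).mp inferInstance
  by_cases hne : Nonempty (gorensteinIndex e) ∧ G.Nonempty
  · obtain ⟨⟨t₀⟩, g₀, hg₀⟩ := hne
    have hfin : Fintype (gorensteinIndex e) := Fintype.ofFinite _
    obtain ⟨⟨⟨g, _⟩, ⟨t, ht⟩⟩, -, hmax⟩ := he.exists_right_generator s
      (Finset.univ : Finset (G × gorensteinIndex e)) ⟨⟨⟨g₀, hg₀⟩, t₀⟩, by simp⟩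
      (fun q => e s * q.1.1 * e q.2.1) (fun q => by simp only [← mul_assoc, hid])
    set a := e s * g * e t with ha
    have hgen : ∀ t ∈ gorensteinIndex e, ∀ x, e s * x = x → x * e t = x → ∃ w, x = a * w := by
      intro t' ht' x h1 h2
      have : ∀ x ∈ Submodule.span k (G : Set A), ∃ w, e s * x * e t' = a * w := by
        intro x hx
        induction hx using Submodule.span_induction with
        | mem x hx => exact hmax ⟨⟨x, hx⟩, ⟨t', ht'⟩⟩ (Finset.mem_univ _)
        | zero => exact ⟨0, by simp⟩
        | add x y _ _ hx hy =>
          obtain ⟨w, hw⟩ := hx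
          obtain ⟨v, hv⟩ := hy
          exact ⟨w + v, by rw [mul_add, mul_add, add_mul, hw, hv]⟩
        | smul c x _ hx =>
          obtain ⟨w, hw⟩ := hx
          exact ⟨c • w, by rw [mul_smul_comm, mul_smul_comm, smul_mul_assoc, hw]⟩
      obtain ⟨w, hw⟩ := this x (hG ▸ Submodule.mem_top)
      exact ⟨w, by rw [← hw, h1, h2]⟩
    have hal : e s * a = a := by rw [ha]; simp only [← mul_assoc, hid]
    have har : a * e t = a := by rw [ha]; simp only [mul_assoc, hid]
    by_cases ha0 : a = 0
    · apply triv
      intro t ht x h1 h2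
      obtain ⟨w, hw⟩ := hgen t ht x h1 h2
      rw [hw, ha0, zero_mul]
    refine ⟨e t, a, Or.inr ⟨ha0, t, ht, rfl⟩, hal, har, hgen, fun q hq h h1 h2 hah => ?_⟩
    by_contra h0
    have harr : IsArrow e t q h := by
      refine ⟨h1, h2, h0, fun w hw => ha0 ?_⟩
      obtain ⟨w', hw'⟩ := he.exists_right_inv h1 hw
      rw [← har, ← hw', ← mul_assoc, hah, zero_mul]
    -- If `a * h = 0`, exactness gives `a = b * h'`. As `h'` starts at an admissible vertex, `b` is
    -- again a multiple of `a`, so `a = a * (c * h')` and `a` vanishes by the Nakayama argument.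
    obtain ⟨r, hr, h', hh', hex⟩ := he.exists_arrow_left hq harr
    obtain ⟨b, hb⟩ := hex.left a har hah
    obtain ⟨c, hc⟩ := hgen r hr (e s * b * e r) (by simp only [← mul_assoc, hid])
      (by simp only [mul_assoc, hid])
    refine ha0 (he.eq_zero_of_eq_mul_right hh' har (w := c) ?_)
    rw [← mul_assoc, ← hc, mul_assoc, hh'.left, mul_assoc, ← hb, hal]
  · apply triv
    intro t ht x h1 h2
    have hG0 : G = ∅ := by
      by_contra hne'
      exact hne ⟨⟨t, ht⟩, Finset.nonempty_iff_ne_empty.mpr hne'⟩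
    have : x ∈ Submodule.span k (G : Set A) := hG ▸ Submodule.mem_top
    simpa [hG0] using this

end CoreApproximations

/-! ### Closure properties of core modules. -/

section CoreModules

variable {A : Type u} [Ring A] {ι : Type} {e : ι → A}

/-- The modules `X` such that the approximations `A (e s) → A (ε s)` induce bijections
`Hom (A (ε s)) X → Hom (A (e s)) X`. -/
structure IsCoreModule (e ε a : ι → A) (X : Type*) [AddCommGroup X] [Module A X] : Prop where
  inj : ∀ s (y : X), ε s • y = y → a s • y = 0 → y = 0
  surj : ∀ s (x : X), e s • x = x → ∃ y, ε s • y = y ∧ a s • y = x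

namespace IsCoreModule

variable {ε a : ι → A} {X Y Z : Type*} [AddCommGroup X] [Module A X] [AddCommGroup Y] [Module A Y]
  [AddCommGroup Z] [Module A Z]

theorem of_retract (hY : IsCoreModule e ε a Y) (i : X →ₗ[A] Y) (r : Y →ₗ[A] X)
    (h : ∀ x, r (i x) = x) : IsCoreModule e ε a X := by
  refine ⟨fun s y h1 h2 => ?_, fun s x hx => ?_⟩
  · rw [← h y, hY.inj s (i y) (by rw [← map_smul, h1]) (by rw [← map_smul, h2, map_zero]), map_zero]
  · obtain ⟨y, h1, h2⟩ := hY.surj s (i x) (by rw [← map_smul, hx])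
    exact ⟨r y, by rw [← map_smul, h1], by rw [← map_smul, h2, h]⟩

theorem of_equiv (hY : IsCoreModule e ε a Y) (f : X ≃ₗ[A] Y) : IsCoreModule e ε a X :=
  hY.of_retract f.toLinearMap f.symm.toLinearMap (by simp)

theorem of_surjective (hY : IsCoreModule e ε a Y) [Module.Projective A X] (f : Y →ₗ[A] X)
    (hf : Function.Surjective f) : IsCoreModule e ε a X := by
  obtain ⟨g, hg⟩ := Module.projective_lifting_property f LinearMap.id hf
  exact hY.of_retract g f (LinearMap.congr_fun hg)

theorem pi {κ : Type*} {W : κ → Type*} [∀ i, AddCommGroup (W i)] [∀ i, Module A (W i)]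
    (h : ∀ i, IsCoreModule e ε a (W i)) : IsCoreModule e ε a (∀ i, W i) := by
  refine ⟨fun s y h1 h2 => funext fun i => (h i).inj s _ (congrFun h1 i) (congrFun h2 i),
    fun s x hx => ?_⟩
  choose y h1 h2 using fun i => (h i).surj s (x i) (congrFun hx i)
  exact ⟨y, funext h1, funext h2⟩

theorem of_subsingleton [Subsingleton X] : IsCoreModule e ε a X :=
  ⟨fun _ _ _ _ => Subsingleton.elim _ _, fun _ _ _ => ⟨0, Subsingleton.elim _ _,
    Subsingleton.elim _ _⟩⟩

/-- Multiplication by `a s` is a natural map from `ε s • X` to `e s • X`. Both are exact functors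
when `e s` and `ε s` are idempotent; this lemma and the next two are instances of the five lemma. -/
theorem ker (hX : IsCoreModule e ε a X) (hY : IsCoreModule e ε a Y) {κ : Z →ₗ[A] X}
    {f : X →ₗ[A] Y} (hκ : Function.Injective κ) (h : Function.Exact κ f) :
    IsCoreModule e ε a Z := by
  refine ⟨fun s y h1 h2 => hκ ?_, fun s x hx => ?_⟩
  · rw [hX.inj s (κ y) (by rw [← map_smul, h1]) (by rw [← map_smul, h2, map_zero]), map_zero]
  · obtain ⟨y, h1, h2⟩ := hX.surj s (κ x) (by rw [← map_smul, hx])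
    obtain ⟨z, rfl⟩ := (h y).mp (hY.inj s _ (by rw [← map_smul, h1])
      (by rw [← map_smul, h2, h.apply_apply_eq_zero]))
    exact ⟨z, hκ (by rw [map_smul, h1]), hκ (by rw [map_smul, h2])⟩

theorem coker (hid : ∀ s, e s * e s = e s) (hε : ∀ s, ε s * ε s = ε s)
    (hl : ∀ s, e s * a s = a s) (hX : IsCoreModule e ε a X) (hY : IsCoreModule e ε a Y)
    {f : X →ₗ[A] Y} {c : Y →ₗ[A] Z} (h : Function.Exact f c) (hc : Function.Surjective c) :
    IsCoreModule e ε a Z := by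
  refine ⟨fun s z h1 h2 => ?_, fun s z hz => ?_⟩
  · obtain ⟨y', hy'⟩ := hc z
    obtain ⟨y, hy, rfl⟩ : ∃ y, ε s • y = y ∧ c y = z :=
      ⟨ε s • y', by rw [← mul_smul, hε], by rw [map_smul, hy', h1]⟩
    obtain ⟨x', hx'⟩ := (h (a s • y)).mp (by rw [map_smul, h2])
    obtain ⟨x, hx, hfx⟩ : ∃ x, e s • x = x ∧ f x = a s • y :=
      ⟨e s • x', by rw [← mul_smul, hid], by rw [map_smul, hx', ← mul_smul, hl]⟩
    obtain ⟨w, hw, rfl⟩ := hX.surj s x hx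
    have := hY.inj s (y - f w) (by rw [smul_sub, hy, ← map_smul, hw])
      (by rw [smul_sub, ← map_smul, hfx, sub_self])
    rw [sub_eq_zero.mp this, h.apply_apply_eq_zero]
  · obtain ⟨y, rfl⟩ := hc z
    obtain ⟨w, h1, h2⟩ := hY.surj s (e s • y) (by rw [← mul_smul, hid])
    exact ⟨c w, by rw [← map_smul, h1], by rw [← map_smul, h2, map_smul, hz]⟩

theorem ext (hε : ∀ s, ε s * ε s = ε s) (hl : ∀ s, e s * a s = a s)
    (hX : IsCoreModule e ε a X) (hZ : IsCoreModule e ε a Z)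
    {j : X →ₗ[A] Y} {c : Y →ₗ[A] Z} (hj : Function.Injective j) (h : Function.Exact j c)
    (hc : Function.Surjective c) : IsCoreModule e ε a Y := by
  refine ⟨fun s y h1 h2 => ?_, fun s y hy => ?_⟩
  · obtain ⟨x, rfl⟩ := (h y).mp (hZ.inj s _ (by rw [← map_smul, h1])
      (by rw [← map_smul, h2, map_zero]))
    rw [hX.inj s x (hj (by rw [map_smul, h1])) (hj (by rw [map_smul, h2, map_zero])), map_zero]
  · obtain ⟨z, hz, haz⟩ := hZ.surj s (c y) (by rw [← map_smul, hy])
    obtain ⟨w', rfl⟩ := hc z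
    obtain ⟨w, hw, hcw⟩ : ∃ w, ε s • w = w ∧ c w = c w' :=
      ⟨ε s • w', by rw [← mul_smul, hε], by rw [map_smul, hz]⟩
    obtain ⟨x, hx⟩ := (h (y - a s • w)).mp (by rw [map_sub, map_smul, hcw, haz, sub_self])
    obtain ⟨v, hv, rfl⟩ := hX.surj s x (hj (by
      rw [map_smul, hx, smul_sub, hy, ← mul_smul, hl]))
    exact ⟨w + j v, by rw [smul_add, hw, ← map_smul, hv], by
      rw [smul_add, ← map_smul, hx, add_sub_cancel]⟩

end IsCoreModule

end CoreModules

/-! ### The generator of the core and its universal property. -/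

section CoreFamilies

variable {A : Type u} [Ring A] {ι : Type} [Fintype ι] {e : ι → A}

/-- A family of approximations as in `IsCoreApproximation`. -/
def IsCoreFamily (e ε a : ι → A) : Prop := ∀ s, IsCoreApproximation e s (ε s) (a s)

/-- The direct sum of the projective modules `A (ε s)`. -/
abbrev CoreGenerator (ε : ι → A) : Type u := ∀ s, leftIdeal (ε s)

namespace IsCoreFamily

variable {ε a : ι → A}

theorem leftIdeal (he : IsSerialSystem e) (h : IsCoreFamily e ε a) {t : ι}
    (ht : t ∈ gorensteinIndex e) : IsCoreModule e ε a (leftIdeal (e t)) := by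
  have hid := he.mul_self
  refine ⟨fun s y h1 h2 => Subtype.ext ?_, fun s x hx => ?_⟩
  · exact (h s).injective t ht y.1 (congrArg Subtype.val h1) y.2 (congrArg Subtype.val h2)
  · obtain ⟨w, hw⟩ := (h s).generates t ht x.1 (congrArg Subtype.val hx) x.2
    refine ⟨⟨ε s * w * e t, by rw [mem_leftIdeal, mul_assoc, hid]⟩, Subtype.ext ?_,
      Subtype.ext ?_⟩
    · simp only [SetLike.val_smul, smul_eq_mul, ← mul_assoc, (h s).idem he]
    · simp only [SetLike.val_smul, smul_eq_mul, ← mul_assoc, (h s).right]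
      rw [← hw]
      exact x.2

theorem leftIdeal_target (he : IsSerialSystem e) (h : IsCoreFamily e ε a) (s : ι) :
    IsCoreModule e ε a (_root_.leftIdeal (ε s)) := by
  rcases (h s).target with ⟨h0, -⟩ | ⟨-, t, ht, h1⟩
  · have : Subsingleton (_root_.leftIdeal (ε s)) := by
      refine ⟨fun x y => Subtype.ext ?_⟩
      have hx : x.1 * ε s = x.1 := x.2
      have hy : y.1 * ε s = y.1 := y.2
      rw [← hx, ← hy]
      simp [h0]
    exact IsCoreModule.of_subsingleton
  · rw [h1]
    exact h.leftIdeal he ht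

theorem generator (he : IsSerialSystem e) (h : IsCoreFamily e ε a) :
    IsCoreModule e ε a (CoreGenerator ε) :=
  IsCoreModule.pi fun s => h.leftIdeal_target he s

theorem generator_projective (he : IsSerialSystem e) (h : IsCoreFamily e ε a) :
    Module.Projective A (CoreGenerator ε) := by
  have := fun s => leftIdeal_projective ((h s).idem he)
  exact projective_pi

theorem generator_finite (he : IsSerialSystem e) (h : IsCoreFamily e ε a) :
    Module.Finite A (CoreGenerator ε) := by
  have := fun s => leftIdeal_finite ((h s).idem he)
  infer_instance

/-- The approximation of `1`. -/
def unit (h : IsCoreFamily e ε a) : CoreGenerator ε := fun s => ⟨a s, (h s).right⟩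

theorem smul_unit [DecidableEq ι] (he : IsSerialSystem e) (h : IsCoreFamily e ε a) (s : ι) :
    e s • h.unit = Pi.single s (a s • ⟨ε s, (h s).idem he⟩) := by
  funext s'
  by_cases hs : s' = s
  · subst hs
    rw [Pi.single_eq_same]
    exact Subtype.ext ((h s').left.trans (h s').right.symm)
  · rw [Pi.single_eq_of_ne hs]
    refine Subtype.ext ?_
    change e s * a s' = 0
    rw [← (h s').left, ← mul_assoc, he.coi.ortho (Ne.symm hs), zero_mul]

/-- A map out of the generator is a choice of elements `y s` in `ε s • X`, and it sends `unit` to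
the sum of the `a s • y s`. So every `x` is reached by lifting its components `e s • x`. -/
theorem exists_linearMap (he : IsSerialSystem e) (h : IsCoreFamily e ε a) {X : Type*}
    [AddCommGroup X] [Module A X] (hX : IsCoreModule e ε a X) (x : X) :
    ∃ φ : CoreGenerator ε →ₗ[A] X, φ h.unit = x := by
  choose y h1 h2 using fun s => hX.surj s (e s • x) (by rw [← mul_smul, he.mul_self])
  refine ⟨∑ s, LinearMap.toSpanSingleton A X (y s) ∘ₗ (_root_.leftIdeal (ε s)).subtype ∘ₗ
    LinearMap.proj s, ?_⟩
  rw [LinearMap.sum_apply]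
  rw [← one_smul A x, ← he.coi.complete, Finset.sum_smul]
  exact Finset.sum_congr rfl fun s _ => h2 s

/-- Multiplying `unit` by `e s` isolates its `s`-th component, and injectivity of `a s` then
determines the map on that summand. With `exists_linearMap`, this makes the generator the reflection
of `A` in the core modules. -/
theorem linearMap_ext (he : IsSerialSystem e) (h : IsCoreFamily e ε a) {X : Type*}
    [AddCommGroup X] [Module A X] (hX : IsCoreModule e ε a X) {φ ψ : CoreGenerator ε →ₗ[A] X}
    (hφ : φ h.unit = ψ h.unit) : φ = ψ := by
  classical
  rw [← sub_eq_zero]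
  have h0 : (φ - ψ) h.unit = 0 := by rw [LinearMap.sub_apply, hφ, sub_self]
  generalize φ - ψ = χ at h0
  have hε : ∀ s, χ (Pi.single s ⟨ε s, (h s).idem he⟩) = 0 := by
    intro s
    apply hX.inj s
    · rw [← map_smul, ← Pi.single_smul]
      congr 2
      exact Subtype.ext ((h s).idem he)
    · rw [← map_smul, ← Pi.single_smul, ← h.smul_unit he, map_smul, h0, smul_zero]
  refine LinearMap.pi_ext fun s x => ?_
  have : x = x.1 • (⟨ε s, (h s).idem he⟩ : _root_.leftIdeal (ε s)) := Subtype.ext x.2.symm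
  rw [this, Pi.single_smul, map_smul, hε, smul_zero, LinearMap.zero_apply]

theorem exists_surjective (he : IsSerialSystem e) (h : IsCoreFamily e ε a) {X : Type*}
    [AddCommGroup X] [Module A X] [Module.Finite A X] (hX : IsCoreModule e ε a X) :
    ∃ (n : ℕ) (φ : (Fin n → CoreGenerator ε) →ₗ[A] X), Function.Surjective φ := by
  classical
  obtain ⟨n, s, hs⟩ := Module.Finite.exists_fin (R := A) (M := X)
  choose φ hφ using fun i => h.exists_linearMap he hX (s i)
  refine ⟨n, ∑ i, φ i ∘ₗ LinearMap.proj i, ?_⟩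
  rw [← LinearMap.range_eq_top, eq_top_iff, ← hs, Submodule.span_le]
  rintro _ ⟨i, rfl⟩
  refine ⟨Pi.single i h.unit, ?_⟩
  rw [LinearMap.sum_apply, Finset.sum_eq_single i]
  · simp [hφ]
  · intro j _ hj
    simp [Pi.single_eq_of_ne hj]
  · simp

end IsCoreFamily

end CoreFamilies

/-! ### The Gorenstein core consists of the core modules. -/

section GorensteinCore

/-- The map `(x, y) ↦ (y, 0)` on `M × M`, repeated in every degree, is a complete resolution whose
images are copies of `M`. -/
theorem gorensteinProj_of_projective {A : Type u} [Ring A] {M : FGModuleCat.{u} A}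
    (hM : Module.Projective A M) : gorensteinProj A M := by
  let d : (M × M) →ₗ[A] (M × M) := (LinearMap.snd A M M).prod 0
  have hd : ∀ z, d z = (z.2, 0) := fun z => rfl
  let K : CompleteProjectiveResolution A :=
    { P := fun _ => FGModuleCat.of A (M × M)
      projective := fun _ => inferInstanceAs (Module.Projective A (M × M))
      d := fun _ => d
      exact := by
        rintro - ⟨x, y⟩
        constructor
        · intro h
          have : y = 0 := congrArg Prod.fst h
          subst this
          exact ⟨(0, x), rfl⟩
        · rintro ⟨z, hz⟩
          rw [← hz]
          rfl
      hom_exact := by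
        rintro - g
        constructor
        · intro h
          refine ⟨g ∘ₗ LinearMap.inr A M M ∘ₗ LinearMap.fst A M M, LinearMap.ext fun z => ?_⟩
          have h1 : g (z.1, 0) = 0 := LinearMap.congr_fun h (0, z.1)
          have h2 : z = (z.1, 0) + (0, z.2) := by simp
          change g (0, z.2) = g z
          conv_rhs => rw [h2, map_add, h1, zero_add]
        · rintro ⟨φ, rfl⟩
          apply LinearMap.ext
          intro z
          exact map_zero φ }
  refine ⟨K, nonempty_linearEquiv_of_range_eq (LinearMap.inl A M M)
    (LinearMap.range (K.d 0)).subtype LinearMap.inl_injective (Submodule.subtype_injective _) ?_⟩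
  rw [Submodule.range_subtype]
  ext z
  constructor
  · rintro ⟨m, rfl⟩
    exact ⟨((0 : M), m), rfl⟩
  · rintro ⟨y, rfl⟩
    exact ⟨y.2, rfl⟩

theorem gorensteinProj_of_equiv_pi {A : Type u} [Ring A] {M : FGModuleCat.{u} A} {n : ℕ}
    {X : Fin n → FGModuleCat.{u} A} (hX : ∀ i, gorensteinProj A (X i))
    (E : M ≃ₗ[A] (∀ i, X i)) : gorensteinProj A M := by
  choose K hK using hX
  have EK := fun i => (hK i).some
  let d : ∀ m, (∀ i, (K i).P (m + 1)) →ₗ[A] (∀ i, (K i).P m) :=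
    fun m => LinearMap.pi fun i => (K i).d m ∘ₗ LinearMap.proj i
  have hd : ∀ m y i, d m y i = (K i).d m (y i) := fun m y i => rfl
  have hdd : ∀ m y, d m (d (m + 1) y) = 0 := fun m y =>
    funext fun i => ((K i).exact m).apply_apply_eq_zero (y i)
  let L : CompleteProjectiveResolution A :=
    { P := fun m => FGModuleCat.of A (∀ i, (K i).P m)
      projective := fun m => by
        have := fun i => (K i).projective m
        exact projective_pi
      d := d
      exact := by
        intro m y
        constructor
        · intro h
          choose z hz using fun i => ((K i).exact m (y i)).mp (congrFun h i)
          exact ⟨z, funext hz⟩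
        · rintro ⟨z, rfl⟩
          exact hdd m z
      hom_exact := by
        intro m g
        constructor
        · intro h
          have h' : ∀ i, (g ∘ₗ LinearMap.single A (fun i => (K i).P (m + 1)) i) ∘ₗ
              (K i).d (m + 1) = 0 := by
            intro i
            apply LinearMap.ext
            intro y
            have := LinearMap.congr_fun h (Pi.single i y)
            have h2 : d (m + 1) (Pi.single i y) = Pi.single i ((K i).d (m + 1) y) := by
              funext i'
              rw [hd]
              exact Pi.apply_single (fun i => (K i).d (m + 1)) (fun i => map_zero _) i y i'
            change g (Pi.single i ((K i).d (m + 1) y)) = 0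
            rw [← h2]
            exact this
          choose ψ hψ using fun i => ((K i).hom_exact m _).mp (h' i)
          refine ⟨∑ i, ψ i ∘ₗ LinearMap.proj i, ?_⟩
          refine LinearMap.ext fun y => ?_
          change (∑ i, ψ i ∘ₗ LinearMap.proj i : _ →ₗ[A] A) (d m y) = g y
          rw [LinearMap.sum_apply]
          have : ∀ i, (ψ i ∘ₗ LinearMap.proj i : _ →ₗ[A] A) (d m y) = g (Pi.single i (y i)) :=
            fun i => LinearMap.congr_fun (hψ i) (y i)
          rw [Finset.sum_congr rfl fun i _ => this i, ← map_sum, Finset.univ_sum_single]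
        · rintro ⟨φ, rfl⟩
          refine LinearMap.ext fun z => ?_
          change φ (d m (d (m + 1) z)) = 0
          rw [hdd, map_zero] }
  let θ : M →ₗ[A] (∀ i, (K i).P 0) := LinearMap.pi (fun i =>
    (LinearMap.range ((K i).d 0)).subtype ∘ₗ (EK i).toLinearMap ∘ₗ LinearMap.proj i) ∘ₗ
    E.toLinearMap
  have hθ : ∀ m i, θ m i = (EK i (E m i)).1 := fun m i => rfl
  refine ⟨L, nonempty_linearEquiv_of_range_eq θ (LinearMap.range (L.d 0)).subtype ?_
    (Submodule.subtype_injective _) ?_⟩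
  · intro x y hxy
    apply E.injective
    funext i
    exact (EK i).injective (Subtype.ext (congrFun hxy i))
  · rw [Submodule.range_subtype]
    ext z
    constructor
    · rintro ⟨m, rfl⟩
      choose y hy using fun i => (EK i (E m i)).2
      exact ⟨y, funext hy⟩
    · rintro ⟨y, rfl⟩
      refine ⟨E.symm fun i => (EK i).symm ⟨(K i).d 0 (y i), y i, rfl⟩, funext fun i => ?_⟩
      rw [hθ]
      simp only [LinearEquiv.apply_symm_apply]
      rfl

variable {A : Type u} [Ring A] {ι : Type} [Fintype ι] {e ε a : ι → A}

theorem IsCoreFamily.isCoreModule_of_isPresentedBy (he : IsSerialSystem e)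
    (h : IsCoreFamily e ε a) {i j : ι} {f : A} (hi : i ∈ gorensteinIndex e)
    (hj : j ∈ gorensteinIndex e) (hf : IsArrow e i j f) {M : Type*} [AddCommGroup M] [Module A M]
    (hM : IsPresentedBy e j f M) : IsCoreModule e ε a M := by
  obtain ⟨x, hx, hgen, hann⟩ := hM
  have hid := he.mul_self
  refine IsCoreModule.coker (Y := _root_.leftIdeal (e j))
    (f := LinearMap.restrict (LinearMap.toSpanSingleton A A f) (p := _root_.leftIdeal (e i))
      (q := _root_.leftIdeal (e j)) (fun y _ => by simp [mem_leftIdeal, mul_assoc, hf.right]))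
    (c := LinearMap.toSpanSingleton A M x ∘ₗ (_root_.leftIdeal (e j)).subtype)
    hid (fun s => (h s).idem he) (fun s => (h s).left)
    (h.leftIdeal he hi) (h.leftIdeal he hj) ?_ ?_
  · rintro ⟨r, hr⟩
    change r • x = 0 ↔ _
    rw [hann, show r * e j = r from hr]
    constructor
    · rintro ⟨w, hw⟩
      refine ⟨⟨w * e i, by rw [mem_leftIdeal, mul_assoc, hid]⟩, Subtype.ext ?_⟩
      change w * e i * f = r
      rw [mul_assoc, hf.left, hw]
    · rintro ⟨y, hy⟩
      exact ⟨y.1, (congrArg Subtype.val hy).symm⟩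
  · intro m
    obtain ⟨r, rfl⟩ := hgen m
    exact ⟨⟨r * e j, by rw [mem_leftIdeal, mul_assoc, hid]⟩, by simp [mul_smul, hx]⟩

/-- A lift `T → P` of `g` is surjective because the kernel of the cover is superfluous; so `P` is a
retract of `T`. -/
theorem IsCoreModule.of_isProjectiveCover {ι : Type} {e ε a : ι → A} {P M : Type w} {T : Type*}
    [AddCommGroup P] [Module A P] [AddCommGroup M] [Module A M]
    [AddCommGroup T] [Module A T] [Module.Projective A T] (hT : IsCoreModule e ε a T)
    (g : T →ₗ[A] M) (hg : Function.Surjective g) {f : P →ₗ[A] M} (hf : IsProjectiveCover f) :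
    IsCoreModule e ε a P := by
  obtain ⟨φ, hφ⟩ := Module.projective_lifting_property f g hf.surjective
  have := hf.projective
  refine hT.of_surjective φ (LinearMap.range_eq_top.mp (hf.superfluous _ ?_))
  rw [eq_top_iff]
  intro p _
  obtain ⟨t, ht⟩ := hg (f p)
  have : f (φ t) = f p := by rw [← ht]; exact LinearMap.congr_fun hφ t
  rw [← add_sub_cancel (φ t) p]
  exact Submodule.add_mem_sup ⟨t, rfl⟩ (by rw [LinearMap.mem_ker, map_sub, this, sub_self])

variable [IsArtinianRing A]

/-- Here mere summands of Gorenstein projective modules become Gorenstein projective: the presenting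
arrow has both ends in `gorensteinIndex`, so it extends to a complete resolution. -/
theorem IsSerialSystem.indecNonprojGorensteinProj (he : IsSerialSystem e) {M : FGModuleCat.{u} A}
    (hM : IsIndecomposableModule A M) (hP : ¬ Module.Projective A M)
    (hG : IsGorensteinSummand A M) : indecNonprojGorensteinProj A M := by
  obtain ⟨i, j, f, hf, hp⟩ := he.exists_isPresentedBy hM hP hG
  exact ⟨hM, hP, he.gorensteinProj_of_isPresentedBy (he.mem_gorensteinIndex_source hf) ⟨i, f, hf⟩
    hf.1 hp⟩

theorem IsCoreFamily.isCoreModule_of_indecNonproj (he : IsSerialSystem e)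
    (h : IsCoreFamily e ε a) {M : FGModuleCat.{u} A} (hM : indecNonprojGorensteinProj A M) :
    IsCoreModule e ε a M := by
  obtain ⟨i, j, f, hf, hp⟩ := he.exists_isPresentedBy hM.1 hM.2.1
    (gorensteinProj_isGorensteinSummand hM.2.2)
  exact h.isCoreModule_of_isPresentedBy he (he.mem_gorensteinIndex_source hf) ⟨i, f, hf⟩ hf.1 hp

theorem IsCoreFamily.isCoreModule_of_gorensteinCoreIndec (he : IsSerialSystem e)
    (h : IsCoreFamily e ε a) {M : FGModuleCat.{u} A} (hM : gorensteinCoreIndec A M) :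
    IsCoreModule e ε a M := by
  rcases hM with hM | ⟨N, f, hN, hf⟩
  · exact h.isCoreModule_of_indecNonproj he hM
  · have hNc := h.isCoreModule_of_indecNonproj he hN
    obtain ⟨n, φ, hφ⟩ := h.exists_surjective he hNc
    have := h.generator_projective he
    have : Module.Projective A (Fin n → CoreGenerator ε) := projective_pi
    exact (IsCoreModule.pi fun _ => h.generator he).of_isProjectiveCover φ hφ hf

theorem IsCoreFamily.isCoreModule_of_gorensteinCore (he : IsSerialSystem e)
    (h : IsCoreFamily e ε a) {M : FGModuleCat.{u} A} (hM : gorensteinCore A M) :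
    IsCoreModule e ε a M := by
  obtain ⟨n, X, hX, ⟨E⟩⟩ := hM
  exact (IsCoreModule.pi fun i => h.isCoreModule_of_gorensteinCoreIndec he (hX i)).of_equiv E

/-- Proper submodules of a uniserial module are superfluous, so the map to the cokernel of a
Gorenstein arrow is a projective cover. -/
theorem IsSerialSystem.gorensteinCoreIndec_leftIdeal (he : IsSerialSystem e) {t : ι}
    (ht : t ∈ gorensteinIndex e) {X : FGModuleCat.{u} A} (E : X ≃ₗ[A] leftIdeal (e t)) :
    gorensteinCoreIndec A X := by
  right
  have hid := he.mul_self
  have := leftIdeal_projective (hid t)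
  obtain ⟨i, f, hf⟩ := ht
  obtain ⟨M, hp, hG⟩ := hf.2
  have hi := he.indecomposable_of_isPresentedBy hf.1 hp
  obtain ⟨x, hx, hgen, -⟩ := hp
  have hsurj : Function.Surjective
      (LinearMap.toSpanSingleton A M x ∘ₗ (leftIdeal (e t)).subtype ∘ₗ E.toLinearMap) := by
    intro m
    obtain ⟨r, rfl⟩ := hgen m
    exact ⟨E.symm ⟨r * e t, by rw [mem_leftIdeal, mul_assoc, hid]⟩, by simp [mul_smul, hx]⟩
  refine ⟨M, _, he.indecNonprojGorensteinProj hi.1 hi.2 hG,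
    Module.Projective.of_equiv E.symm, hsurj, fun U hU => ?_⟩
  have huni : IsUniserialModule A X :=
    (isUniserial_of_comparable (he.left t)).of_injective E.toLinearMap E.injective
  rcases huni U (LinearMap.ker (LinearMap.toSpanSingleton A M x ∘ₗ (leftIdeal (e t)).subtype ∘ₗ
    E.toLinearMap)) with hle | hle
  · rw [sup_eq_right.mpr hle, LinearMap.ker_eq_top] at hU
    rw [hU] at hsurj
    obtain ⟨m, hm⟩ := @exists_ne _ hi.1.1 (0 : M)
    obtain ⟨p, hp⟩ := hsurj m
    exact absurd hp.symm hm
  · rwa [sup_eq_left.mpr hle] at hU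

/-- The generator of `M` is of the form `a s • x`, so `M` is a quotient of some `A (e t)` with `t`
in `gorensteinIndex`. The kernel `V` is again a core module, so its generator can likewise be moved
to a vertex of `gorensteinIndex`. Either `V` is zero, or `M` is the cokernel of an arrow between two
such vertices. -/
theorem IsCoreFamily.gorensteinCoreIndec_of_isCoreModule (he : IsSerialSystem e)
    (h : IsCoreFamily e ε a) {M : FGModuleCat.{u} A} (hi : IsIndecomposableModule A M)
    (hM : IsCoreModule e ε a M) : gorensteinCoreIndec A M := by
  obtain ⟨s, x₀, hx₀, hgen₀⟩ := he.exists_generator hi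
  have hid := he.mul_self
  have := hi.1
  obtain ⟨x, hεx, rfl⟩ := hM.surj s x₀ hx₀
  have hgen : ∀ m : M, ∃ r : A, r • x = m := fun m => by
    obtain ⟨r, hr⟩ := hgen₀ m
    exact ⟨r * a s, by rw [mul_smul, hr]⟩
  have hx0 : x ≠ 0 := by
    rintro rfl
    obtain ⟨m, hm⟩ := exists_ne (0 : M)
    obtain ⟨r, rfl⟩ := hgen m
    exact hm (smul_zero r)
  obtain ⟨t, ht, hx⟩ : ∃ t ∈ gorensteinIndex e, e t • x = x := by
    rcases (h s).target with ⟨h0, -⟩ | ⟨-, t, ht, h1⟩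
    · rw [h0, zero_smul] at hεx
      exact absurd hεx.symm hx0
    · exact ⟨t, ht, by rw [← h1, hεx]⟩
  let V : Submodule A A := _root_.leftIdeal (e t) ⊓ LinearMap.ker (LinearMap.toSpanSingleton A M x)
  have hVmem : ∀ r, r ∈ V ↔ r * e t = r ∧ r • x = 0 := fun r => Iff.rfl
  have hann : ∀ r : A, r • x = 0 ↔ r * e t ∈ V := by
    intro r
    rw [hVmem, mul_assoc, hid, mul_smul, hx]
    simp
  have hVcore : IsCoreModule e ε a V := by
    refine IsCoreModule.ker (h.leftIdeal he ht) hM (κ := Submodule.inclusion inf_le_left)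
      (f := LinearMap.toSpanSingleton A M x ∘ₗ (_root_.leftIdeal (e t)).subtype)
      (Submodule.inclusion_injective _) ?_
    rintro ⟨r, hr⟩
    constructor
    · intro h0
      exact ⟨⟨r, hr, h0⟩, rfl⟩
    · rintro ⟨⟨r', hr'⟩, hrr⟩
      obtain rfl : r' = r := congrArg Subtype.val hrr
      exact hr'.2
  obtain ⟨l, f, hl, hV, hgenV⟩ := he.exists_generator_of_le (V := V) (i := t) inf_le_left
  by_cases hf0 : f = 0
  · have hV0 : ∀ r ∈ V, r = 0 := fun r hr => by
      obtain ⟨w, hw⟩ := hgenV r hr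
      rw [hw, hf0, mul_zero]
    obtain ⟨E⟩ := nonempty_linearEquiv_of_generator hgen
      (y := (⟨e t, hid t⟩ : _root_.leftIdeal (e t))) (fun m => ⟨m.1, Subtype.ext m.2⟩) (fun r => by
        rw [hann, Subtype.ext_iff]
        constructor
        · intro hr
          exact hV0 _ hr
        · intro hr
          have hr : r * e t = 0 := hr
          rw [hr]
          exact V.zero_mem)
    exact he.gorensteinCoreIndec_leftIdeal ht E
  · obtain ⟨⟨y, hyV⟩, hεy, hy⟩ := hVcore.surj l ⟨f, hV⟩ (Subtype.ext hl)
    have hεy : ε l * y = y := congrArg Subtype.val hεy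
    have hy : a l * y = f := congrArg Subtype.val hy
    have hy0 : y ≠ 0 := by
      rintro rfl
      exact hf0 (by rw [← hy, mul_zero])
    obtain ⟨q, hq, hqy⟩ : ∃ q ∈ gorensteinIndex e, e q * y = y := by
      rcases (h l).target with ⟨h0, -⟩ | ⟨-, q, hq, h1⟩
      · rw [h0, zero_mul] at hεy
        exact absurd hεy.symm hy0
      · exact ⟨q, hq, by rw [← h1, hεy]⟩
    have harr : IsArrow e q t y := by
      refine ⟨hqy, ((hVmem y).mp hyV).1, hy0, fun w hw => hx0 ?_⟩
      rw [← hx, ← hw, mul_smul, ((hVmem y).mp hyV).2, smul_zero]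
    have hp : IsPresentedBy e t y M := by
      refine ⟨x, hx, hgen, fun r => ?_⟩
      rw [hann]
      constructor
      · intro hr
        obtain ⟨w, hw⟩ := hgenV _ hr
        exact ⟨w * a l, by rw [mul_assoc, hy, hw]⟩
      · rintro ⟨w, hw⟩
        rw [hw]
        exact V.smul_mem w hyV
    have := he.indecomposable_of_isPresentedBy harr hp
    exact Or.inl ⟨this.1, this.2, he.gorensteinProj_of_isPresentedBy hq ht harr hp⟩

/-- The Gorenstein core consists of the core modules. -/
theorem IsCoreFamily.gorensteinCore_iff (he : IsSerialSystem e)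
    (h : IsCoreFamily e ε a) {M : FGModuleCat.{u} A} :
    gorensteinCore A M ↔ IsCoreModule e ε a M := by
  classical
  refine ⟨h.isCoreModule_of_gorensteinCore he, fun hM => ?_⟩
  obtain ⟨n, X, hX, ⟨E⟩⟩ := exists_equiv_pi_indecomposable (R := A) M
  refine ⟨n, X, fun i => h.gorensteinCoreIndec_of_isCoreModule he (hX i) ?_, ⟨E⟩⟩
  exact hM.of_retract (E.symm.toLinearMap ∘ₗ LinearMap.single A (fun i => (X i : Type u)) i)
    (LinearMap.proj i ∘ₗ E.toLinearMap) (by simp)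

theorem gorensteinCore_le_gorensteinProj {A : Type u} [Ring A] :
    gorensteinCore A ≤ gorensteinProj A := by
  rintro M ⟨n, X, hX, ⟨E⟩⟩
  refine gorensteinProj_of_equiv_pi (fun i => ?_) E
  rcases hX i with h | ⟨N, f, -, hf⟩
  · exact h.2.2
  · exact gorensteinProj_of_projective hf.projective

theorem IsCoreFamily.isClosedUnderProjectiveCovers (he : IsSerialSystem e)
    (h : IsCoreFamily e ε a) : IsClosedUnderProjectiveCovers (gorensteinCore A) := by
  intro M P f hM hf
  rw [h.gorensteinCore_iff he] at hM ⊢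
  obtain ⟨n, φ, hφ⟩ := h.exists_surjective he hM
  have := h.generator_projective he
  have : Module.Projective A (Fin n → CoreGenerator ε) := projective_pi
  exact (IsCoreModule.pi fun _ => h.generator he).of_isProjectiveCover φ hφ hf

/-- For the cokernel of an arrow `f`, the approximation is induced by the next arrow `g`; exactness
of the dual pair is the factorisation property. -/
theorem IsCoreFamily.exists_approximation_indec (he : IsSerialSystem e)
    (h : IsCoreFamily e ε a) {M : FGModuleCat.{u} A} (hM : gorensteinCoreIndec A M) :
    ∃ (P : FGModuleCat.{u} A) (j : M →ₗ[A] P), Module.Projective A P ∧ IsCoreModule e ε a P ∧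
      IsLeftApproximation j := by
  have hid := he.mul_self
  have hM' := h.isCoreModule_of_gorensteinCoreIndec he hM
  rcases hM with hM | ⟨N, f, hN, hf⟩
  · obtain ⟨i, j, f, hf, x, hx, hgen, hann⟩ := he.exists_isPresentedBy hM.1 hM.2.1
      (gorensteinProj_isGorensteinSummand hM.2.2)
    obtain ⟨q, hq, g, hg, hfg⟩ := he.exists_arrow_right (he.mem_gorensteinIndex_source hf) hf.1
    obtain ⟨φ, hφ⟩ := exists_linearMap_of_generator hgen
      (y := (⟨g, hg.right⟩ : _root_.leftIdeal (e q))) (fun r hr => by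
        obtain ⟨w, hw⟩ := (hann r).mp hr
        refine Subtype.ext ?_
        change r * g = 0
        rw [← hg.left, ← mul_assoc, hw, mul_assoc, hfg.mul_eq_zero, mul_zero])
    have := leftIdeal_finite (hid q)
    refine ⟨FGModuleCat.of A (_root_.leftIdeal (e q)), φ, leftIdeal_projective (hid q),
      h.leftIdeal he hq, fun χ => ?_⟩
    obtain ⟨w, hw⟩ := hfg.right (χ x) (by rw [← smul_eq_mul, ← map_smul, hx]) (by
      rw [← smul_eq_mul, ← map_smul, (hann f).mpr ⟨1, by rw [hf.1.right, one_mul]⟩, map_zero])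
    refine ⟨LinearMap.toSpanSingleton A A w ∘ₗ (_root_.leftIdeal (e q)).subtype,
      LinearMap.ext fun m => ?_⟩
    obtain ⟨r, rfl⟩ := hgen m
    rw [map_smul, map_smul]
    congr 1
    rw [LinearMap.comp_apply, hφ, hw]
    rfl
  · exact ⟨M, LinearMap.id, hf.projective, hM', fun χ => ⟨χ, rfl⟩⟩

theorem IsCoreFamily.exists_approximation (he : IsSerialSystem e)
    (h : IsCoreFamily e ε a) {M : FGModuleCat.{u} A} (hM : gorensteinCore A M) :
    ∃ (P : FGModuleCat.{u} A) (j : M →ₗ[A] P), Module.Projective A P ∧ IsCoreModule e ε a P ∧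
      IsLeftApproximation j := by
  classical
  obtain ⟨n, X, hX, ⟨E⟩⟩ := hM
  choose P j hP hPc hj using fun i => h.exists_approximation_indec he (hX i)
  refine ⟨FGModuleCat.of A (∀ i, P i),
    (LinearMap.pi fun i => j i ∘ₗ LinearMap.proj i) ∘ₗ E.toLinearMap, projective_pi,
    IsCoreModule.pi hPc, fun χ => ?_⟩
  choose ψ hψ using fun i => hj i (χ ∘ₗ E.symm.toLinearMap ∘ₗ
    LinearMap.single A (fun i => (X i : Type u)) i)
  refine ⟨∑ i, ψ i ∘ₗ LinearMap.proj i, LinearMap.ext fun m => ?_⟩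
  rw [LinearMap.comp_apply, LinearMap.sum_apply]
  have : ∀ i, (ψ i ∘ₗ LinearMap.proj i : (∀ i, P i) →ₗ[A] A)
      (((LinearMap.pi fun i => j i ∘ₗ LinearMap.proj i) ∘ₗ E.toLinearMap) m) =
        χ (E.symm (Pi.single i (E m i))) := fun i => LinearMap.congr_fun (hψ i) (E m i)
  rw [Finset.sum_congr rfl fun i _ => this i, ← map_sum, ← map_sum, Finset.univ_sum_single,
    LinearEquiv.symm_apply_apply]

theorem IsCoreFamily.isClosedUnderMinimalLeftApproximations (he : IsSerialSystem e)
    (h : IsCoreFamily e ε a) : IsClosedUnderMinimalLeftApproximations (gorensteinCore A) := by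
  intro M P f hM hf
  obtain ⟨Q, j, hQ, hQc, hj⟩ := h.exists_approximation he hM
  have := hf.projective
  obtain ⟨α, hα⟩ := hf.factors Q j
  obtain ⟨β, hβ⟩ := hj.exists_comp_eq f
  -- Minimality makes `P` a direct summand of the approximation `Q` inside the core.
  have hb := hf.minimal (β ∘ₗ α) (by rw [LinearMap.comp_assoc, hα, hβ])
  rw [h.gorensteinCore_iff he]
  refine hQc.of_surjective β ?_
  have := hb.2
  rw [LinearMap.coe_comp] at this
  exact this.of_comp

end GorensteinCore

/-! ### Modules over the endomorphism ring of the generator. -/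

section CoreRing

variable {A : Type u} [Ring A] {ι : Type} [Fintype ι] {e ε a : ι → A}

/-- The opposite endomorphism ring of the generator of the Gorenstein core. -/
abbrev CoreRing (ε : ι → A) : Type u := (Module.End A (CoreGenerator ε))ᵐᵒᵖ

namespace IsCoreFamily

/-- The endomorphism of the generator that is given by an element of the generator. -/
noncomputable def endo (he : IsSerialSystem e) (h : IsCoreFamily e ε a) (v : CoreGenerator ε) :
    Module.End A (CoreGenerator ε) :=
  (h.exists_linearMap he (h.generator he) v).choose

theorem endo_unit (he : IsSerialSystem e) (h : IsCoreFamily e ε a) (v : CoreGenerator ε) :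
    h.endo he v h.unit = v :=
  (h.exists_linearMap he (h.generator he) v).choose_spec

theorem endo_eq (he : IsSerialSystem e) (h : IsCoreFamily e ε a) {v : CoreGenerator ε}
    {f : Module.End A (CoreGenerator ε)} (hf : f h.unit = v) : f = h.endo he v :=
  h.linearMap_ext he (h.generator he) (hf.trans (h.endo_unit he v).symm)

/-- The ring homomorphism from `A` to the opposite endomorphism ring of the generator. -/
noncomputable def ringHom (he : IsSerialSystem e) (h : IsCoreFamily e ε a) : A →+* CoreRing ε where
  toFun r := MulOpposite.op (h.endo he (r • h.unit))
  map_one' := by rw [one_smul]; exact congrArg _ (h.endo_eq he (f := 1) rfl).symm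
  map_mul' r s := by
    rw [← MulOpposite.op_mul]
    refine congrArg _ (h.endo_eq he ?_).symm
    rw [Module.End.mul_apply, endo_unit, map_smul, endo_unit, mul_smul]
  map_zero' := by rw [zero_smul]; exact congrArg _ (h.endo_eq he (f := 0) rfl).symm
  map_add' r s := by
    rw [← MulOpposite.op_add]
    refine congrArg _ (h.endo_eq he ?_).symm
    rw [LinearMap.add_apply, endo_unit, endo_unit, add_smul]

theorem ringHom_apply (he : IsSerialSystem e) (h : IsCoreFamily e ε a) (r : A) :
    h.ringHom he r = MulOpposite.op (h.endo he (r • h.unit)) := rfl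

theorem op_endo_smul (he : IsSerialSystem e) (h : IsCoreFamily e ε a) (r : A)
    (v : CoreGenerator ε) :
    MulOpposite.op (h.endo he (r • v)) = h.ringHom he r * MulOpposite.op (h.endo he v) := by
  rw [ringHom_apply, ← MulOpposite.op_mul]
  refine congrArg _ (h.endo_eq he ?_).symm
  rw [Module.End.mul_apply, endo_unit, map_smul, endo_unit]

theorem op_endo_add (he : IsSerialSystem e) (h : IsCoreFamily e ε a) (v w : CoreGenerator ε) :
    MulOpposite.op (h.endo he (v + w)) =
      MulOpposite.op (h.endo he v) + MulOpposite.op (h.endo he w) := by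
  rw [← MulOpposite.op_add]
  refine congrArg _ (h.endo_eq he ?_).symm
  rw [LinearMap.add_apply, endo_unit, endo_unit]

theorem op_endo_apply_unit (he : IsSerialSystem e) (h : IsCoreFamily e ε a) (x : CoreRing ε) :
    MulOpposite.op (h.endo he (x.unop h.unit)) = x :=
  congrArg MulOpposite.op (h.endo_eq he (f := x.unop) rfl).symm

section Modules

variable {N : Type*} [AddCommGroup N] [Module A N] [Module (CoreRing ε) N]

/-- The linear map from the generator to a module over its opposite endomorphism ring which is given
by an element of the module. -/
noncomputable def ofElement (he : IsSerialSystem e) (h : IsCoreFamily e ε a)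
    (hN : ∀ (r : A) (n : N), r • n = h.ringHom he r • n) (n : N) : CoreGenerator ε →ₗ[A] N where
  toFun v := MulOpposite.op (h.endo he v) • n
  map_add' v w := by rw [op_endo_add, add_smul]
  map_smul' r v := by rw [op_endo_smul, mul_smul, ← hN, RingHom.id_apply]

theorem ofElement_apply (he : IsSerialSystem e) (h : IsCoreFamily e ε a)
    (hN : ∀ (r : A) (n : N), r • n = h.ringHom he r • n) (n : N) (v : CoreGenerator ε) :
    h.ofElement he hN n v = MulOpposite.op (h.endo he v) • n := rfl

theorem ofElement_unit (he : IsSerialSystem e) (h : IsCoreFamily e ε a)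
    (hN : ∀ (r : A) (n : N), r • n = h.ringHom he r • n) (n : N) :
    h.ofElement he hN n h.unit = n := by
  have h1 := h.endo_eq he (v := h.unit) (f := 1) rfl
  rw [ofElement_apply, ← h1]
  exact one_smul _ n

/-- Over `CoreRing` the element `a s` becomes invertible between the images of `e s` and `ε s`; its
inverse is the endomorphism sending `unit` to the generator of the `s`-th summand. -/
theorem isCoreModule (he : IsSerialSystem e) (h : IsCoreFamily e ε a)
    (hN : ∀ (r : A) (n : N), r • n = h.ringHom he r • n) : IsCoreModule e ε a N := by
  classical
  have hid := fun s => (h s).idem he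
  refine ⟨fun s y h1 h2 => ?_, fun s x hx => ?_⟩
  · let v : CoreGenerator ε := Pi.single s ⟨ε s, hid s⟩
    have hv : ε s • v = v := by
      rw [← Pi.single_smul]
      congr 1
      exact Subtype.ext (hid s)
    have hav : a s • v = e s • h.unit := by rw [h.smul_unit he, ← Pi.single_smul]
    have key : h.endo he (a s • h.unit) v = ε s • h.unit := by
      rw [← sub_eq_zero]
      apply (h.generator he).inj s
      · rw [smul_sub, ← map_smul, hv, ← mul_smul, hid]
      · rw [smul_sub, ← map_smul, hav, map_smul, endo_unit, ← mul_smul, ← mul_smul, (h s).left,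
          (h s).right, sub_self]
    have hw : MulOpposite.op (h.endo he v) * h.ringHom he (a s) = h.ringHom he (ε s) := by
      rw [ringHom_apply, ringHom_apply, ← MulOpposite.op_mul]
      refine congrArg _ (h.endo_eq he ?_)
      rw [Module.End.mul_apply, endo_unit, key]
    rw [← h1, hN, ← hw, mul_smul, ← hN, h2, smul_zero]
  · refine ⟨h.ofElement he hN x (Pi.single s ⟨ε s, hid s⟩), ?_, ?_⟩
    · rw [← map_smul, ← Pi.single_smul]
      congr 2
      exact Subtype.ext (hid s)
    · rw [← map_smul, ← Pi.single_smul, ← h.smul_unit he, map_smul, ofElement_unit, hx]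

theorem finite_of_finite (he : IsSerialSystem e) (h : IsCoreFamily e ε a)
    (hN : ∀ (r : A) (n : N), r • n = h.ringHom he r • n) [Module.Finite (CoreRing ε) N] :
    Module.Finite A N := by
  obtain ⟨n, s, hs⟩ := Module.Finite.exists_fin (R := CoreRing ε) (M := N)
  have := h.generator_finite he
  refine Module.Finite.of_surjective
    (∑ i, h.ofElement he hN (s i) ∘ₗ LinearMap.proj i : (Fin n → CoreGenerator ε) →ₗ[A] N) ?_
  intro x
  have hx : x ∈ Submodule.span (CoreRing ε) (Set.range s) := hs ▸ Submodule.mem_top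
  rw [Submodule.mem_span_range_iff_exists_fun] at hx
  obtain ⟨c, rfl⟩ := hx
  refine ⟨fun i => (c i).unop h.unit, ?_⟩
  rw [LinearMap.sum_apply]
  refine Finset.sum_congr rfl fun i _ => ?_
  rw [LinearMap.comp_apply, LinearMap.proj_apply, ofElement_apply, op_endo_apply_unit]

theorem finite_coreRing (he : IsSerialSystem e) (h : IsCoreFamily e ε a)
    (hN : ∀ (r : A) (n : N), r • n = h.ringHom he r • n) [Module.Finite A N] :
    Module.Finite (CoreRing ε) N := by
  obtain ⟨n, s, hs⟩ := Module.Finite.exists_fin (R := A) (M := N)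
  refine ⟨Submodule.fg_def.mpr ⟨Set.range s, Set.finite_range s, ?_⟩⟩
  rw [eq_top_iff]
  rintro x -
  have hx : x ∈ Submodule.span A (Set.range s) := hs ▸ Submodule.mem_top
  rw [Submodule.mem_span_range_iff_exists_fun] at hx ⊢
  obtain ⟨c, rfl⟩ := hx
  exact ⟨fun i => h.ringHom he (c i), Finset.sum_congr rfl fun i _ => (hN _ _).symm⟩

/-- Restriction of scalars is full: two maps from the generator to a core module agree once they
agree on `unit`. -/
theorem map_smul_coreRing (he : IsSerialSystem e) (h : IsCoreFamily e ε a)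
    (hN : ∀ (r : A) (n : N), r • n = h.ringHom he r • n) {N' : Type*} [AddCommGroup N']
    [Module A N'] [Module (CoreRing ε) N'] (hN' : ∀ (r : A) (n : N'), r • n = h.ringHom he r • n)
    (f : N →ₗ[A] N') (x : CoreRing ε) (n : N) : f (x • n) = x • f n := by
  have : f ∘ₗ h.ofElement he hN n = h.ofElement he hN' (f n) :=
    h.linearMap_ext he (h.isCoreModule he hN') (by
      rw [LinearMap.comp_apply, ofElement_unit, ofElement_unit])
  have := LinearMap.congr_fun this (x.unop h.unit)
  rwa [LinearMap.comp_apply, ofElement_apply, ofElement_apply, op_endo_apply_unit] at this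

/-- A splitting over `A` of a free cover is automatically linear over `CoreRing`. -/
theorem projective_coreRing (he : IsSerialSystem e) (h : IsCoreFamily e ε a)
    (hN : ∀ (r : A) (n : N), r • n = h.ringHom he r • n) [Module.Projective A N]
    [Module.Finite (CoreRing ε) N] : Module.Projective (CoreRing ε) N := by
  obtain ⟨n, s, hs⟩ := Module.Finite.exists_fin' (CoreRing ε) N
  let : Module A (Fin n → CoreRing ε) := Module.compHom _ (h.ringHom he)
  let s' : (Fin n → CoreRing ε) →ₗ[A] N :=
    ⟨⟨s, s.map_add⟩, fun r x => (s.map_smul (h.ringHom he r) x).trans (hN r (s x)).symm⟩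
  obtain ⟨g, hg⟩ := Module.projective_lifting_property s' LinearMap.id hs
  refine Module.Projective.of_split (⟨⟨g, g.map_add⟩,
    h.map_smul_coreRing he hN (fun _ _ => rfl) g⟩ : N →ₗ[CoreRing ε] (Fin n → CoreRing ε)) s ?_
  exact LinearMap.ext fun x => LinearMap.congr_fun hg x

/-- The generator as a module over its opposite endomorphism ring. -/
noncomputable def evalEquiv (he : IsSerialSystem e) (h : IsCoreFamily e ε a) [Module A (CoreRing ε)]
    (hN : ∀ (r : A) (n : CoreRing ε), r • n = h.ringHom he r • n) :
    CoreRing ε ≃ₗ[A] CoreGenerator ε where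
  toFun x := x.unop h.unit
  map_add' _ _ := rfl
  map_smul' r x := by
    rw [hN, ringHom_apply, smul_eq_mul, MulOpposite.unop_mul, Module.End.mul_apply,
      MulOpposite.unop_op, endo_unit, map_smul]
    rfl
  invFun v := MulOpposite.op (h.endo he v)
  left_inv x := h.op_endo_apply_unit he x
  right_inv v := h.endo_unit he v

theorem projective_restrict (he : IsSerialSystem e) (h : IsCoreFamily e ε a)
    (hN : ∀ (r : A) (n : N), r • n = h.ringHom he r • n) [Module.Projective (CoreRing ε) N]
    [Module.Finite (CoreRing ε) N] : Module.Projective A N := by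
  obtain ⟨n, s, g, -, -, hs⟩ := Module.Finite.exists_comp_eq_id_of_projective (CoreRing ε) N
  let : Module A (CoreRing ε) := Module.compHom _ (h.ringHom he)
  have := h.generator_projective he
  have : Module.Projective A (CoreRing ε) :=
    Module.Projective.of_equiv (h.evalEquiv he fun _ _ => rfl).symm
  have : Module.Projective A (Fin n → CoreRing ε) := projective_pi
  refine Module.Projective.of_split
    (⟨⟨g, g.map_add⟩, fun r x =>
      (congrArg g (hN r x)).trans (g.map_smul (h.ringHom he r) x)⟩ : N →ₗ[A] (Fin n → CoreRing ε))
    (⟨⟨s, s.map_add⟩, fun r x => (s.map_smul (h.ringHom he r) x).trans (hN r (s x)).symm⟩ :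
      (Fin n → CoreRing ε) →ₗ[A] N) ?_
  exact LinearMap.ext fun x => LinearMap.congr_fun hs x

end Modules

/-- A core module is a module over the opposite endomorphism ring of the generator. -/
@[reducible]
noncomputable def coreRingModule (he : IsSerialSystem e) (h : IsCoreFamily e ε a) {X : Type*}
    [AddCommGroup X] [Module A X] (hX : IsCoreModule e ε a X) : Module (CoreRing ε) X :=
  have hc := fun m => (h.exists_linearMap he hX m).choose_spec
  have hext : ∀ (m : X) (φ : CoreGenerator ε →ₗ[A] X), φ h.unit = m →
      (h.exists_linearMap he hX m).choose = φ :=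
    fun m φ hφ => h.linearMap_ext he hX ((hc m).trans hφ.symm)
  { smul := fun x m => (h.exists_linearMap he hX m).choose (x.unop h.unit)
    one_smul := fun m => hc m
    mul_smul := fun x y m => by
      change (h.exists_linearMap he hX m).choose (y.unop (x.unop h.unit)) =
        (h.exists_linearMap he hX ((h.exists_linearMap he hX m).choose (y.unop h.unit))).choose
          (x.unop h.unit)
      rw [hext _ ((h.exists_linearMap he hX m).choose ∘ₗ y.unop) rfl]
      rfl
    smul_zero := fun x => by
      change (h.exists_linearMap he hX 0).choose (x.unop h.unit) = 0
      rw [hext 0 0 rfl]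
      rfl
    smul_add := fun x m m' => by
      change (h.exists_linearMap he hX (m + m')).choose (x.unop h.unit) =
        (h.exists_linearMap he hX m).choose (x.unop h.unit) +
        (h.exists_linearMap he hX m').choose (x.unop h.unit)
      rw [hext (m + m') ((h.exists_linearMap he hX m).choose +
        (h.exists_linearMap he hX m').choose) (by rw [LinearMap.add_apply, hc, hc])]
      rfl
    add_smul := fun x y m => map_add _ _ _
    zero_smul := fun m => map_zero _ }

theorem smul_eq_coreRingModule_smul (he : IsSerialSystem e) (h : IsCoreFamily e ε a) {X : Type*}
    [AddCommGroup X] [Module A X] (hX : IsCoreModule e ε a X) (r : A) (x : X) :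
    letI := h.coreRingModule he hX
    r • x = h.ringHom he r • x := by
  change r • x = (h.exists_linearMap he hX x).choose (h.endo he (r • h.unit) h.unit)
  rw [endo_unit, map_smul, (h.exists_linearMap he hX x).choose_spec]

end IsCoreFamily

end CoreRing

/-! ### The endomorphism ring is Nakayama and self-injective. -/

section CoreRingNakayama

namespace IsCoreFamily

section Idempotents

variable {A : Type u} [Ring A] {ι : Type} {ε : ι → A}

/-- The idempotent endomorphisms of the generator that are given by its direct summands. -/
noncomputable def projEndo [DecidableEq ι] (ε : ι → A) (s : ι) : Module.End A (CoreGenerator ε) :=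
  LinearMap.single A (fun s => _root_.leftIdeal (ε s)) s ∘ₗ LinearMap.proj s

theorem projEndo_apply [DecidableEq ι] (s : ι) (v : CoreGenerator ε) :
    projEndo ε s v = Pi.single s (v s) := rfl

theorem projEndo_mul_self [DecidableEq ι] (s : ι) : projEndo ε s * projEndo ε s = projEndo ε s :=
  LinearMap.ext fun v => by
    rw [Module.End.mul_apply, projEndo_apply, projEndo_apply, Pi.single_eq_same]

theorem sum_projEndo [Fintype ι] [DecidableEq ι] : ∑ s, projEndo ε s = 1 :=
  LinearMap.ext fun v => by
    rw [LinearMap.sum_apply, Module.End.one_apply]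
    exact Finset.univ_sum_single v

end Idempotents

variable {A : Type u} [Ring A] {ι : Type} [Fintype ι] {e ε a : ι → A}

/-- An endomorphism with values in the `s`-th summand is determined by the image of `unit`, an
element of the uniserial (or zero) module `A (ε s)`. -/
theorem comparable_of_projEndo_mul [DecidableEq ι] (he : IsSerialSystem e)
    (h : IsCoreFamily e ε a) (s : ι) {α β : Module.End A (CoreGenerator ε)}
    (hα : projEndo ε s * α = α) (hβ : projEndo ε s * β = β) :
    (∃ w, α = β * w) ∨ ∃ w, β = α * w := by
  have key : ∀ α β : Module.End A (CoreGenerator ε), projEndo ε s * α = α →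
      projEndo ε s * β = β → ∀ r : A, (α h.unit s).1 = r * (β h.unit s).1 → ∃ w, α = β * w := by
    intro α β hα hβ r hr
    refine ⟨h.endo he (r • h.unit), h.linearMap_ext he (h.generator he) ?_⟩
    have h1 : ∀ α, projEndo ε s * α = α → α h.unit = Pi.single s (α h.unit s) :=
      fun α hα => (LinearMap.congr_fun hα h.unit).symm
    rw [Module.End.mul_apply, endo_unit, map_smul, h1 α hα, h1 β hβ, ← Pi.single_smul]
    exact congrArg _ (Subtype.ext hr)
  have hx : (α h.unit s).1 * ε s = (α h.unit s).1 := (α h.unit s).2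
  have hy : (β h.unit s).1 * ε s = (β h.unit s).1 := (β h.unit s).2
  rcases (h s).target with ⟨h0, -⟩ | ⟨-, t, -, ht⟩
  · exact Or.inl (key α β hα hβ 0 (hx.symm.trans (by
      rw [show _ * ε s = _ * 0 from congrArg _ h0, mul_zero, zero_mul])))
  · rcases he.left t _ _ ((congrArg _ ht.symm).trans hx) ((congrArg _ ht.symm).trans hy) with ⟨r, hr⟩ | ⟨r, hr⟩
    · exact Or.inl (key α β hα hβ r hr)
    · exact Or.inr (key β α hβ hα r hr)

/-- An endomorphism supported on the `s`-th summand is determined by the image of the generator `x`,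
whose coordinates lie in `e t A` when `ε s = e t`. -/
theorem comparable_of_mul_projEndo [DecidableEq ι] (he : IsSerialSystem e)
    (h : IsCoreFamily e ε a) (s : ι) {α β : Module.End A (CoreGenerator ε)}
    (hα : α * projEndo ε s = α) (hβ : β * projEndo ε s = β) :
    (∃ w, α = w * β) ∨ ∃ w, β = w * α := by
  let x : CoreGenerator ε := Pi.single s ⟨ε s, (h s).idem he⟩
  have hx : ε s • x = x := by
    rw [← Pi.single_smul]
    congr 1
    exact Subtype.ext ((h s).idem he)
  have hext : ∀ α β : Module.End A (CoreGenerator ε), α * projEndo ε s = α →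
      β * projEndo ε s = β → α x = β x → α = β := by
    intro α β hα hβ hαβ
    rw [← hα, ← hβ]
    refine LinearMap.ext fun v => ?_
    have hv : projEndo ε s v = (v s).1 • x := by
      rw [projEndo_apply, ← Pi.single_smul]
      congr 1
      exact Subtype.ext (v s).2.symm
    rw [Module.End.mul_apply, Module.End.mul_apply, hv, map_smul, map_smul, hαβ]
  have key : ∀ α β : Module.End A (CoreGenerator ε), α * projEndo ε s = α →
      β * projEndo ε s = β → ∀ i (w : ι → A), (∀ j, (α x j).1 = (β x i).1 * w j) →
      ∃ w, α = w * β := by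
    intro α β hα hβ i w hw
    refine ⟨LinearMap.pi fun j => LinearMap.toSpanSingleton A (_root_.leftIdeal (ε j))
      ⟨w j * ε j, by rw [mem_leftIdeal, mul_assoc, (h j).idem he]⟩ ∘ₗ
      (_root_.leftIdeal (ε i)).subtype ∘ₗ LinearMap.proj i,
      hext _ _ hα (by rw [mul_assoc, hβ]) (funext fun j => Subtype.ext ?_)⟩
    change (α x j).1 = (β x i).1 * (w j * ε j)
    rw [← mul_assoc, ← hw]
    exact (α x j).2.symm
  rcases (h s).target with ⟨h0, -⟩ | ⟨-, t, -, ht⟩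
  · have hx0 : x = 0 := by rw [← hx, h0, zero_smul]
    exact Or.inl ⟨1, hext _ _ hα (by rw [one_mul, hβ]) (by rw [hx0, map_zero, map_zero])⟩
  · have hl : ∀ (α : Module.End A (CoreGenerator ε)) i, e t * (α x i).1 = (α x i).1 := by
      intro α i
      have := congrArg (fun v : CoreGenerator ε => (v i).1) (map_smul α (ε s) x)
      rw [hx, ht] at this
      exact this.symm
    -- The Boolean says whether a coordinate belongs to `α` or to `β`; the one dividing all others
    -- decides which endomorphism factors through which.
    obtain ⟨⟨b, i⟩, -, hmax⟩ := he.exists_right_generator t (Finset.univ : Finset (Bool × ι))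
      ⟨(true, s), Finset.mem_univ _⟩ (fun q => if q.1 then (α x q.2).1 else (β x q.2).1)
      (by rintro ⟨b | b, i⟩ <;> exact hl _ i)
    cases b
    · choose w hw using fun j => hmax (true, j) (Finset.mem_univ _)
      exact Or.inl (key α β hα hβ i w hw)
    · choose w hw using fun j => hmax (false, j) (Finset.mem_univ _)
      exact Or.inr (key β α hβ hα i w hw)

variable {k : Type v} [CommRing k] [Algebra k A]

theorem finite_coreRing_base [IsNoetherianRing k] [Module.Finite k A] (he : IsSerialSystem e)
    (h : IsCoreFamily e ε a) : Module.Finite k (CoreRing ε) := by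
  have : ∀ s, Module.Finite k (_root_.leftIdeal (ε s)) := fun s =>
    Module.Finite.of_injective ((_root_.leftIdeal (ε s)).subtype.restrictScalars k)
      Subtype.val_injective
  have : Module.Finite k (Module.End A (CoreGenerator ε)) :=
    Module.Finite.of_injective (M := Module.End A (CoreGenerator ε)) (N := CoreGenerator ε)
      (⟨⟨fun f => f h.unit, fun _ _ => rfl⟩, fun _ _ => rfl⟩ :
        Module.End A (CoreGenerator ε) →ₗ[k] CoreGenerator ε)
      (fun f g hfg => h.linearMap_ext he (h.generator he) hfg)
  exact Module.Finite.equiv (MulOpposite.opLinearEquiv k)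

theorem ringHom_algebraMap (he : IsSerialSystem e) (h : IsCoreFamily e ε a) (c : k) :
    h.ringHom he (algebraMap k A c) = algebraMap k (CoreRing ε) c := by
  refine congrArg MulOpposite.op (h.endo_eq he (f := algebraMap k (Module.End A _) c) ?_).symm
  rw [algebraMap_smul]
  rfl

theorem isNakayamaAlgebra_coreRing [IsArtinianRing k] [Module.Finite k A] (he : IsSerialSystem e)
    (h : IsCoreFamily e ε a) : IsNakayamaAlgebra k (CoreRing ε) := by
  classical
  have hfin : Module.Finite k (CoreRing ε) := h.finite_coreRing_base he
  have : IsArtinianRing (CoreRing ε) := isArtinianRing_of_finite k _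
  have : Module.Finite k (CoreRing ε)ᵐᵒᵖ := Module.Finite.equiv (MulOpposite.opLinearEquiv k)
  have : IsArtinianRing (CoreRing ε)ᵐᵒᵖ := isArtinianRing_of_finite k _
  refine ⟨inferInstance, hfin, fun P _ _ _ hP hi => ?_, fun P _ _ _ hP hi => ?_⟩
  · refine isUniserial_of_projective (e := fun s => MulOpposite.op (projEndo ε s)) ?_ ?_ ?_ P hi
    · rw [← Finset.op_sum, sum_projEndo, MulOpposite.op_one]
    · intro s
      rw [← MulOpposite.op_mul, projEndo_mul_self]
    · intro s α β hα hβ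
      rcases h.comparable_of_projEndo_mul he s (MulOpposite.op_injective hα)
        (MulOpposite.op_injective hβ) with ⟨w, hw⟩ | ⟨w, hw⟩
      · exact Or.inl ⟨MulOpposite.op w, MulOpposite.unop_injective hw⟩
      · exact Or.inr ⟨MulOpposite.op w, MulOpposite.unop_injective hw⟩
  · refine isUniserial_of_projective
      (e := fun s => MulOpposite.op (MulOpposite.op (projEndo ε s))) ?_ ?_ ?_ P hi
    · rw [← Finset.op_sum, ← Finset.op_sum, sum_projEndo, MulOpposite.op_one,
        MulOpposite.op_one]
    · intro s
      rw [← MulOpposite.op_mul, ← MulOpposite.op_mul, projEndo_mul_self]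
    · intro s α β hα hβ
      rcases h.comparable_of_mul_projEndo he s
        (MulOpposite.op_injective (MulOpposite.op_injective hα))
        (MulOpposite.op_injective (MulOpposite.op_injective hβ)) with ⟨w, hw⟩ | ⟨w, hw⟩
      · exact Or.inl ⟨MulOpposite.op (MulOpposite.op w),
          MulOpposite.unop_injective (MulOpposite.unop_injective hw)⟩
      · exact Or.inr ⟨MulOpposite.op (MulOpposite.op w),
          MulOpposite.unop_injective (MulOpposite.unop_injective hw)⟩

/-- By Baer's criterion. The quotient by a left ideal `I` restricts to a core module, which is
Gorenstein projective over `A`. So `I` is a syzygy whose maps to finitely generated projective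
modules extend, and the extension is linear over `CoreRing`. -/
theorem injective_coreRing [IsArtinianRing A] (he : IsSerialSystem e)
    (h : IsCoreFamily e ε a) : Module.Injective (CoreRing ε) (CoreRing ε) := by
  refine Module.Baer.injective fun I g => ?_
  let : Module A (CoreRing ε) := Module.compHom _ (h.ringHom he)
  let : Module A I := Module.compHom _ (h.ringHom he)
  let : Module A (CoreRing ε ⧸ I) := Module.compHom _ (h.ringHom he)
  have hB : ∀ (r : A) (n : CoreRing ε), r • n = h.ringHom he r • n := fun _ _ => rfl
  have hQ : ∀ (r : A) (n : CoreRing ε ⧸ I), r • n = h.ringHom he r • n := fun _ _ => rfl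
  have : Module.Finite A (CoreRing ε) := h.finite_of_finite he hB
  have : Module.Finite A (CoreRing ε ⧸ I) := h.finite_of_finite he hQ
  have : Module.Projective A (CoreRing ε) := h.projective_restrict he hB
  have hG : gorensteinProj A (FGModuleCat.of A (CoreRing ε ⧸ I)) :=
    gorensteinCore_le_gorensteinProj _ ((h.gorensteinCore_iff he).mpr (h.isCoreModule he hQ))
  let κ : I →ₗ[A] CoreRing ε := ⟨⟨I.subtype, I.subtype.map_add⟩, fun _ _ => rfl⟩
  let π : CoreRing ε →ₗ[A] CoreRing ε ⧸ I := ⟨⟨I.mkQ, I.mkQ.map_add⟩, fun _ _ => rfl⟩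
  let g' : I →ₗ[A] CoreRing ε := ⟨⟨g, g.map_add⟩, fun r x => g.map_smul (h.ringHom he r) x⟩
  have hκ : IsLeftApproximation κ :=
    (gorensteinProj_isGorensteinSummand hG).isLeftApproximation (π := π) Subtype.val_injective
      (fun x => (Submodule.Quotient.mk_eq_zero I).trans
        ⟨fun hx => ⟨⟨x, hx⟩, rfl⟩, fun ⟨y, hy⟩ => hy ▸ y.2⟩) I.mkQ_surjective
  obtain ⟨ψ, hψ⟩ := hκ.exists_comp_eq g'
  exact ⟨⟨⟨ψ, ψ.map_add⟩, h.map_smul_coreRing he hB hB ψ⟩,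
    fun x hx => LinearMap.congr_fun hψ ⟨x, hx⟩⟩

end IsCoreFamily

end CoreRingNakayama

/-! ### Abelian subcategories of the category of finitely generated modules. -/

section Subcategories

variable {A : Type u} [Ring A] [IsNoetherianRing A]

theorem FGModuleCat.function_exact {S : ShortComplex (FGModuleCat.{u} A)} (hS : S.Exact) :
    Function.Exact S.f.hom.hom S.g.hom.hom :=
  (ShortComplex.ShortExact.moduleCat_exact_iff_function_exact _).mp
    (hS.map (forget₂ (FGModuleCat A) (ModuleCat A)))

theorem FGModuleCat.injective_of_mono {X Y : FGModuleCat.{u} A} (f : X ⟶ Y) [Mono f] :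
    Function.Injective f.hom.hom :=
  (ModuleCat.mono_iff_injective ((forget₂ (FGModuleCat A) (ModuleCat A)).map f)).mp inferInstance

theorem FGModuleCat.surjective_of_epi {X Y : FGModuleCat.{u} A} (f : X ⟶ Y) [Epi f] :
    Function.Surjective f.hom.hom :=
  (ModuleCat.epi_iff_surjective ((forget₂ (FGModuleCat A) (ModuleCat A)).map f)).mp inferInstance

theorem FGModuleCat.isClosedUnderKernels {P : ObjectProperty (FGModuleCat.{u} A)}
    (h : ∀ ⦃X Y Z : FGModuleCat.{u} A⦄ (κ : Z →ₗ[A] X) (f : X →ₗ[A] Y), Function.Injective κ →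
      Function.Exact κ f → P X → P Y → P Z) : P.IsClosedUnderKernels where
  kernels_le := by
    rintro _ ⟨f, k, hk, hf⟩
    have : Mono k.ι := Fork.IsLimit.mono hk
    exact h _ _ (injective_of_mono k.ι) (function_exact (S := ShortComplex.mk k.ι f k.condition)
      (ShortComplex.exact_of_f_is_kernel _ (IsLimit.ofIsoLimit hk (Fork.ext (Iso.refl _)))))
      hf.1 hf.2

theorem FGModuleCat.isClosedUnderCokernels {P : ObjectProperty (FGModuleCat.{u} A)}
    (h : ∀ ⦃X Y Z : FGModuleCat.{u} A⦄ (f : X →ₗ[A] Y) (c : Y →ₗ[A] Z), Function.Surjective c →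
      Function.Exact f c → P X → P Y → P Z) : P.IsClosedUnderCokernels where
  cokernels_le := by
    rintro _ ⟨f, k, hk, hf⟩
    have : Epi k.π := Cofork.IsColimit.epi hk
    exact h _ _ (surjective_of_epi k.π) (function_exact (S := ShortComplex.mk f k.π k.condition)
      (ShortComplex.exact_of_g_is_cokernel _ (IsColimit.ofIsoColimit hk (Cofork.ext (Iso.refl _)))))
      hf.1 hf.2

theorem FGModuleCat.isClosedUnderExtensions {P : ObjectProperty (FGModuleCat.{u} A)}
    (h : ∀ ⦃X Y Z : FGModuleCat.{u} A⦄ (j : X →ₗ[A] Y) (c : Y →ₗ[A] Z), Function.Injective j →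
      Function.Exact j c → Function.Surjective c → P X → P Z → P Y) :
    P.IsClosedUnderExtensions where
  prop_X₂_of_shortExact hS h₁ h₃ := by
    have := hS.mono_f
    have := hS.epi_g
    exact h _ _ (injective_of_mono _) (function_exact hS.exact) (surjective_of_epi _) h₁ h₃

theorem isExactAbelianSubcategory_of_isClosedUnder {P : ObjectProperty (FGModuleCat.{u} A)}
    [P.IsClosedUnderKernels] [P.IsClosedUnderCokernels] [P.IsClosedUnderExtensions]
    [P.IsClosedUnderIsomorphisms] [P.ContainsZero] : IsExactAbelianSubcategory P := by
  -- A biproduct is a split extension of its factors.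
  have : P.IsClosedUnderBinaryProducts :=
    { limitsOfShape_le := by
        rintro X ⟨p⟩
        refine P.prop_of_iso ?_ (P.prop_biprod (p.prop_diag_obj (.mk .left))
          (p.prop_diag_obj (.mk .right)))
        exact IsLimit.conePointUniqueUpToIso (BinaryBiproduct.isLimit _ _)
          ((IsLimit.postcomposeHomEquiv (diagramIsoPair p.diag) _).2 p.isLimit) }
  have : P.IsClosedUnderFiniteProducts := .mk'
  have hab : Abelian P.FullSubcategory := inferInstance
  have : HasBinaryBiproducts P.FullSubcategory := HasBinaryBiproducts.of_hasBinaryProducts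
  have h1 := P.preservesKernels_ι
  have h2 := P.preservesCokernels_ι
  exact ⟨⟨hab⟩, P.ι.preservesFiniteLimits_of_preservesKernels,
    P.ι.preservesFiniteColimits_of_preservesCokernels⟩

end Subcategories

/-! ### The core as an exact abelian subcategory. -/

section GorensteinCore

variable {A : Type u} [Ring A] {ι : Type} [Fintype ι] {e ε a : ι → A} [IsArtinianRing A]

namespace IsCoreFamily

theorem isClosedUnderExtensions (he : IsSerialSystem e) (h : IsCoreFamily e ε a) :
    (gorensteinCore A).IsClosedUnderExtensions :=
  FGModuleCat.isClosedUnderExtensions fun X Y Z j c hj hjc hc hX hZ => by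
    rw [h.gorensteinCore_iff he] at hX hZ ⊢
    exact IsCoreModule.ext (fun s => (h s).idem he) (fun s => (h s).left) hX hZ hj hjc hc

open ZeroObject in
theorem isExactAbelianSubcategory (he : IsSerialSystem e) (h : IsCoreFamily e ε a) :
    IsExactAbelianSubcategory (gorensteinCore A) := by
  have : (gorensteinCore A).IsClosedUnderKernels :=
    FGModuleCat.isClosedUnderKernels fun X Y Z κ f hκ hκf hX hY => by
      rw [h.gorensteinCore_iff he] at hX hY ⊢
      exact hX.ker hY hκ hκf
  have : (gorensteinCore A).IsClosedUnderCokernels :=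
    FGModuleCat.isClosedUnderCokernels fun X Y Z f c hc hfc hX hY => by
      rw [h.gorensteinCore_iff he] at hX hY ⊢
      exact IsCoreModule.coker he.mul_self (fun s => (h s).idem he) (fun s => (h s).left) hX hY
        hfc hc
  have := h.isClosedUnderExtensions he
  have : (gorensteinCore A).IsClosedUnderIsomorphisms :=
    ⟨fun i hX => by
      rw [h.gorensteinCore_iff he] at hX ⊢
      exact hX.of_equiv (FGModuleCat.isoToLinearEquiv i).symm⟩
  have : (gorensteinCore A).ContainsZero := by
    refine ⟨0, isZero_zero _, (h.gorensteinCore_iff he).mpr ?_⟩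
    have : Subsingleton ((0 : FGModuleCat.{u} A) : Type u) :=
      ModuleCat.subsingleton_of_isZero
        ((forget₂ (FGModuleCat.{u} A) (ModuleCat.{u} A)).map_isZero (isZero_zero _))
    exact IsCoreModule.of_subsingleton
  exact isExactAbelianSubcategory_of_isClosedUnder

end IsCoreFamily

end GorensteinCore

/-! ### Stable categories as quotients, and a criterion for stable equivalence. -/

section StableCategories

universe v₁ u₁ v₂ u₂

/-- Biproducts are needed for transitivity: the sum of two factorisations passes through the direct
sum of the two objects. -/
theorem congruence_stableRel {D : Type u₁} [Category.{v₁} D] [Preadditive D] {Pr : ObjectProperty D}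
    (h0 : ∃ P, Pr P) (h : ∀ P P', Pr P → Pr P' → ∃ b : BinaryBicone P P', Pr b.pt) :
    Congruence (stableRel Pr) where
  equivalence :=
    { refl := fun f => by
        obtain ⟨P, hP⟩ := h0
        exact ⟨P, hP, 0, 0, by simp⟩
      symm := by
        rintro f g ⟨P, hP, a, b, hab⟩
        exact ⟨P, hP, -a, b, by rw [Preadditive.neg_comp, ← hab, neg_sub]⟩
      trans := by
        rintro f g k ⟨P, hP, a, b, hab⟩ ⟨P', hP', a', b', hab'⟩
        obtain ⟨c, hc⟩ := h P P' hP hP'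
        refine ⟨c.pt, hc, a ≫ c.inl + a' ≫ c.inr, c.fst ≫ b + c.snd ≫ b', ?_⟩
        rw [← sub_add_sub_cancel f g k, hab, hab']
        simp }
  comp_left := by
    rintro X Y Z f g g' ⟨P, hP, a, b, hab⟩
    exact ⟨P, hP, f ≫ a, b, by rw [← Preadditive.comp_sub, hab, Category.assoc]⟩
  comp_right := by
    rintro X Y Z f f' g ⟨P, hP, a, b, hab⟩
    exact ⟨P, hP, a, b ≫ g, by rw [← Preadditive.sub_comp, hab, Category.assoc]⟩

/-- `hF` gives faithfulness on the quotients. `hess` presents each `G` as `F X` plus a complement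
that vanishes stably, which gives essential surjectivity. -/
theorem isEquivalence_lift_stableRel {B : Type u₁} [Category.{v₁} B] [Preadditive B] {D : Type u₂}
    [Category.{v₂} D] [Preadditive D] (F : B ⥤ D) [F.Additive] [F.Full]
    {Pr : ObjectProperty B} {Pr' : ObjectProperty D} [Congruence (stableRel Pr')]
    (hPr : ∀ X, Pr X → Pr' (F.obj X))
    (hF : ∀ (X Y : B) (f : X ⟶ Y) (Q : D) (a : F.obj X ⟶ Q) (b : Q ⟶ F.obj Y), Pr' Q →
      F.map f = a ≫ b → ∃ P, Pr P ∧ ∃ (a' : X ⟶ P) (b' : P ⟶ Y), f = a' ≫ b')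
    (hess : ∀ G : D, ∃ (X : B) (i : F.obj X ⟶ G) (r : G ⟶ F.obj X) (Q : D) (a : G ⟶ Q) (b : Q ⟶ G),
      Pr' Q ∧ i ≫ r = 𝟙 _ ∧ 𝟙 G - r ≫ i = a ≫ b) :
    ∃ H : ∀ (X Y : B) (f g : X ⟶ Y), stableRel Pr f g →
        (F ⋙ CategoryTheory.Quotient.functor (stableRel Pr')).map f =
          (F ⋙ CategoryTheory.Quotient.functor (stableRel Pr')).map g,
      (CategoryTheory.Quotient.lift (stableRel Pr)
        (F ⋙ CategoryTheory.Quotient.functor (stableRel Pr')) H).IsEquivalence := by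
  have H : ∀ (X Y : B) (f g : X ⟶ Y), stableRel Pr f g →
      (F ⋙ CategoryTheory.Quotient.functor (stableRel Pr')).map f =
        (F ⋙ CategoryTheory.Quotient.functor (stableRel Pr')).map g := by
    rintro X Y f g ⟨P, hP, a, b, hab⟩
    exact CategoryTheory.Quotient.sound _ ⟨F.obj P, hPr P hP, F.map a, F.map b, by
      rw [← F.map_sub, hab, F.map_comp]⟩
  refine ⟨H, @Functor.IsEquivalence.mk _ _ _ _ _ ⟨fun {X Y f g} hfg => ?_⟩ ⟨fun {X Y} f => ?_⟩
    ⟨fun G => ?_⟩⟩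
  · obtain ⟨f, rfl⟩ := (CategoryTheory.Quotient.functor (stableRel Pr)).map_surjective f
    obtain ⟨g, rfl⟩ := (CategoryTheory.Quotient.functor (stableRel Pr)).map_surjective g
    obtain ⟨Q, hQ, a, b, hab⟩ := (CategoryTheory.Quotient.functor_map_eq_iff _ _ _).mp hfg
    obtain ⟨P, hP, a', b', h⟩ := hF _ _ (f - g) Q a b hQ (by rw [F.map_sub, hab])
    exact CategoryTheory.Quotient.sound _ ⟨P, hP, a', b', h⟩
  · obtain ⟨f, rfl⟩ := (CategoryTheory.Quotient.functor (stableRel Pr')).map_surjective f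
    obtain ⟨f, rfl⟩ := F.map_surjective f
    exact ⟨(CategoryTheory.Quotient.functor (stableRel Pr)).map f, rfl⟩
  · obtain ⟨X, i, r, Q, a, b, hQ, hir, hab⟩ := hess G.as
    exact ⟨(CategoryTheory.Quotient.functor (stableRel Pr)).obj X,
      ⟨{ hom := (CategoryTheory.Quotient.functor (stableRel Pr')).map i
         inv := (CategoryTheory.Quotient.functor (stableRel Pr')).map r
         hom_inv_id := by
          rw [← Functor.map_comp, hir]
          rfl
         inv_hom_id := by
          rw [← Functor.map_comp]
          exact (CategoryTheory.Quotient.sound _ ⟨Q, hQ, a, b, hab⟩).symm }⟩⟩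

theorem congruence_stableGpRel (A : Type u) [Ring A] : Congruence (stableGpRel A) := by
  refine congruence_stableRel
    ⟨⟨FGModuleCat.of A PUnit.{u + 1}, gorensteinProj_of_projective
      (inferInstanceAs (Module.Projective A PUnit.{u + 1}))⟩,
      inferInstanceAs (Module.Projective A PUnit.{u + 1})⟩ ?_
  rintro ⟨P, hP⟩ ⟨P', hP'⟩ (h : Module.Projective A P) (h' : Module.Projective A P')
  refine ⟨{ pt := ⟨FGModuleCat.of A (P × P'), gorensteinProj_of_projective
              (inferInstanceAs (Module.Projective A (P × P')))⟩
            fst := ObjectProperty.homMk (FGModuleCat.ofHom (LinearMap.fst A P P'))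
            snd := ObjectProperty.homMk (FGModuleCat.ofHom (LinearMap.snd A P P'))
            inl := ObjectProperty.homMk (FGModuleCat.ofHom (LinearMap.inl A P P'))
            inr := ObjectProperty.homMk (FGModuleCat.ofHom (LinearMap.inr A P P'))
            inl_fst := rfl
            inl_snd := rfl
            inr_fst := rfl
            inr_snd := rfl }, inferInstanceAs (Module.Projective A (P × P'))⟩

end StableCategories

/-! ### Restriction of scalars to the core and the stable equivalence. -/

section CoreFunctor

theorem IsGorensteinSummand.of_retract {A : Type u} [Ring A] {M N : Type u} [AddCommGroup M]
    [Module A M] [AddCommGroup N] [Module A N] [Module.Finite A N] (h : IsGorensteinSummand A N)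
    (i : M →ₗ[A] N) (r : N →ₗ[A] M) (hir : ∀ x, r (i x) = x) : IsGorensteinSummand A M := by
  have hc : ∀ x, (LinearMap.id - i ∘ₗ r : N →ₗ[A] N) x ∈ LinearMap.ker r := by simp [hir]
  have : Module.Finite A (LinearMap.ker r) := Module.Finite.of_surjective
    ((LinearMap.id - i ∘ₗ r).codRestrict (LinearMap.ker r) hc)
    (fun x => ⟨x.1, Subtype.ext (by simp)⟩)
  refine (h.of_equiv (LinearEquiv.symm (LinearEquiv.ofLinearMap
    (i.coprod (LinearMap.ker r).subtype)
    (r.prod ((LinearMap.id - i ∘ₗ r).codRestrict (LinearMap.ker r) hc))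
    ?_ ?_))).of_prod (M' := LinearMap.ker r)
  · ext x
    simp
  · ext x
    all_goals simp [hir]

variable {A : Type u} [Ring A] {ι : Type} [Fintype ι] {e ε a : ι → A} [IsArtinianRing A]

/-- A Gorenstein projective module is the direct sum of a module in the Gorenstein core and a
projective module. -/
theorem IsCoreFamily.exists_equiv_prod (he : IsSerialSystem e) (h : IsCoreFamily e ε a)
    {G : FGModuleCat.{u} A} (hG : gorensteinProj A G) :
    ∃ U V : FGModuleCat.{u} A, gorensteinCore A U ∧ Module.Projective A V ∧
      Nonempty (G ≃ₗ[A] (U × V)) := by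
  classical
  obtain ⟨n, X, hX, ⟨E⟩⟩ := exists_equiv_pi_indecomposable (R := A) G
  have hS : ∀ i, IsGorensteinSummand A (X i) := fun i =>
    (gorensteinProj_isGorensteinSummand hG).of_retract
      (E.symm.toLinearMap ∘ₗ LinearMap.single A (fun i => (X i : Type u)) i)
      (LinearMap.proj i ∘ₗ E.toLinearMap) (by simp)
  let p : Fin n → Prop := fun i => Module.Projective A (X i)
  have hU : ∀ i : {i // ¬ p i}, IsCoreModule e ε a (X i) := fun i =>
    h.isCoreModule_of_indecNonproj he (he.indecNonprojGorensteinProj (hX i) i.2 (hS i))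
  have hV : ∀ i : {i // p i}, Module.Projective A (X i) := fun i => i.2
  refine ⟨FGModuleCat.of A (∀ i : {i // ¬ p i}, X i), FGModuleCat.of A (∀ i : {i // p i}, X i),
    (h.gorensteinCore_iff he).mpr (IsCoreModule.pi hU), projective_pi, ⟨E.trans
    (LinearEquiv.trans (M₂ := (∀ i : {i // p i}, X i) × ∀ i : {i // ¬ p i}, X i)
      { Equiv.piEquivPiSubtypeProd p (fun i => (X i : Type u)) with
        map_add' := fun _ _ => rfl
        map_smul' := fun _ _ => rfl } (LinearEquiv.prodComm A _ _))⟩⟩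

namespace IsCoreFamily

/-- A module over the opposite endomorphism ring of the generator as a module over `A`. -/
noncomputable def coreObj (he : IsSerialSystem e) (h : IsCoreFamily e ε a)
    (N : FGModuleCat.{u} (CoreRing ε)) : (gorensteinCore A).FullSubcategory :=
  letI : Module A N := Module.compHom N (h.ringHom he)
  haveI : Module.Finite A N := h.finite_of_finite he fun _ _ => rfl
  ⟨FGModuleCat.of A N, (h.gorensteinCore_iff he).mpr (h.isCoreModule he (N := N) fun _ _ => rfl)⟩

/-- The restriction of scalars from modules over the opposite endomorphism ring of the generator to
the Gorenstein core. -/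
noncomputable def coreFunctor (he : IsSerialSystem e) (h : IsCoreFamily e ε a) :
    FGModuleCat.{u} (CoreRing ε) ⥤ (gorensteinCore A).FullSubcategory where
  obj N := h.coreObj he N
  map {N N'} f := ObjectProperty.homMk (InducedCategory.homMk (ModuleCat.ofHom
    (X := (h.coreObj he N).obj) (Y := (h.coreObj he N').obj)
    { toFun := f.hom.hom
      map_add' := f.hom.hom.map_add
      map_smul' := fun r x => f.hom.hom.map_smul (h.ringHom he r) x }))

instance (N : FGModuleCat.{u} (CoreRing ε)) (he : IsSerialSystem e) (h : IsCoreFamily e ε a) :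
    Module (CoreRing ε) (h.coreObj he N).obj :=
  inferInstanceAs (Module (CoreRing ε) N)

theorem coreObj_smul (he : IsSerialSystem e) (h : IsCoreFamily e ε a)
    (N : FGModuleCat.{u} (CoreRing ε)) (r : A) (x : (h.coreObj he N).obj) :
    r • x = h.ringHom he r • x := rfl

instance (he : IsSerialSystem e) (h : IsCoreFamily e ε a) : (h.coreFunctor he).Additive where

instance (he : IsSerialSystem e) (h : IsCoreFamily e ε a) : (h.coreFunctor he).Faithful where
  map_injective {N N'} f g hfg := by
    ext x
    exact congrArg (fun φ => φ.hom.hom.hom x) hfg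

instance (he : IsSerialSystem e) (h : IsCoreFamily e ε a) : (h.coreFunctor he).Full where
  map_surjective {N N'} f :=
    ⟨FGModuleCat.ofHom ⟨⟨f.hom.hom.hom, f.hom.hom.hom.map_add⟩,
      h.map_smul_coreRing he (h.coreObj_smul he N) (h.coreObj_smul he N') f.hom.hom.hom⟩, rfl⟩

instance (he : IsSerialSystem e) (h : IsCoreFamily e ε a) : (h.coreFunctor he).EssSurj where
  mem_essImage X := by
    have hX := (h.gorensteinCore_iff he).mp X.2
    let := h.coreRingModule he hX
    have hs := h.smul_eq_coreRingModule_smul he hX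
    have := h.finite_coreRing he hs
    let E : (h.coreObj he (FGModuleCat.of (CoreRing ε) X.obj)).obj ≃ₗ[A] X.obj :=
      { AddEquiv.refl X.obj with map_smul' := fun r x => (hs r x).symm }
    exact ⟨FGModuleCat.of (CoreRing ε) X.obj, ⟨ObjectProperty.isoMk _ E.toFGModuleCatIso⟩⟩

instance (he : IsSerialSystem e) (h : IsCoreFamily e ε a) : (h.coreFunctor he).IsEquivalence where

theorem isLinearOver_coreFunctor {k : Type v} [CommRing k] [Algebra k A] (he : IsSerialSystem e)
    (h : IsCoreFamily e ε a) : IsLinearOver k (h.coreFunctor he) := by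
  refine ⟨inferInstance, fun X Y f g c hfg y => (hfg y).trans ?_⟩
  rw [← h.ringHom_algebraMap he]
  rfl

theorem inducesStableEquivalence_coreFunctor (he : IsSerialSystem e) (h : IsCoreFamily e ε a) :
    InducesStableEquivalence gorensteinCore_le_gorensteinProj (h.coreFunctor he) := by
  have := congruence_stableGpRel A
  have : (h.coreFunctor he ⋙
      ObjectProperty.ιOfLE (gorensteinCore_le_gorensteinProj (A := A))).Additive := { }
  refine isEquivalence_lift_stableRel
    (h.coreFunctor he ⋙ ObjectProperty.ιOfLE gorensteinCore_le_gorensteinProj) ?_ ?_ ?_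
  · intro N (hN : Module.Projective (CoreRing ε) N)
    have : Module.Projective (CoreRing ε) (h.coreObj he N).obj := hN
    have : Module.Finite (CoreRing ε) (h.coreObj he N).obj :=
      inferInstanceAs (Module.Finite (CoreRing ε) N)
    exact h.projective_restrict (N := (h.coreObj he N).obj) he (h.coreObj_smul he N)
  · intro N N' f Q a b (hQ : Module.Projective A Q.obj) hf
    -- `Q` need not lie in the core. The first factor `a` is therefore pushed through an
    -- approximation of the source by a projective core module, which is projective over `CoreRing`.
    obtain ⟨P, j, hP, hPc, hj⟩ := h.exists_approximation he (h.coreObj he N).2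
    obtain ⟨ψ, hψ⟩ := hj.exists_comp_eq a.hom.hom.hom
    let := h.coreRingModule he hPc
    have hs := h.smul_eq_coreRingModule_smul he hPc
    have := h.finite_coreRing he hs
    refine ⟨FGModuleCat.of (CoreRing ε) P, h.projective_coreRing he hs,
      FGModuleCat.ofHom ⟨⟨j, j.map_add⟩, h.map_smul_coreRing he (h.coreObj_smul he N) hs j⟩,
      FGModuleCat.ofHom ⟨⟨b.hom.hom.hom ∘ₗ ψ, map_add _⟩,
        h.map_smul_coreRing he hs (h.coreObj_smul he N') (b.hom.hom.hom ∘ₗ ψ)⟩, ?_⟩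
    ext x
    refine (congrArg (fun φ => φ.hom.hom.hom x) hf).trans ?_
    exact congrArg b.hom.hom.hom (LinearMap.congr_fun hψ x).symm
  · intro G
    obtain ⟨U, V, hU, hV, ⟨E⟩⟩ := h.exists_equiv_prod he G.2
    let X := (h.coreFunctor he).objPreimage ⟨U, hU⟩
    let I : (h.coreObj he X).obj ≃ₗ[A] U := FGModuleCat.isoToLinearEquiv
      ((gorensteinCore A).ι.mapIso ((h.coreFunctor he).objObjPreimageIso ⟨U, hU⟩))
    let i : (h.coreObj he X).obj →ₗ[A] G.obj :=
      E.symm.toLinearMap ∘ₗ LinearMap.inl A U V ∘ₗ I.toLinearMap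
    let r : G.obj →ₗ[A] (h.coreObj he X).obj :=
      I.symm.toLinearMap ∘ₗ LinearMap.fst A U V ∘ₗ E.toLinearMap
    let i' : (h.coreObj he X).obj ⟶ G.obj := InducedCategory.homMk (ModuleCat.ofHom (X := (h.coreObj he X).obj) i)
    let r' : G.obj ⟶ (h.coreObj he X).obj := InducedCategory.homMk (ModuleCat.ofHom (Y := (h.coreObj he X).obj) r)
    refine ⟨X, ObjectProperty.homMk i', ObjectProperty.homMk r',
      ⟨V, gorensteinProj_of_projective hV⟩,
      ObjectProperty.homMk (FGModuleCat.ofHom (LinearMap.snd A U V ∘ₗ E.toLinearMap)),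
      ObjectProperty.homMk (FGModuleCat.ofHom (E.symm.toLinearMap ∘ₗ LinearMap.inr A U V)),
      hV, ?_, ?_⟩
    · apply ObjectProperty.hom_ext
      ext x
      change I.symm (E (E.symm (I x, 0))).1 = x
      rw [LinearEquiv.apply_symm_apply]
      exact I.symm_apply_apply x
    · apply ObjectProperty.hom_ext
      ext x
      change x - E.symm (I (I.symm (E x).1), 0) = E.symm (0, (E x).2)
      rw [sub_eq_iff_eq_add, LinearEquiv.apply_symm_apply, ← map_add, Prod.mk_add_mk, zero_add,
        add_zero, Prod.mk.eta, LinearEquiv.symm_apply_apply]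

end IsCoreFamily

end CoreFunctor

/-! ### Connectedness. -/

section Connected

variable {A : Type u} [Ring A] {ι : Type} [Fintype ι] {e ε a : ι → A}

/-- The sum of the `e s` with `Q s` is idempotent, and central because no nonzero element of `e s A
e t` joins a vertex in `Q` to one outside. -/
theorem IsConnectedAlgebra.forall_or_forall_not (hA : IsConnectedAlgebra A)
    (he : CompleteOrthogonalIdempotents e) (hne : ∀ s, e s ≠ 0) {Q : ι → Prop}
    (hQ : ∀ s t x, e s * x = x → x * e t = x → x ≠ 0 → (Q s ↔ Q t)) :
    (∀ s, Q s) ∨ ∀ s, ¬ Q s := by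
  classical
  let c : A := ∑ s with Q s, e s
  have hce : ∀ s, e s * c = if Q s then e s else 0 := by
    intro s
    rw [Finset.mul_sum, Finset.sum_filter, Finset.sum_eq_single s]
    · rw [he.idem s]
    · intro t _ ht
      rw [he.ortho (Ne.symm ht), ite_self]
    · simp
  have hec : ∀ s, c * e s = if Q s then e s else 0 := by
    intro s
    rw [Finset.sum_mul, Finset.sum_filter, Finset.sum_eq_single s]
    · rw [he.idem s]
    · intro t _ ht
      rw [he.ortho ht, ite_self]
    · simp
  have hcx : ∀ x, c * x = x * c := by
    intro x
    have : ∀ s t, e s * (c * x) * e t = e s * (x * c) * e t := by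
      intro s t
      rw [← mul_assoc, hce, ← mul_assoc, mul_assoc (e s * x), hec]
      by_cases h0 : e s * x * e t = 0
      · split_ifs <;> simp [h0]
      · have := hQ s t _ (by rw [← mul_assoc, ← mul_assoc, he.idem s])
          (by rw [mul_assoc, he.idem t]) h0
        by_cases hs : Q s
        · rw [if_pos hs, if_pos (this.mp hs)]
        · rw [if_neg hs, if_neg (fun ht => hs (this.mpr ht)), zero_mul, zero_mul, mul_zero]
    calc c * x = (∑ s, e s) * (c * x) * ∑ t, e t := by rw [he.complete, one_mul, mul_one]
      _ = (∑ s, e s) * (x * c) * ∑ t, e t := by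
        simp only [Finset.sum_mul, Finset.mul_sum, this]
      _ = x * c := by rw [he.complete, one_mul, mul_one]
  have hidem : IsIdempotentElem c := by
    change c * c = c
    conv_lhs => rw [Finset.mul_sum]
    exact Finset.sum_congr rfl fun s hs => by rw [hec, if_pos (Finset.mem_filter.mp hs).2]
  rcases hA.2 c hidem (Subring.mem_center_iff.mpr fun x => (hcx x).symm) with h0 | h1
  · refine Or.inr fun s hs => hne s ?_
    have := hce s
    rw [h0, mul_zero, if_pos hs] at this
    exact this.symm
  · refine Or.inl fun s => ?_
    by_contra hs
    have := hce s
    rw [h1, mul_one, if_neg hs] at this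
    exact hne s this

namespace IsCoreFamily

/-- The compatibility of `Q` is known only for nonzero maps ending in `gorensteinIndex`. For an
arbitrary nonzero `f` from `s` to `s'`, divisibility produces such a map between the vertices
concerned. -/
theorem forall_or_forall_not [IsNoetherianRing A] (he : IsSerialSystem e)
    (h : IsCoreFamily e ε a) (hA : IsConnectedAlgebra A) {Q : ι → Prop}
    (hQ0 : ∀ s, Q s → a s ≠ 0)
    (hQ : ∀ s, ∀ t ∈ gorensteinIndex e, ∀ x, e s * x = x → x * e t = x → x ≠ 0 → (Q s ↔ Q t)) :
    (∀ s, Q s) ∨ ∀ s, ¬ Q s := by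
  have hid := he.mul_self
  have htarget : ∀ s, Q s → ∃ t ∈ gorensteinIndex e, ε s = e t ∧ Q t := by
    intro s hs
    rcases (h s).target with ⟨-, h0⟩ | ⟨ha, t, ht, hεt⟩
    · exact absurd h0 (hQ0 s hs)
    · exact ⟨t, ht, hεt, (hQ s t ht (a s) (h s).left (by rw [← hεt, (h s).right]) ha).mp hs⟩
  refine hA.forall_or_forall_not he.coi he.ne_zero fun s s' f hl hr hf => ⟨fun hs => ?_,
    fun hs' => ?_⟩
  · obtain ⟨t, ht, hεt, hQt⟩ := htarget s hs
    have har : a s * e t = a s := by rw [← hεt, (h s).right]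
    rcases he.right s f (a s) hl (h s).left with ⟨w, hw⟩ | ⟨w, hw⟩
    · obtain ⟨v, hv, hvl, hvr⟩ : ∃ v, v ≠ 0 ∧ e t * v = v ∧ v * e s' = v := by
        refine ⟨e t * w * e s', fun h0 => hf ?_, by simp only [← mul_assoc, hid],
          by simp only [mul_assoc, hid]⟩
        rw [← hr, hw, ← har, mul_assoc (a s), mul_assoc (a s), h0, mul_zero]
      -- Now `f` factors as `a s` followed by a nonzero `v` from `t` to `s'`. Two exact steps `g,
      -- g'` out of `t` suffice: if `v` does not divide `g`, then `v = g * x`, and this `x` divides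
      -- `g'`, as otherwise `v` would be a multiple of `g * g' = 0`.
      obtain ⟨i, d, hd⟩ := ht
      obtain ⟨q, hq, g, hg, hdg⟩ := he.exists_arrow_right (he.mem_gorensteinIndex_source hd) hd.1
      obtain ⟨q', hq', g', hg', hgg'⟩ := he.exists_arrow_right ⟨i, d, hd⟩ hg
      have hQq : Q q := (hQ t q hq g hg.left hg.right hg.ne_zero).mp hQt
      have hQq' : Q q' := (hQ q q' hq' g' hg'.left hg'.right hg'.ne_zero).mp hQq
      rcases he.right t v g hvl hg.left with ⟨x, hx⟩ | ⟨x, hx⟩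
      · have hvx : v = g * (e q * x * e s') := by
          rw [← mul_assoc, ← mul_assoc, hg.right, ← hx, hvr]
        rcases he.right q (e q * x * e s') g' (by simp only [← mul_assoc, hid]) hg'.left with
          ⟨y, hy⟩ | ⟨y, hy⟩
        · refine absurd ?_ hv
          rw [hvx, hy, ← mul_assoc, hgg'.mul_eq_zero, zero_mul]
        · refine (hQ s' q' hq' (e s' * y * e q') (by simp only [← mul_assoc, hid])
            (by simp only [mul_assoc, hid]) fun h0 => hg'.ne_zero ?_).mpr hQq'
          rw [← hg'.right, hy, mul_assoc _ (e s'), mul_assoc _ (e s' * y), h0, mul_zero]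
      · refine (hQ s' q hq (e s' * x * e q) (by simp only [← mul_assoc, hid])
          (by simp only [mul_assoc, hid]) fun h0 => hg.ne_zero ?_).mpr hQq
        rw [← hg.right, hx, ← hvr, mul_assoc v, mul_assoc v, h0, mul_zero]
    · refine (hQ s' t ht (e s' * w * e t) (by simp only [← mul_assoc, hid])
        (by simp only [mul_assoc, hid]) fun h0 => hQ0 s hs ?_).mpr hQt
      rw [← har, hw, ← hr, mul_assoc f, mul_assoc f, h0, mul_zero]
  · obtain ⟨t, ht, hεt, hQt⟩ := htarget s' hs'
    have har : a s' * e t = a s' := by rw [← hεt, (h s').right]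
    by_cases hfa : f * a s' = 0
    -- If `f * a s' = 0`, use an arrow `d` from `i` to `t`. The Nakayama argument excludes that `a
    -- s'` factors through `d`, so `d` factors through `a s'`; the first factor does not factor
    -- through `f`, as `d ≠ 0`, so `f` factors through `i`.
    · obtain ⟨i, d, hd⟩ := ht
      have hi := he.mem_gorensteinIndex_source hd
      have hQi : Q i := (hQ i t ⟨i, d, hd⟩ d hd.1.left hd.1.right hd.1.ne_zero).mpr hQt
      rcases he.left t (a s') d har hd.1.right with ⟨w, hw⟩ | ⟨w, hw⟩
      · obtain ⟨w', hw'⟩ := (h s').generates i hi (e s' * w * e i)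
          (by simp only [← mul_assoc, hid]) (by simp only [mul_assoc, hid])
        refine absurd (he.eq_zero_of_eq_mul_right hd.1 har (w := w') ?_) (hQ0 s' hs')
        rw [← mul_assoc, ← hw', mul_assoc, hd.1.left, mul_assoc, ← hw, (h s').left]
      · have hdw : d = e i * w * e s' * a s' := by
          rw [mul_assoc, (h s').left, mul_assoc, ← hw, hd.1.left]
        rcases he.left s' f (e i * w * e s') hr (by rw [mul_assoc, hid]) with ⟨v, hv⟩ | ⟨v, hv⟩
        · refine (hQ s i hi (e s * v * e i) (by simp only [← mul_assoc, hid])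
            (by simp only [mul_assoc, hid]) fun h0 => hf ?_).mpr hQi
          calc f = e s * v * e i * (w * e s') := by
                rw [← hl]
                conv_lhs => rw [hv]
                simp only [mul_assoc]
            _ = 0 := by rw [h0, zero_mul]
        · refine absurd ?_ hd.1.ne_zero
          rw [hdw, hv, mul_assoc, hfa, mul_zero]
    · exact (hQ s t ht (f * a s') (by rw [← mul_assoc, hl]) (by rw [mul_assoc, har]) hfa).mpr hQt

section CentralIdempotents

variable [DecidableEq ι] {γ : Module.End A (CoreGenerator ε)}

/-- The generators of the direct summands of the generator of the Gorenstein core. -/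
def summandUnit (he : IsSerialSystem e) (h : IsCoreFamily e ε a) (s : ι) : CoreGenerator ε :=
  Pi.single s ⟨ε s, (h s).idem he⟩

theorem smul_summandUnit_self (he : IsSerialSystem e) (h : IsCoreFamily e ε a) (s : ι) :
    ε s • h.summandUnit he s = h.summandUnit he s := by
  rw [summandUnit, ← Pi.single_smul]
  exact congrArg _ (Subtype.ext ((h s).idem he))

theorem smul_summandUnit (he : IsSerialSystem e) (h : IsCoreFamily e ε a) (s : ι)
    (x : _root_.leftIdeal (ε s)) : x.1 • h.summandUnit he s = Pi.single s x := by
  rw [summandUnit, ← Pi.single_smul]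
  exact congrArg _ (Subtype.ext x.2)

theorem ext_summandUnit (he : IsSerialSystem e) (h : IsCoreFamily e ε a)
    {f g : Module.End A (CoreGenerator ε)}
    (hfg : ∀ s, f (h.summandUnit he s) = g (h.summandUnit he s)) : f = g :=
  LinearMap.pi_ext fun s x => by rw [← h.smul_summandUnit he, map_smul, map_smul, hfg]

/-- Centrality makes `γ` preserve the summand `A (ε s)`, where it acts by an idempotent of the
corner. Primitivity does the rest. -/
theorem apply_summandUnit (he : IsSerialSystem e) (h : IsCoreFamily e ε a)
    (hγ : γ * γ = γ) (hc : ∀ η, γ * η = η * γ) (s : ι) :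
    γ (h.summandUnit he s) = 0 ∨ γ (h.summandUnit he s) = h.summandUnit he s := by
  have hp : projEndo ε s (h.summandUnit he s) = h.summandUnit he s := by
    rw [projEndo_apply, summandUnit, Pi.single_eq_same]
  set y := γ (h.summandUnit he s) s with hy
  have h1 : γ (h.summandUnit he s) = y.1 • h.summandUnit he s := by
    rw [h.smul_summandUnit he, hy, ← projEndo_apply, ← Module.End.mul_apply, ← hc,
      Module.End.mul_apply, hp]
  have hl : ε s * y.1 = y.1 := by
    have : ε s • y = y := by
      rw [hy, ← Pi.smul_apply, ← map_smul, h.smul_summandUnit_self he]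
    exact congrArg Subtype.val this
  have hyy : y.1 * y.1 = y.1 := by
    have := LinearMap.congr_fun hγ (h.summandUnit he s)
    rw [Module.End.mul_apply, h1, map_smul, h1, h.smul_summandUnit he, ← Pi.single_smul] at this
    exact congrArg Subtype.val (Pi.single_injective s this)
  rcases (h s).target with ⟨h0, -⟩ | ⟨-, t, -, ht⟩
  · left
    have h2 : y.1 = 0 := hl.symm.trans
      ((congrArg (fun r => r * (y.1 : A)) h0).trans (zero_mul _))
    rw [h1, h2, zero_smul]
  · rcases he.prim t y.1 hyy (ht ▸ hl) ((congrArg _ ht.symm).trans y.2) with h2 | h2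
    · left
      rw [h1, h2, zero_smul]
    · right
      rw [h1, h2, ← ht, h.smul_summandUnit_self he]

/-- `x` gives a nonzero map `η` between the two summands, and `γ` commutes with it. -/
theorem apply_summandUnit_ne_zero_iff (he : IsSerialSystem e) (h : IsCoreFamily e ε a)
    (hγ : γ * γ = γ) (hc : ∀ η, γ * η = η * γ) {s t : ι} {x : A} (hl : ε s * x = x)
    (hr : x * ε t = x) (hx : x ≠ 0) :
    γ (h.summandUnit he s) ≠ 0 ↔ γ (h.summandUnit he t) ≠ 0 := by
  let η : Module.End A (CoreGenerator ε) :=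
    LinearMap.single A (fun s => _root_.leftIdeal (ε s)) t ∘ₗ
      LinearMap.toSpanSingleton A (_root_.leftIdeal (ε t)) ⟨x, hr⟩ ∘ₗ
      (_root_.leftIdeal (ε s)).subtype ∘ₗ LinearMap.proj s
  have hη : η (h.summandUnit he s) = x • h.summandUnit he t := by
    rw [h.smul_summandUnit he t ⟨x, hr⟩]
    change (Pi.single t ((h.summandUnit he s s).1 • (⟨x, hr⟩ : _root_.leftIdeal (ε t))) :
      CoreGenerator ε) = _
    rw [summandUnit, Pi.single_eq_same]
    exact congrArg _ (Subtype.ext hl)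
  have hx0 : x • h.summandUnit he t ≠ 0 := by
    rw [h.smul_summandUnit he t ⟨x, hr⟩]
    intro h0
    have h1 := congrFun h0 t
    rw [Pi.single_eq_same] at h1
    exact hx (congrArg Subtype.val h1)
  have key : x • γ (h.summandUnit he t) = η (γ (h.summandUnit he s)) := by
    rw [← map_smul, ← hη, ← Module.End.mul_apply, hc, Module.End.mul_apply]
  constructor
  · intro hs ht
    rw [(h.apply_summandUnit he hγ hc s).resolve_left hs, ht, smul_zero, hη] at key
    exact hx0 key.symm
  · intro ht hs
    rw [(h.apply_summandUnit he hγ hc t).resolve_left ht, hs, map_zero] at key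
    exact hx0 key

theorem apply_summandUnit_ne_zero_iff_of_mem (he : IsSerialSystem e) (h : IsCoreFamily e ε a)
    (hγ : γ * γ = γ) (hc : ∀ η, γ * η = η * γ) {s t : ι} (ht : t ∈ gorensteinIndex e) {x : A}
    (hl : e s * x = x) (hr : x * e t = x) (hx : x ≠ 0) :
    γ (h.summandUnit he s) ≠ 0 ↔ γ (h.summandUnit he t) ≠ 0 := by
  have hid := he.mul_self
  obtain ⟨w, hw⟩ := (h s).generates t ht x hl hr
  -- Since `t` is itself admissible, `e t` factors through `a t`. So passing from `x` to an element
  -- between `ε s` and `ε t` loses nothing.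
  obtain ⟨v, hv⟩ := (h t).generates t ht (e t) (hid t) (hid t)
  refine h.apply_summandUnit_ne_zero_iff he hγ hc (x := ε s * w * a t)
    (by simp only [← mul_assoc, (h s).idem he]) (by rw [mul_assoc, (h t).right]) fun h0 => hx ?_
  calc x = a s * (ε s * w * a t) * v := by
        rw [← hr, hv, ← mul_assoc (a s), ← mul_assoc (a s), (h s).right, ← hw, mul_assoc]
    _ = 0 := by rw [h0, mul_zero, zero_mul]

end CentralIdempotents

theorem isConnectedAlgebra_coreRing [IsNoetherianRing A] (he : IsSerialSystem e)
    (h : IsCoreFamily e ε a) (hA : IsConnectedAlgebra A) {X : Type*}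
    [AddCommGroup X] [Module A X] [Nontrivial X] (hX : IsCoreModule e ε a X) :
    IsConnectedAlgebra (CoreRing ε) := by
  classical
  constructor
  · by_contra hn
    rw [not_nontrivial_iff_subsingleton] at hn
    obtain ⟨x, hx⟩ := exists_ne (0 : X)
    obtain ⟨φ, rfl⟩ := h.exists_linearMap he hX x
    refine hx ?_
    have : (1 : Module.End A (CoreGenerator ε)) = 0 :=
      MulOpposite.op_injective (Subsingleton.elim _ _)
    rw [← Module.End.one_apply (R := A) h.unit, this, LinearMap.zero_apply, map_zero]
  · intro c hc hcc
    have hγ : c.unop * c.unop = c.unop := congrArg MulOpposite.unop hc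
    have hγc : ∀ η, c.unop * η = η * c.unop := fun η =>
      congrArg MulOpposite.unop (Subring.mem_center_iff.mp hcc (MulOpposite.op η))
    have hQ0 : ∀ s, c.unop (h.summandUnit he s) ≠ 0 → a s ≠ 0 := by
      intro s hs h0
      rcases (h s).target with ⟨hε, -⟩ | ⟨ha, -⟩
      · exact hs (by rw [← h.smul_summandUnit_self he, hε, zero_smul, map_zero])
      · exact ha h0
    -- `Q s` says that the central idempotent does not vanish on the `s`-th summand, and hence is
    -- the identity there.
    rcases h.forall_or_forall_not he hA (Q := fun s => c.unop (h.summandUnit he s) ≠ 0) hQ0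
      (fun s t ht x hl hr hx => h.apply_summandUnit_ne_zero_iff_of_mem he hγ hγc ht hl hr hx)
      with h1 | h1
    · right
      apply MulOpposite.unop_injective
      exact h.ext_summandUnit he fun s =>
        (h.apply_summandUnit he hγ hγc s).resolve_left (h1 s)
    · left
      apply MulOpposite.unop_injective
      exact h.ext_summandUnit he fun s => not_not.mp (h1 s)

end IsCoreFamily

end Connected

theorem proposition1 {k : Type v} {Λ : Type u} [CommRing k] [Ring Λ] [Algebra k Λ]
    (hΛ : IsNakayamaAlgebra k Λ)
    (hsimple : ∀ (S : Type u) [AddCommGroup S] [Module Λ S], IsSimpleModule Λ S →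
      ¬ Module.Projective Λ S) :
    IsExactAbelianSubcategory (gorensteinCore Λ) ∧
    (gorensteinCore Λ).IsClosedUnderExtensions ∧
    IsClosedUnderProjectiveCovers (gorensteinCore Λ) ∧
    IsClosedUnderMinimalLeftApproximations (gorensteinCore Λ) ∧
    ∃ (Λ' : Type u) (_ : Ring Λ') (_ : Algebra k Λ'),
      IsNakayamaAlgebra k Λ' ∧ Module.Injective Λ' Λ' ∧
      (∃ e : FGModuleCat.{u} Λ' ≌ (gorensteinCore Λ).FullSubcategory,
        IsLinearOver k e.functor ∧
        ∃ hC : gorensteinCore Λ ≤ gorensteinProj Λ, InducesStableEquivalence hC e.functor) ∧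
      (IsConnectedAlgebra Λ → (∃ M : FGModuleCat.{u} Λ, gorensteinCore Λ M ∧ Nontrivial M) →
        IsConnectedAlgebra Λ') := by
  have := hΛ.artinian
  have := hΛ.finite
  have := hΛ.isArtinianRing
  obtain ⟨n, e, he⟩ := hΛ.exists_isSerialSystem
  choose ε a h using fun s => he.exists_isCoreApproximation (k := k) s
  have h : IsCoreFamily e ε a := h
  refine ⟨h.isExactAbelianSubcategory he, h.isClosedUnderExtensions he,
    h.isClosedUnderProjectiveCovers he, h.isClosedUnderMinimalLeftApproximations he,
    CoreRing ε, inferInstance, inferInstance, h.isNakayamaAlgebra_coreRing he,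
    h.injective_coreRing he, ⟨(h.coreFunctor he).asEquivalence, h.isLinearOver_coreFunctor he,
      gorensteinCore_le_gorensteinProj, h.inducesStableEquivalence_coreFunctor he⟩, ?_⟩
  rintro hconn ⟨M, hM, hnt⟩
  exact h.isConnectedAlgebra_coreRing he hconn ((h.gorensteinCore_iff he).mp hM)
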